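/- **Conventions.** Let $K$ be a field. A $K$-linear tensor category is a $K$-linear additive category with a $K$-bilinear symmetric monoidal structure. It is *pre-Tannakian* if (a) it is abelian and all objects have finite length, (b) all $\mathrm{Hom}$ spaces are finite dimensional over $K$, (c) every object $X$ is rigid, i.e. has a dual $X^\vee$ with evaluation and coevaluation maps satisfying the triangle identities, and (d) $\mathrm{End}(\mathbf 1)=K$ for the unit object $\mathbf 1$. It is *semi-simple* if every object is a finite direct sum of simple objects. Let $k$ be an algebraically closed field of characteristic $0$, let $\mathbf F$ be a finite field with $q$ elements, let $\mathcal E$ be an $\mathbf F$-linear semi-simple pre-Tannakian category, and let $\chi\colon\mathbf F^\times\to k^\times$ be a character. The $k$-linearization $k[\mathcal E]$ has an object $[X]$ for each object $X$ of $\mathcal E$, and $\mathrm{Hom}([X],[Y])$ is the free $k$-module with basis $[f]$, $f\in\mathrm{Hom}_{\mathcal E}(X,Y)$, with $k$-bilinear composition $[f][g]=[fg]$ (in particular $[f+g]\neq[f]+[g]$ in general). Let $k[\mathcal E]^\sharp$ be its additive--Karoubi envelope: the idempotent completion (objects $(M,e)$ with $e^2=e\in\mathrm{End}(M)$) of the category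 of finite tuples of objects of $k[\mathcal E]$ and matrices of morphisms. The tensor product of $\mathcal E$ induces a $k$-bilinear symmetric monoidal structure on $k[\mathcal E]$, with $[X]\otimes[Y]=[X\otimes Y]$ and $[f]\otimes[g]=[f\otimes g]$, and then on $k[\mathcal E]^\sharp$. The monoid algebra $k[\mathbf F]$ of the monoid $(\mathbf F,\cdot)$, with basis $[a]$, $a\in\mathbf F$, acts on every object of $k[\mathcal E]^\sharp$ by natural endomorphisms: $[a]$ acts on $[X]$ as $[a\cdot\mathrm{id}_X]$, diagonally on tuples, and by restriction on $(M,e)$. Put $$e_\chi=-\delta_\chi[0]+\frac1{q-1}\sum_{a\in\mathbf F^\times}\chi(a)^{-1}[a]\in k[\mathbf F],$$ where $\delta_\chi$ is $1$ if $\chi$ is trivial and $0$ otherwise. Let $k[\mathcal E]^\sharp_\chi$ be the full subcategory of $k[\mathcal E]^\sharp$ of the objects $X$ with $X=e_\chi X$, i.e. on which $e_\chi$ acts as the identity. It is closed under the tensor product of $k[\mathcal E]^\sharp$, and with that tensor product and the unit object $e_\chi[\mathbf 1]$ it is a $k$-linear symmetric monoidal category. **Theorem.** The element $e_\chi$ is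 idempotent and $k[\mathcal E]^\sharp_\chi$ is a direct summand of $k[\mathcal E]^\sharp$: there is a full subcategory $\mathcal D$ of $k[\mathcal E]^\sharp$ such that there are no non-zero morphisms between objects of $k[\mathcal E]^\sharp_\chi$ and objects of $\mathcal D$, in either direction, and every object of $k[\mathcal E]^\sharp$ is a direct sum of an object of $k[\mathcal E]^\sharp_\chi$ and an object of $\mathcal D$. With the tensor product above, $k[\mathcal E]^\sharp_\chi$ is a $k$-linear semi-simple pre-Tannakian category. -/

import Mathlib

open CategoryTheory MonoidalCategory Limits Idempotents

universe w v u

namespace LinPT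

noncomputable section

set_option linter.unusedVariables false

/-- The objects of the `k`-linearization `k[E]` of a category `E` are the objects of `E`;
`⟨X⟩ : Lin k E` is the object usually written `[X]`. -/
structure Lin (k : Type w) (E : Type u) where
  as : E

namespace Lin

variable {k : Type w} [CommRing k] {E : Type u} [Category.{v} E]

/-- `Hom([X], [Y])` is the free `k`-module on `Hom(X, Y)`, and composition is the `k`-bilinear
extension of the composition of `E`. -/
instance : Category (Lin k E) where
  Hom X Y := (X.as ⟶ Y.as) →₀ k
  id X := Finsupp.single (𝟙 X.as) 1
  comp f g := f.sum fun φ r => g.sum fun ψ s => Finsupp.single (φ ≫ ψ) (r * s)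
  id_comp f := by simp [-Finsupp.single_mul]
  comp_id f := by simp [-Finsupp.single_mul]
  assoc f g h := by
    simp [-Finsupp.single_mul, Finsupp.sum_sum_index, add_mul, mul_add, Category.assoc, mul_assoc]

instance homGroup (X Y : Lin k E) : AddCommGroup (X ⟶ Y) :=
  inferInstanceAs (AddCommGroup ((X.as ⟶ Y.as) →₀ k))

instance homModule (X Y : Lin k E) : Module k (X ⟶ Y) :=
  inferInstanceAs (Module k ((X.as ⟶ Y.as) →₀ k))

/-- The identification of `Hom([X], [Y])` with the free module on `Hom(X, Y)`. -/
def coeffs (X Y : Lin k E) : (X ⟶ Y) ≃ₗ[k] ((X.as ⟶ Y.as) →₀ k) :=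
  LinearEquiv.refl k ((X.as ⟶ Y.as) →₀ k)

/-- The morphism `r [φ]` of `k[E]`. -/
def single {X Y : Lin k E} (φ : X.as ⟶ Y.as) (r : k) : X ⟶ Y :=
  (coeffs X Y).symm (Finsupp.single φ r)

theorem coeffs_single {X Y : Lin k E} (φ : X.as ⟶ Y.as) (r : k) :
    coeffs X Y (single φ r) = Finsupp.single φ r := rfl

theorem comp_eq {X Y Z : Lin k E} (f : X ⟶ Y) (g : Y ⟶ Z) :
    f ≫ g = (coeffs X Y f).sum fun φ r => (coeffs Y Z g).sum fun ψ s =>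
      single (φ ≫ ψ) (r * s) := rfl

@[elab_as_elim]
theorem ind {X Y : Lin k E} {p : (X ⟶ Y) → Prop}
    (f : X ⟶ Y) (h0 : p 0)
    (ha : ∀ f g, p f → p g → p (f + g)) (hs : ∀ φ r, p (single φ r)) : p f :=
  Finsupp.induction_linear (motive := p) f h0 ha hs

theorem single_add {X Y : Lin k E} (φ : X.as ⟶ Y.as) (r s : k) :
    single φ (r + s) = single (X := X) (Y := Y) φ r + single φ s :=
  Finsupp.single_add φ r s

theorem single_zero {X Y : Lin k E} (φ : X.as ⟶ Y.as) :
    single (X := X) (Y := Y) φ (0 : k) = 0 :=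
  Finsupp.single_zero φ

@[simp]
theorem smul_single {X Y : Lin k E} (φ : X.as ⟶ Y.as) (r s : k) :
    s • single (X := X) (Y := Y) φ r = single φ (s * r) :=
  Finsupp.smul_single s φ r

theorem single_id (X : Lin k E) : single (𝟙 X.as) (1 : k) = 𝟙 X := rfl

theorem add_comp_aux {X Y Z : Lin k E} (f f' : X ⟶ Y) (g : Y ⟶ Z) :
    (f + f') ≫ g = f ≫ g + f' ≫ g := by
  rw [comp_eq, comp_eq, comp_eq, map_add]
  refine Finsupp.sum_add_index' (fun φ => ?_) (fun φ r s => ?_)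
  · simp [single_zero]
  · simp [add_mul, single_add, Finsupp.sum_add]

theorem comp_add_aux {X Y Z : Lin k E} (f : X ⟶ Y) (g g' : Y ⟶ Z) :
    f ≫ (g + g') = f ≫ g + f ≫ g' := by
  have hz : ∀ h : Y ⟶ Z, (0 : X ⟶ Y) ≫ h = 0 := fun h => Finsupp.sum_zero_index
  have hs : ∀ (φ : X.as ⟶ Y.as) (r : k) (h : Y ⟶ Z), single φ r ≫ h =
      (coeffs Y Z h).sum fun ψ s => single (X := X) (Y := Z) (φ ≫ ψ) (r * s) := fun φ r h => by
    rw [comp_eq, coeffs_single]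
    exact Finsupp.sum_single_index (by simp [single_zero])
  refine ind f ?_ ?_ ?_
  · rw [hz, hz, hz, add_zero]
  · intro f f' hf hf'
    rw [add_comp_aux, add_comp_aux, add_comp_aux, hf, hf', add_add_add_comm]
  · intro φ r
    rw [hs, hs, hs, map_add]
    refine Finsupp.sum_add_index' (fun ψ => ?_) (fun ψ r s => ?_)
    · simp [single_zero]
    · simp [mul_add, single_add]

instance : Preadditive (Lin k E) where
  homGroup := homGroup
  add_comp _ _ _ f f' g := add_comp_aux f f' g
  comp_add _ _ _ f g g' := comp_add_aux f g g'

@[simp]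
theorem single_comp {X Y Z : Lin k E} (φ : X.as ⟶ Y.as) (ψ : Y.as ⟶ Z.as) (r s : k) :
    single φ r ≫ single ψ s = single (X := X) (Y := Z) (φ ≫ ψ) (r * s) := by
  rw [comp_eq, coeffs_single, coeffs_single]
  simp [single_zero]

instance : Linear k (Lin k E) where
  homModule := homModule
  smul_comp X Y Z r f g := by
    refine ind f ?_ ?_ ?_
    · simp
    · intro f f' hf hf'
      simp only [smul_add, Preadditive.add_comp, hf, hf']
    intro φ s
    refine ind g ?_ ?_ ?_
    · simp
    · intro g g' hg hg'
      simp only [smul_add, Preadditive.comp_add, hg, hg']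
    intro ψ t
    simp [mul_assoc]
  comp_smul X Y Z f r g := by
    refine ind f ?_ ?_ ?_
    · simp
    · intro f f' hf hf'
      simp only [smul_add, Preadditive.add_comp, hf, hf']
    intro φ s
    refine ind g ?_ ?_ ?_
    · simp
    · intro g g' hg hg'
      simp only [smul_add, Preadditive.comp_add, hg, hg']
    intro ψ t
    simp [mul_left_comm]

/-- The `k`-linear map on morphisms of `k[E]` induced by a map on morphisms of `E`. -/
def map {X Y X' Y' : Lin k E} (t : (X.as ⟶ Y.as) → (X'.as ⟶ Y'.as)) :
    (X ⟶ Y) →ₗ[k] (X' ⟶ Y') :=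
  (coeffs X' Y').symm.toLinearMap ∘ₗ Finsupp.lmapDomain k k t ∘ₗ (coeffs X Y).toLinearMap

@[simp]
theorem map_single {X Y X' Y' : Lin k E} (t : (X.as ⟶ Y.as) → (X'.as ⟶ Y'.as))
    (φ : X.as ⟶ Y.as) (r : k) :
    map t (single (X := X) (Y := Y) φ r) = single (X := X') (Y := Y') (t φ) r :=
  Finsupp.mapDomain_single

/-- An isomorphism of `E` as an isomorphism of `k[E]`. -/
@[simps]
def iso {X Y : Lin k E} (φ : X.as ≅ Y.as) : X ≅ Y where
  hom := single φ.hom 1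
  inv := single φ.inv 1
  hom_inv_id := by simp [single_id]
  inv_hom_id := by simp [single_id]

section Monoidal

variable [MonoidalCategory E]

/-- The tensor product of `k[E]`: on objects `[X] ⊗ [Y] = [X ⊗ Y]`, and on morphisms the
`k`-bilinear extension of the tensor product of `E`. -/
instance : MonoidalCategoryStruct (Lin k E) where
  tensorObj X Y := ⟨X.as ⊗ Y.as⟩
  whiskerLeft X _ _ f := map (fun φ => X.as ◁ φ) f
  whiskerRight f Y := map (fun φ => φ ▷ Y.as) f
  tensorUnit := ⟨𝟙_ E⟩
  associator X Y Z := iso (α_ X.as Y.as Z.as)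
  leftUnitor X := iso (λ_ X.as)
  rightUnitor X := iso (ρ_ X.as)

theorem whiskerLeft_eq (X : Lin k E) {Y Z : Lin k E} (f : Y ⟶ Z) :
    X ◁ f = map (X' := X ⊗ Y) (Y' := X ⊗ Z) (fun φ => X.as ◁ φ) f := rfl

theorem whiskerRight_eq {Y Z : Lin k E} (f : Y ⟶ Z) (X : Lin k E) :
    f ▷ X = map (X' := Y ⊗ X) (Y' := Z ⊗ X) (fun φ => φ ▷ X.as) f := rfl

theorem tensorHom_eq {X Y Z W : Lin k E} (f : X ⟶ Y) (g : Z ⟶ W) :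
    f ⊗ₘ g = (f ▷ Z) ≫ (Y ◁ g) := rfl

@[simp]
theorem whiskerLeft_single (X : Lin k E) {Y Z : Lin k E} (φ : Y.as ⟶ Z.as) (r : k) :
    X ◁ single (X := Y) (Y := Z) φ r = single (X := X ⊗ Y) (Y := X ⊗ Z) (X.as ◁ φ) r :=
  map_single _ _ _

@[simp]
theorem single_whiskerRight (X : Lin k E) {Y Z : Lin k E} (φ : Y.as ⟶ Z.as) (r : k) :
    single (X := Y) (Y := Z) φ r ▷ X = single (X := Y ⊗ X) (Y := Z ⊗ X) (φ ▷ X.as) r :=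
  map_single _ _ _

@[simp]
theorem single_tensor {X Y Z W : Lin k E} (φ : X.as ⟶ Y.as) (ψ : Z.as ⟶ W.as) (r s : k) :
    single φ r ⊗ₘ single ψ s = single (X := X ⊗ Z) (Y := Y ⊗ W) (φ ⊗ₘ ψ) (r * s) := by
  rw [tensorHom_eq, whiskerLeft_single, single_whiskerRight, single_comp,
    MonoidalCategory.tensorHom_def]

theorem add_tensor {X Y Z W : Lin k E} (f f' : X ⟶ Y) (g : Z ⟶ W) :
    (f + f') ⊗ₘ g = f ⊗ₘ g + f' ⊗ₘ g := by
  simp only [tensorHom_eq, whiskerRight_eq, map_add, Preadditive.add_comp]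

theorem tensor_add {X Y Z W : Lin k E} (f : X ⟶ Y) (g g' : Z ⟶ W) :
    f ⊗ₘ (g + g') = f ⊗ₘ g + f ⊗ₘ g' := by
  simp only [tensorHom_eq, whiskerLeft_eq, map_add, Preadditive.comp_add]

theorem zero_tensor {X Y Z W : Lin k E} (g : Z ⟶ W) :
    (0 : X ⟶ Y) ⊗ₘ g = 0 := by
  simp only [tensorHom_eq, whiskerRight_eq, map_zero, zero_comp]

theorem tensor_zero {X Y Z W : Lin k E} (f : X ⟶ Y) :
    f ⊗ₘ (0 : Z ⟶ W) = 0 := by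
  simp only [tensorHom_eq, whiskerLeft_eq, map_zero, comp_zero]

theorem associator_hom (X Y Z : Lin k E) :
    (α_ X Y Z).hom = single (X := (X ⊗ Y) ⊗ Z) (Y := X ⊗ (Y ⊗ Z)) (α_ X.as Y.as Z.as).hom 1 := rfl

theorem associator_inv (X Y Z : Lin k E) :
    (α_ X Y Z).inv = single (X := X ⊗ (Y ⊗ Z)) (Y := (X ⊗ Y) ⊗ Z) (α_ X.as Y.as Z.as).inv 1 := rfl

theorem leftUnitor_hom (X : Lin k E) :
    (λ_ X).hom = single (X := 𝟙_ (Lin k E) ⊗ X) (Y := X) (λ_ X.as).hom 1 := rfl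

theorem rightUnitor_hom (X : Lin k E) :
    (ρ_ X).hom = single (X := X ⊗ 𝟙_ (Lin k E)) (Y := X) (ρ_ X.as).hom 1 := rfl

instance : MonoidalCategory (Lin k E) :=
  MonoidalCategory.ofTensorHom
    (id_tensorHom_id := fun X Y => by
      rw [← single_id, ← single_id, single_tensor, MonoidalCategory.id_tensorHom_id, mul_one]
      exact single_id (X ⊗ Y))
    (id_tensorHom := fun X {Y Z} f => by
      refine ind f ?_ ?_ ?_
      · rw [tensor_zero, whiskerLeft_eq, map_zero]
      · intro f g hf hg
        rw [tensor_add, hf, hg, whiskerLeft_eq, whiskerLeft_eq, whiskerLeft_eq, map_add]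
      · intro φ r
        rw [← single_id, single_tensor, whiskerLeft_single, MonoidalCategory.id_tensorHom, one_mul])
    (tensorHom_id := fun {Y Z} f X => by
      refine ind f ?_ ?_ ?_
      · rw [zero_tensor, whiskerRight_eq, map_zero]
      · intro f g hf hg
        rw [add_tensor, hf, hg, whiskerRight_eq, whiskerRight_eq, whiskerRight_eq, map_add]
      · intro φ r
        rw [← single_id, single_tensor, single_whiskerRight, MonoidalCategory.tensorHom_id,
          mul_one])
    (tensorHom_comp_tensorHom := fun {X₁ Y₁ Z₁ X₂ Y₂ Z₂} f₁ f₂ g₁ g₂ => by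
      refine ind f₁ ?_ ?_ ?_
      · rw [zero_tensor, zero_comp, zero_comp, zero_tensor]
      · intro f g hf hg
        rw [add_tensor, Preadditive.add_comp, Preadditive.add_comp, add_tensor, hf, hg]
      intro φ₁ r₁
      refine ind f₂ ?_ ?_ ?_
      · rw [tensor_zero, zero_comp, zero_comp, tensor_zero]
      · intro f g hf hg
        rw [tensor_add, Preadditive.add_comp, Preadditive.add_comp, tensor_add, hf, hg]
      intro φ₂ r₂
      refine ind g₁ ?_ ?_ ?_
      · rw [zero_tensor, comp_zero, comp_zero, zero_tensor]
      · intro f g hf hg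
        rw [add_tensor, Preadditive.comp_add, Preadditive.comp_add, add_tensor, hf, hg]
      intro ψ₁ s₁
      refine ind g₂ ?_ ?_ ?_
      · rw [tensor_zero, comp_zero, comp_zero, tensor_zero]
      · intro f g hf hg
        rw [tensor_add, Preadditive.comp_add, Preadditive.comp_add, tensor_add, hf, hg]
      intro ψ₂ s₂
      rw [single_tensor, single_tensor, single_comp, single_comp, single_comp, single_tensor,
        MonoidalCategory.tensorHom_comp_tensorHom, mul_mul_mul_comm])
    (associator_naturality := fun {X₁ X₂ X₃ Y₁ Y₂ Y₃} f₁ f₂ f₃ => by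
      refine ind f₁ ?_ ?_ ?_
      · rw [zero_tensor, zero_tensor, zero_comp, zero_tensor, comp_zero]
      · intro f g hf hg
        rw [add_tensor, add_tensor, Preadditive.add_comp, add_tensor, Preadditive.comp_add, hf, hg]
      intro φ₁ r₁
      refine ind f₂ ?_ ?_ ?_
      · rw [tensor_zero, zero_tensor, zero_comp, zero_tensor, tensor_zero, comp_zero]
      · intro f g hf hg
        rw [tensor_add, add_tensor, Preadditive.add_comp, add_tensor,
          tensor_add, Preadditive.comp_add, hf, hg]
      intro φ₂ r₂
      refine ind f₃ ?_ ?_ ?_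
      · rw [tensor_zero, zero_comp, tensor_zero, tensor_zero, comp_zero]
      · intro f g hf hg
        rw [tensor_add, Preadditive.add_comp, tensor_add,
          tensor_add, Preadditive.comp_add, hf, hg]
      intro φ₃ r₃
      rw [single_tensor, single_tensor, single_tensor, single_tensor, associator_hom,
        associator_hom, single_comp, single_comp, MonoidalCategory.associator_naturality,
        mul_one, one_mul, mul_assoc])
    (leftUnitor_naturality := fun {X Y} f => by
      refine ind f ?_ ?_ ?_
      · rw [tensor_zero, zero_comp, comp_zero]
      · intro f g hf hg
        rw [tensor_add, Preadditive.add_comp, Preadditive.comp_add, hf, hg]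
      intro φ r
      rw [← single_id, single_tensor, leftUnitor_hom, leftUnitor_hom, single_comp, single_comp,
        one_mul, mul_one, MonoidalCategory.id_tensorHom]
      exact congrArg (fun t => single t r) (MonoidalCategory.leftUnitor_naturality φ))
    (rightUnitor_naturality := fun {X Y} f => by
      refine ind f ?_ ?_ ?_
      · rw [zero_tensor, zero_comp, comp_zero]
      · intro f g hf hg
        rw [add_tensor, Preadditive.add_comp, Preadditive.comp_add, hf, hg]
      intro φ r
      rw [← single_id, single_tensor, rightUnitor_hom, rightUnitor_hom, single_comp, single_comp,
        mul_one, mul_one, one_mul, MonoidalCategory.tensorHom_id]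
      exact congrArg (fun t => single t r) (MonoidalCategory.rightUnitor_naturality φ))
    (pentagon := fun W X Y Z => by
      simp only [associator_hom, ← single_id, single_tensor, single_comp, mul_one,
        MonoidalCategory.tensorHom_id, MonoidalCategory.id_tensorHom]
      exact congrArg (fun t => single t (1 : k)) (MonoidalCategory.pentagon W.as X.as Y.as Z.as))
    (triangle := fun X Y => by
      simp only [associator_hom, leftUnitor_hom, rightUnitor_hom, ← single_id, single_tensor,
        single_comp, mul_one, MonoidalCategory.tensorHom_id, MonoidalCategory.id_tensorHom]
      exact congrArg (fun t => single t (1 : k)) (MonoidalCategory.triangle X.as Y.as))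

instance : MonoidalPreadditive (Lin k E) where
  whiskerLeft_zero := map_zero (map _)
  zero_whiskerRight := map_zero (map _)
  whiskerLeft_add := map_add (map _)
  add_whiskerRight := map_add (map _)

instance : MonoidalLinear k (Lin k E) where
  whiskerLeft_smul _ _ _ := map_smul (map _)
  smul_whiskerRight r _ _ f _ := map_smul (map _) r f

instance [SymmetricCategory E] : SymmetricCategory (Lin k E) where
  braiding X Y := iso (X := X ⊗ Y) (Y := Y ⊗ X) (β_ X.as Y.as)
  braiding_naturality_right X {Y Z} f := by
    refine ind f ?_ ?_ ?_
    · simp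
    · intro f g hf hg
      simp only [MonoidalPreadditive.whiskerLeft_add, MonoidalPreadditive.add_whiskerRight,
        Preadditive.add_comp, Preadditive.comp_add, hf, hg]
    intro φ r
    rw [iso_hom, iso_hom, whiskerLeft_single, single_whiskerRight, single_comp, single_comp,
      mul_one, one_mul]
    exact congrArg (fun t => single t r) (BraidedCategory.braiding_naturality_right X.as φ)
  braiding_naturality_left {Y Z} f X := by
    refine ind f ?_ ?_ ?_
    · simp
    · intro f g hf hg
      simp only [MonoidalPreadditive.whiskerLeft_add, MonoidalPreadditive.add_whiskerRight,
        Preadditive.add_comp, Preadditive.comp_add, hf, hg]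
    intro φ r
    rw [iso_hom, iso_hom, whiskerLeft_single, single_whiskerRight, single_comp, single_comp,
      mul_one, one_mul]
    exact congrArg (fun t => single t r) (BraidedCategory.braiding_naturality_left φ X.as)
  hexagon_forward X Y Z := by
    simp only [iso_hom, associator_hom, whiskerLeft_single, single_whiskerRight, single_comp,
      mul_one]
    exact congrArg (fun t => single t (1 : k)) (BraidedCategory.hexagon_forward X.as Y.as Z.as)
  hexagon_reverse X Y Z := by
    simp only [iso_hom, associator_inv, whiskerLeft_single, single_whiskerRight, single_comp,
      mul_one]
    exact congrArg (fun t => single t (1 : k)) (BraidedCategory.hexagon_reverse X.as Y.as Z.as)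
  symmetry X Y := by
    simp only [iso_hom, single_comp, mul_one]
    rw [← single_id]
    exact congrArg (fun t => single t (1 : k)) (SymmetricCategory.symmetry X.as Y.as)

end Monoidal

end Lin
/-- Endomorphisms of the identity functor of a category. -/
structure IdEnd (C : Type u) [Category.{v} C] where
  app : ∀ X : C, X ⟶ X
  naturality : ∀ {X Y : C} (f : X ⟶ Y), f ≫ app Y = app X ≫ f

/-- An idempotent endomorphism `τ` of the identity functor of a monoidal category such that
`τ_{X ⊗ Y} = τ_X ⊗ Y = X ⊗ τ_Y`. -/
class IdEnd.IsTensorIdempotent {C : Type u} [Category.{v} C] [MonoidalCategory C] (τ : IdEnd C) :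
    Prop where
  idem : ∀ X : C, τ.app X ≫ τ.app X = τ.app X
  app_tensor_left : ∀ X Y : C, τ.app (X ⊗ Y) = τ.app X ▷ Y
  app_tensor_right : ∀ X Y : C, τ.app (X ⊗ Y) = X ◁ τ.app Y

namespace AddEnv

variable {C : Type u} [Category.{v} C] [Preadditive C]

section Linear

variable {k : Type w} [Ring k] [Linear k C]

instance homModule (M N : Mat_ C) : Module k (M ⟶ N) :=
  inferInstanceAs (Module k (∀ i j, M.X i ⟶ N.X j))

@[simp]
theorem smul_apply {M N : Mat_ C} (r : k) (f : M ⟶ N) (i : M.ι) (j : N.ι) :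
    (r • f) i j = r • f i j := rfl

instance : Linear k (Mat_ C) where
  homModule := homModule
  smul_comp M N K r f g := by
    apply Mat_.hom_ext
    intro i j
    simp [Finset.smul_sum]
  comp_smul M N K f r g := by
    apply Mat_.hom_ext
    intro i j
    simp [Finset.smul_sum]

end Linear

theorem zero_apply {M N : Mat_ C} (i : M.ι) (j : N.ι) : (0 : M ⟶ N) i j = 0 := rfl

open scoped Classical in
/-- The morphism of tuples whose matrix is supported on the graph of a map of the index sets. -/
def perm {M N : Mat_ C} (e : M.ι → N.ι) (φ : ∀ i, M.X i ⟶ N.X (e i)) : M ⟶ N :=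
  fun i j => if h : e i = j then φ i ≫ eqToHom (congrArg N.X h) else 0

theorem perm_apply {M N : Mat_ C} (e : M.ι → N.ι) (φ : ∀ i, M.X i ⟶ N.X (e i)) (i : M.ι) :
    perm e φ i (e i) = φ i := by
  simp [perm]

theorem perm_apply_ne {M N : Mat_ C} (e : M.ι → N.ι) (φ : ∀ i, M.X i ⟶ N.X (e i)) (i : M.ι)
    (j : N.ι) (h : e i ≠ j) : perm e φ i j = 0 := by
  simp [perm, h]

theorem perm_comp_apply {M N K : Mat_ C} (e : M.ι → N.ι) (φ : ∀ i, M.X i ⟶ N.X (e i)) (g : N ⟶ K)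
    (i : M.ι) (l : K.ι) : (perm e φ ≫ g) i l = φ i ≫ g (e i) l := by
  rw [Mat_.comp_apply, Finset.sum_eq_single (e i), perm_apply]
  · intro j _ hj
    rw [perm_apply_ne _ _ _ _ hj.symm, zero_comp]
  · intro h
    exact absurd (Finset.mem_univ _) h

theorem comp_perm_apply {M N K : Mat_ C} (e : N.ι → K.ι) (he : e.Injective)
    (φ : ∀ i, N.X i ⟶ K.X (e i)) (g : M ⟶ N)
    (i : M.ι) (j : N.ι) : (g ≫ perm e φ) i (e j) = g i j ≫ φ j := by
  rw [Mat_.comp_apply, Finset.sum_eq_single j, perm_apply]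
  · intro l _ hl
    rw [perm_apply_ne _ _ _ _ (fun h => hl (he h)), comp_zero]
  · intro h
    exact absurd (Finset.mem_univ _) h

theorem perm_ext {M N : Mat_ C} {ι : Type} (e : ι → N.ι) (he : e.Surjective) {f g : M ⟶ N}
    (h : ∀ i j, f i (e j) = g i (e j)) : f = g := by
  apply Mat_.hom_ext
  intro i j
  obtain ⟨j, rfl⟩ := he j
  exact h i j

theorem perm_comp_perm {M N K : Mat_ C} (e : M.ι → N.ι) (φ : ∀ i, M.X i ⟶ N.X (e i))
    (e' : N.ι → K.ι) (φ' : ∀ i, N.X i ⟶ K.X (e' i)) :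
    perm e φ ≫ perm e' φ' = perm (fun i => e' (e i)) (fun i => φ i ≫ φ' (e i)) := by
  apply Mat_.hom_ext
  intro i j
  rw [perm_comp_apply]
  by_cases h : e' (e i) = j
  · subst h
    rw [perm_apply, perm_apply (fun i => e' (e i)) (fun i => φ i ≫ φ' (e i)) i]
  · rw [perm_apply_ne _ _ _ _ h, comp_zero]
    exact (perm_apply_ne (fun i => e' (e i)) (fun i => φ i ≫ φ' (e i)) i j h).symm

theorem id_eq_perm (M : Mat_ C) : 𝟙 M = perm (fun i => i) (fun i => 𝟙 (M.X i)) := by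
  apply Mat_.hom_ext
  intro i j
  simp [Mat_.id_apply, perm]

section Monoidal

variable [MonoidalCategory C]

/-- The tensor product of the additive envelope: `(X_i) ⊗ (Y_j) = (X_i ⊗ Y_j)`, and on morphisms
the Kronecker product of matrices. -/
instance : MonoidalCategoryStruct (Mat_ C) where
  tensorObj M N := { ι := M.ι × N.ι, X := fun p => M.X p.1 ⊗ N.X p.2 }
  tensorHom f g := fun p q => f p.1 q.1 ⊗ₘ g p.2 q.2
  whiskerLeft M _ _ f := fun p q => (𝟙 M : M ⟶ M) p.1 q.1 ⊗ₘ f p.2 q.2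
  whiskerRight f K := fun p q => f p.1 q.1 ⊗ₘ (𝟙 K : K ⟶ K) p.2 q.2
  tensorUnit := { ι := PUnit, X := fun _ => 𝟙_ C }
  associator M N K :=
    { hom := perm (fun p => (p.1.1, (p.1.2, p.2)))
        (fun p => (α_ (M.X p.1.1) (N.X p.1.2) (K.X p.2)).hom)
      inv := perm (fun p => ((p.1, p.2.1), p.2.2))
        (fun p => (α_ (M.X p.1) (N.X p.2.1) (K.X p.2.2)).inv)
      hom_inv_id := by
        refine (perm_comp_perm _ _ _ _).trans (Eq.trans ?_ (id_eq_perm _).symm)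
        exact congrArg (perm (fun i => i)) (funext fun p => Iso.hom_inv_id _)
      inv_hom_id := by
        refine (perm_comp_perm _ _ _ _).trans (Eq.trans ?_ (id_eq_perm _).symm)
        exact congrArg (perm (fun i => i)) (funext fun p => Iso.inv_hom_id _) }
  leftUnitor M :=
    { hom := perm (fun p => p.2) (fun p => (λ_ (M.X p.2)).hom)
      inv := perm (fun i => (PUnit.unit, i)) (fun i => (λ_ (M.X i)).inv)
      hom_inv_id := by
        refine (perm_comp_perm _ _ _ _).trans (Eq.trans ?_ (id_eq_perm _).symm)
        exact congrArg (perm (fun i => i)) (funext fun p => Iso.hom_inv_id _)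
      inv_hom_id := by
        refine (perm_comp_perm _ _ _ _).trans (Eq.trans ?_ (id_eq_perm _).symm)
        exact congrArg (perm (fun i => i)) (funext fun p => Iso.inv_hom_id _) }
  rightUnitor M :=
    { hom := perm (fun p => p.1) (fun p => (ρ_ (M.X p.1)).hom)
      inv := perm (fun i => (i, PUnit.unit)) (fun i => (ρ_ (M.X i)).inv)
      hom_inv_id := by
        refine (perm_comp_perm _ _ _ _).trans (Eq.trans ?_ (id_eq_perm _).symm)
        exact congrArg (perm (fun i => i)) (funext fun p => Iso.hom_inv_id _)
      inv_hom_id := by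
        refine (perm_comp_perm _ _ _ _).trans (Eq.trans ?_ (id_eq_perm _).symm)
        exact congrArg (perm (fun i => i)) (funext fun p => Iso.inv_hom_id _) }

theorem tensor_apply {M N K L : Mat_ C} (f : M ⟶ N) (g : K ⟶ L) (p : (M ⊗ K).ι)
    (q : (N ⊗ L).ι) : (f ⊗ₘ g) p q = f p.1 q.1 ⊗ₘ g p.2 q.2 := rfl

theorem id_tensor (M : Mat_ C) {K L : Mat_ C} (g : K ⟶ L) : 𝟙 M ⊗ₘ g = M ◁ g := rfl

theorem tensor_id {K L : Mat_ C} (g : K ⟶ L) (M : Mat_ C) : g ⊗ₘ 𝟙 M = g ▷ M := rfl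

theorem associator_hom (M N K : Mat_ C) :
    (α_ M N K).hom = perm (M := (M ⊗ N) ⊗ K) (N := M ⊗ (N ⊗ K)) (fun p => (p.1.1, (p.1.2, p.2)))
        (fun p => (α_ (M.X p.1.1) (N.X p.1.2) (K.X p.2)).hom) := rfl

theorem associator_inv (M N K : Mat_ C) :
    (α_ M N K).inv = perm (M := M ⊗ (N ⊗ K)) (N := (M ⊗ N) ⊗ K)
      (fun p => ((p.1, p.2.1), p.2.2))
        (fun p => (α_ (M.X p.1) (N.X p.2.1) (K.X p.2.2)).inv) := rfl

theorem leftUnitor_hom (M : Mat_ C) :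
    (λ_ M).hom = perm (M := 𝟙_ (Mat_ C) ⊗ M) (N := M) (fun p => p.2)
      (fun p => (λ_ (M.X p.2)).hom) := rfl

theorem rightUnitor_hom (M : Mat_ C) :
    (ρ_ M).hom = perm (M := M ⊗ 𝟙_ (Mat_ C)) (N := M) (fun p => p.1)
      (fun p => (ρ_ (M.X p.1)).hom) := rfl

theorem whiskerLeft_apply (M : Mat_ C) {K L : Mat_ C} (f : K ⟶ L) (p : (M ⊗ K).ι)
    (q : (M ⊗ L).ι) : (M ◁ f) p q = (𝟙 M : M ⟶ M) p.1 q.1 ⊗ₘ f p.2 q.2 := rfl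

theorem whiskerRight_apply (M : Mat_ C) {K L : Mat_ C} (f : K ⟶ L) (p : (K ⊗ M).ι)
    (q : (L ⊗ M).ι) : (f ▷ M) p q = f p.1 q.1 ⊗ₘ (𝟙 M : M ⟶ M) p.2 q.2 := rfl

variable [MonoidalPreadditive C]

theorem perm_tensor_perm {M N K L : Mat_ C} (e : M.ι → N.ι) (φ : ∀ i, M.X i ⟶ N.X (e i))
    (e' : K.ι → L.ι) (φ' : ∀ i, K.X i ⟶ L.X (e' i)) :
    perm e φ ⊗ₘ perm e' φ' = perm (M := M ⊗ K) (N := N ⊗ L) (fun p => (e p.1, e' p.2))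
      (fun p => φ p.1 ⊗ₘ φ' p.2) := by
  apply Mat_.hom_ext
  rintro ⟨i, i'⟩ ⟨j, j'⟩
  rw [tensor_apply]
  by_cases h1 : e i = j
  · by_cases h2 : e' i' = j'
    · subst h1 h2
      rw [perm_apply, perm_apply]
      exact (perm_apply (M := M ⊗ K) (N := N ⊗ L) (fun p => (e p.1, e' p.2))
        (fun p => φ p.1 ⊗ₘ φ' p.2) (i, i')).symm
    · rw [perm_apply_ne e' _ _ _ h2, MonoidalPreadditive.tensor_zero, perm_apply_ne]
      exact fun h => h2 (congrArg Prod.snd h)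
  · rw [perm_apply_ne e _ _ _ h1, MonoidalPreadditive.zero_tensor, perm_apply_ne]
    exact fun h => h1 (congrArg Prod.fst h)

instance : MonoidalCategory (Mat_ C) :=
  MonoidalCategory.ofTensorHom
    (id_tensorHom_id := fun M N => by
      rw [id_eq_perm, id_eq_perm, perm_tensor_perm, id_eq_perm]
      exact congrArg (perm (fun i => i)) (funext fun p => MonoidalCategory.id_tensorHom_id _ _))
    (id_tensorHom := fun _ _ _ _ => rfl)
    (tensorHom_id := fun _ _ => rfl)
    (tensorHom_comp_tensorHom := fun {X₁ Y₁ Z₁ X₂ Y₂ Z₂} f₁ f₂ g₁ g₂ => by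
      apply Mat_.hom_ext
      rintro ⟨i, i'⟩ ⟨j, j'⟩
      rw [tensor_apply, Mat_.comp_apply, Mat_.comp_apply, Mat_.comp_apply, sum_tensor]
      simp only [tensor_sum, ← MonoidalCategory.tensorHom_comp_tensorHom]
      exact Fintype.sum_prod_type _)
    (associator_naturality := fun {X₁ X₂ X₃ Y₁ Y₂ Y₃} f₁ f₂ f₃ => by
      apply perm_ext (M := (X₁ ⊗ X₂) ⊗ X₃) (N := Y₁ ⊗ (Y₂ ⊗ Y₃)) (fun p : (Y₁.ι × Y₂.ι) × Y₃.ι => (p.1.1, (p.1.2, p.2)))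
        (fun q => ⟨((q.1, q.2.1), q.2.2), rfl⟩)
      intro p q
      rw [associator_hom, associator_hom, perm_comp_apply, comp_perm_apply _
        (fun a b h => Prod.ext (Prod.ext (Prod.mk.inj h).1 (Prod.mk.inj (Prod.mk.inj h).2).1)
          (Prod.mk.inj (Prod.mk.inj h).2).2)]
      exact MonoidalCategory.associator_naturality _ _ _)
    (leftUnitor_naturality := fun {X Y} f => by
      apply Mat_.hom_ext
      intro p q
      refine (comp_perm_apply (M := 𝟙_ (Mat_ C) ⊗ X) (N := 𝟙_ (Mat_ C) ⊗ Y) (K := Y) (fun p => p.2)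
        (fun a b h => Prod.ext rfl h) (fun p => (λ_ (Y.X p.2)).hom) _ p (PUnit.unit, q)).trans
        (Eq.trans ?_ (perm_comp_apply (M := 𝟙_ (Mat_ C) ⊗ X) (N := X) (fun p => p.2) _ _ _ _).symm)
      have h : (𝟙 (𝟙_ (Mat_ C)) : 𝟙_ (Mat_ C) ⟶ 𝟙_ (Mat_ C)) p.1 PUnit.unit = 𝟙 (𝟙_ C) :=
        Mat_.id_apply_self _ _
      rw [tensor_apply, h]
      exact (congrArg (fun t => t ≫ (λ_ (Y.X q)).hom) (MonoidalCategory.id_tensorHom (𝟙_ C)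
        (f p.2 q))).trans (MonoidalCategory.leftUnitor_naturality _))
    (rightUnitor_naturality := fun {X Y} f => by
      apply Mat_.hom_ext
      intro p q
      refine (comp_perm_apply (M := X ⊗ 𝟙_ (Mat_ C)) (N := Y ⊗ 𝟙_ (Mat_ C)) (K := Y) (fun p => p.1)
        (fun a b h => Prod.ext h rfl) (fun p => (ρ_ (Y.X p.1)).hom) _ p (q, PUnit.unit)).trans
        (Eq.trans ?_ (perm_comp_apply (M := X ⊗ 𝟙_ (Mat_ C)) (N := X) (fun p => p.1) _ _ _ _).symm)
      have h : (𝟙 (𝟙_ (Mat_ C)) : 𝟙_ (Mat_ C) ⟶ 𝟙_ (Mat_ C)) p.2 PUnit.unit = 𝟙 (𝟙_ C) :=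
        Mat_.id_apply_self _ _
      rw [tensor_apply, h]
      exact (congrArg (fun t => t ≫ (ρ_ (Y.X q)).hom) (MonoidalCategory.tensorHom_id
        (f p.1 q) (𝟙_ C))).trans (MonoidalCategory.rightUnitor_naturality _))
    (pentagon := fun W X Y Z => by
      simp only [associator_hom, id_eq_perm, perm_tensor_perm, perm_comp_perm]
      refine congrArg (perm (M := ((W ⊗ X) ⊗ Y) ⊗ Z) (N := W ⊗ (X ⊗ (Y ⊗ Z))) _)
        (funext fun p => ?_)
      simp only [MonoidalCategory.tensorHom_id, MonoidalCategory.id_tensorHom]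
      exact MonoidalCategory.pentagon _ _ _ _)
    (triangle := fun X Y => by
      simp only [associator_hom, leftUnitor_hom, rightUnitor_hom, id_eq_perm, perm_tensor_perm,
        perm_comp_perm]
      refine congrArg (perm (M := (X ⊗ 𝟙_ _) ⊗ Y) (N := X ⊗ Y) _)
        (funext fun p => ?_)
      simp only [MonoidalCategory.tensorHom_id, MonoidalCategory.id_tensorHom]
      exact MonoidalCategory.triangle _ _)

instance : MonoidalPreadditive (Mat_ C) where
  whiskerLeft_zero {M K L} := by
    apply Mat_.hom_ext
    intro p q
    rw [whiskerLeft_apply, zero_apply, zero_apply, MonoidalPreadditive.tensor_zero]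
  zero_whiskerRight {M K L} := by
    apply Mat_.hom_ext
    intro p q
    rw [whiskerRight_apply, zero_apply, zero_apply, MonoidalPreadditive.zero_tensor]
  whiskerLeft_add {M K L} f g := by
    apply Mat_.hom_ext
    intro p q
    rw [whiskerLeft_apply, Mat_.add_apply, Mat_.add_apply, MonoidalPreadditive.tensor_add]
    rfl
  add_whiskerRight {M K L} f g := by
    apply Mat_.hom_ext
    intro p q
    rw [whiskerRight_apply, Mat_.add_apply, Mat_.add_apply, MonoidalPreadditive.add_tensor]
    rfl

instance {k : Type w} [CommRing k] [Linear k C] [MonoidalLinear k C] :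
    MonoidalLinear k (Mat_ C) where
  whiskerLeft_smul M K L r f := by
    apply Mat_.hom_ext
    intro p q
    rw [whiskerLeft_apply, smul_apply, smul_apply, whiskerLeft_apply,
      MonoidalCategory.tensorHom_def, MonoidalCategory.tensorHom_def,
      MonoidalLinear.whiskerLeft_smul, Linear.comp_smul]
  smul_whiskerRight r K L f M := by
    apply Mat_.hom_ext
    intro p q
    rw [whiskerRight_apply, smul_apply, smul_apply, whiskerRight_apply,
      MonoidalCategory.tensorHom_def, MonoidalCategory.tensorHom_def,
      MonoidalLinear.smul_whiskerRight, Linear.smul_comp]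

variable [SymmetricCategory C]

/-- The symmetry `(X_i ⊗ Y_j) ≅ (Y_j ⊗ X_i)` of the additive envelope. -/
@[simps]
def braid (M N : Mat_ C) : M ⊗ N ≅ N ⊗ M where
  hom := perm (M := M ⊗ N) (N := N ⊗ M) (fun p => (p.2, p.1))
    (fun p => (β_ (M.X p.1) (N.X p.2)).hom)
  inv := perm (M := N ⊗ M) (N := M ⊗ N) (fun p => (p.2, p.1))
    (fun p => (β_ (N.X p.1) (M.X p.2)).hom)
  hom_inv_id := by
    rw [perm_comp_perm, id_eq_perm]
    exact congrArg (perm (M := M ⊗ N) (N := M ⊗ N) (fun i => i))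
      (funext fun p => SymmetricCategory.symmetry _ _)
  inv_hom_id := by
    rw [perm_comp_perm, id_eq_perm]
    exact congrArg (perm (M := N ⊗ M) (N := N ⊗ M) (fun i => i))
      (funext fun p => SymmetricCategory.symmetry _ _)

instance : SymmetricCategory (Mat_ C) where
  braiding := braid
  braiding_naturality_right X {Y Z} f := by
    apply perm_ext (M := X ⊗ Y) (N := Z ⊗ X) (fun p : X.ι × Z.ι => (p.2, p.1))
      (fun q => ⟨(q.2, q.1), rfl⟩)
    intro p q
    rw [braid_hom, braid_hom, perm_comp_apply,
      comp_perm_apply _ (fun a b h => Prod.ext (congrArg Prod.snd h) (congrArg Prod.fst h))]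
    exact BraidedCategory.braiding_naturality _ _
  braiding_naturality_left {X Y} f Z := by
    apply perm_ext (M := X ⊗ Z) (N := Z ⊗ Y) (fun p : Y.ι × Z.ι => (p.2, p.1))
      (fun q => ⟨(q.2, q.1), rfl⟩)
    intro p q
    rw [braid_hom, braid_hom, perm_comp_apply,
      comp_perm_apply _ (fun a b h => Prod.ext (congrArg Prod.snd h) (congrArg Prod.fst h))]
    exact BraidedCategory.braiding_naturality _ _
  hexagon_forward X Y Z := by
    simp only [braid_hom, ← id_tensor, ← tensor_id, associator_hom, id_eq_perm, perm_tensor_perm,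
      perm_comp_perm]
    refine congrArg (perm (M := (X ⊗ Y) ⊗ Z) (N := Y ⊗ (Z ⊗ X)) _)
      (funext fun p => ?_)
    simp only [MonoidalCategory.tensorHom_id, MonoidalCategory.id_tensorHom]
    exact BraidedCategory.hexagon_forward _ _ _
  hexagon_reverse X Y Z := by
    simp only [braid_hom, ← id_tensor, ← tensor_id, associator_inv, id_eq_perm, perm_tensor_perm,
      perm_comp_perm]
    refine congrArg (perm (M := X ⊗ (Y ⊗ Z)) (N := (Z ⊗ X) ⊗ Y) _)
      (funext fun p => ?_)
    simp only [MonoidalCategory.tensorHom_id, MonoidalCategory.id_tensorHom]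
    exact BraidedCategory.hexagon_reverse _ _ _
  symmetry X Y := (braid X Y).hom_inv_id

end Monoidal

/-- An endomorphism of the identity functor of `C` acts diagonally on tuples. -/
def idEnd (τ : IdEnd C) : IdEnd (Mat_ C) where
  app M := perm (M := M) (N := M) (fun i => i) (fun i => τ.app (M.X i))
  naturality {M N} f := by
    apply Mat_.hom_ext
    intro i j
    refine (comp_perm_apply (fun i => i) (fun _ _ h => h) (fun i => τ.app (N.X i)) f i j).trans
      (Eq.trans ?_ (perm_comp_apply (fun i => i) (fun i => τ.app (M.X i)) f i j).symm)
    exact τ.naturality (f i j)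

theorem idEnd_app (τ : IdEnd C) (M : Mat_ C) :
    (idEnd τ).app M = perm (M := M) (N := M) (fun i => i) (fun i => τ.app (M.X i)) := rfl

instance (τ : IdEnd C) [MonoidalCategory C] [MonoidalPreadditive C] [τ.IsTensorIdempotent] :
    (idEnd τ).IsTensorIdempotent where
  idem M := by
    rw [idEnd_app, perm_comp_perm]
    simp only [IdEnd.IsTensorIdempotent.idem]
  app_tensor_left M N := by
    rw [← tensor_id, id_eq_perm, idEnd_app, idEnd_app, perm_tensor_perm]
    refine congrArg (perm (M := M ⊗ N) (N := M ⊗ N) (fun i => i)) (funext fun p => ?_)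
    rw [MonoidalCategory.tensorHom_id]
    exact IdEnd.IsTensorIdempotent.app_tensor_left _ _
  app_tensor_right M N := by
    rw [← id_tensor, id_eq_perm, idEnd_app, idEnd_app, perm_tensor_perm]
    refine congrArg (perm (M := M ⊗ N) (N := M ⊗ N) (fun i => i)) (funext fun p => ?_)
    rw [MonoidalCategory.id_tensorHom]
    exact IdEnd.IsTensorIdempotent.app_tensor_right _ _

end AddEnv
namespace Kar

variable {C : Type u} [Category.{v} C]

section Linear

variable [Preadditive C] {k : Type w} [Ring k] [Linear k C]

instance homSMul (P Q : Karoubi C) : SMul k (P ⟶ Q) where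
  smul r f := ⟨r • f.f, by rw [Linear.smul_comp, Linear.comp_smul, f.comm]⟩

@[simp]
theorem smul_f {P Q : Karoubi C} (r : k) (f : P ⟶ Q) : (r • f).f = r • f.f := rfl

instance homModule (P Q : Karoubi C) : Module k (P ⟶ Q) :=
  Function.Injective.module k (Karoubi.inclusionHom P Q) (fun _ _ h => Karoubi.hom_ext _ _ h)
    (fun _ _ => rfl)

instance : Linear k (Karoubi C) where
  homModule := homModule
  smul_comp P Q R r f g := by
    apply Karoubi.hom_ext
    exact Linear.smul_comp _ _ _ r f.f g.f
  comp_smul P Q R f r g := by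
    apply Karoubi.hom_ext
    exact Linear.comp_smul _ _ _ f.f r g.f

end Linear

/-- A morphism that commutes with the idempotents restricts to the images of the idempotents. -/
def res {P Q : Karoubi C} (φ : P.X ⟶ Q.X) (h : P.p ≫ φ = φ ≫ Q.p) : P ⟶ Q :=
  ⟨P.p ≫ φ, by rw [Category.assoc, ← h, P.idem_assoc, P.idem_assoc]⟩

theorem res_f {P Q : Karoubi C} (φ : P.X ⟶ Q.X) (h : P.p ≫ φ = φ ≫ Q.p) :
    (res φ h).f = P.p ≫ φ := rfl

theorem comp_res_f {P Q R : Karoubi C} (f : P ⟶ Q) (φ : Q.X ⟶ R.X) (h : Q.p ≫ φ = φ ≫ R.p) :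
    (f ≫ res φ h).f = f.f ≫ φ := by
  rw [Karoubi.comp_f, res_f, Karoubi.comp_p_assoc]

theorem res_comp_f {P Q R : Karoubi C} (φ : P.X ⟶ Q.X) (h : P.p ≫ φ = φ ≫ Q.p) (f : Q ⟶ R) :
    (res φ h ≫ f).f = φ ≫ f.f := by
  rw [Karoubi.comp_f, res_f, h, Category.assoc, Karoubi.p_comp]

theorem res_comp_res {P Q R : Karoubi C} (φ : P.X ⟶ Q.X) (h : P.p ≫ φ = φ ≫ Q.p)
    (ψ : Q.X ⟶ R.X) (h' : Q.p ≫ ψ = ψ ≫ R.p) :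
    res φ h ≫ res ψ h' = res (φ ≫ ψ) (by rw [← Category.assoc, h, Category.assoc, h',
      Category.assoc]) := by
  apply Karoubi.hom_ext
  rw [comp_res_f, res_f, res_f, Category.assoc]

theorem id_eq_res (P : Karoubi C) :
    𝟙 P = res (𝟙 P.X) (by rw [Category.comp_id, Category.id_comp]) := by
  apply Karoubi.hom_ext
  rw [res_f, Karoubi.id_f, Category.comp_id]

theorem res_congr {P Q : Karoubi C} {φ ψ : P.X ⟶ Q.X} (h : P.p ≫ φ = φ ≫ Q.p)
    (h' : P.p ≫ ψ = ψ ≫ Q.p) (e : φ = ψ) : res φ h = res ψ h' := by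
  subst e
  rfl

/-- An isomorphism that commutes with the idempotents restricts to an isomorphism. -/
def resIso {P Q : Karoubi C} (φ : P.X ≅ Q.X) (h : P.p ≫ φ.hom = φ.hom ≫ Q.p) : P ≅ Q where
  hom := res φ.hom h
  inv := res φ.inv (by rw [Iso.comp_inv_eq, Category.assoc, h, Iso.inv_hom_id_assoc])
  hom_inv_id := by
    rw [res_comp_res, id_eq_res]
    exact res_congr _ _ φ.hom_inv_id
  inv_hom_id := by
    rw [res_comp_res, id_eq_res]
    exact res_congr _ _ φ.inv_hom_id

section Monoidal

variable [MonoidalCategory C]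

theorem tensor_aux {P Q R S : Karoubi C} (f : P ⟶ Q) (g : R ⟶ S) :
    (P.p ⊗ₘ R.p) ≫ (f.f ⊗ₘ g.f) ≫ (Q.p ⊗ₘ S.p) = f.f ⊗ₘ g.f := by
  rw [MonoidalCategory.tensorHom_comp_tensorHom, MonoidalCategory.tensorHom_comp_tensorHom, f.comm, g.comm]

/-- The tensor product of the Karoubi envelope: `(X, p) ⊗ (Y, q) = (X ⊗ Y, p ⊗ q)`. -/
instance : MonoidalCategoryStruct (Karoubi C) where
  tensorObj P Q := ⟨P.X ⊗ Q.X, P.p ⊗ₘ Q.p, by rw [MonoidalCategory.tensorHom_comp_tensorHom, P.idem, Q.idem]⟩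
  tensorHom f g := ⟨f.f ⊗ₘ g.f, tensor_aux f g⟩
  whiskerLeft P _ _ f := ⟨P.p ⊗ₘ f.f, tensor_aux (𝟙 P) f⟩
  whiskerRight f Q := ⟨f.f ⊗ₘ Q.p, tensor_aux f (𝟙 Q)⟩
  tensorUnit := ⟨𝟙_ C, 𝟙 _, Category.comp_id _⟩
  associator P Q R := resIso (α_ P.X Q.X R.X) (MonoidalCategory.associator_naturality _ _ _)
  leftUnitor P := resIso (λ_ P.X) ((congrArg (fun t => t ≫ (λ_ P.X).hom)
    (MonoidalCategory.id_tensorHom _ _)).trans (MonoidalCategory.leftUnitor_naturality _))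
  rightUnitor P := resIso (ρ_ P.X) ((congrArg (fun t => t ≫ (ρ_ P.X).hom)
    (MonoidalCategory.tensorHom_id _ _)).trans (MonoidalCategory.rightUnitor_naturality _))

theorem tensor_f {P Q R S : Karoubi C} (f : P ⟶ Q) (g : R ⟶ S) :
    (f ⊗ₘ g).f = f.f ⊗ₘ g.f := rfl

theorem id_tensor (P : Karoubi C) {Q R : Karoubi C} (f : Q ⟶ R) : 𝟙 P ⊗ₘ f = P ◁ f := rfl

theorem tensor_id {Q R : Karoubi C} (f : Q ⟶ R) (P : Karoubi C) : f ⊗ₘ 𝟙 P = f ▷ P := rfl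

theorem res_tensor_aux {P Q R S : Karoubi C} (φ : P.X ⟶ Q.X) (h : P.p ≫ φ = φ ≫ Q.p)
    (ψ : R.X ⟶ S.X) (h' : R.p ≫ ψ = ψ ≫ S.p) :
    (P.p ⊗ₘ R.p) ≫ (φ ⊗ₘ ψ) = (φ ⊗ₘ ψ) ≫ (Q.p ⊗ₘ S.p) := by
  rw [MonoidalCategory.tensorHom_comp_tensorHom, MonoidalCategory.tensorHom_comp_tensorHom, h, h']

theorem res_tensor_res {P Q R S : Karoubi C} (φ : P.X ⟶ Q.X) (h : P.p ≫ φ = φ ≫ Q.p)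
    (ψ : R.X ⟶ S.X) (h' : R.p ≫ ψ = ψ ≫ S.p) :
    res φ h ⊗ₘ res ψ h' = res (P := P ⊗ R) (Q := Q ⊗ S) (φ ⊗ₘ ψ) (res_tensor_aux φ h ψ h') := by
  apply Karoubi.hom_ext
  rw [tensor_f, res_f, res_f, res_f]
  exact (MonoidalCategory.tensorHom_comp_tensorHom _ _ _ _).symm

theorem associator_hom (P Q R : Karoubi C) : (α_ P Q R).hom =
    res (P := (P ⊗ Q) ⊗ R) (Q := P ⊗ (Q ⊗ R)) (α_ P.X Q.X R.X).hom
      (MonoidalCategory.associator_naturality _ _ _) := rfl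

theorem associator_inv (P Q R : Karoubi C) : (α_ P Q R).inv =
    res (P := P ⊗ (Q ⊗ R)) (Q := (P ⊗ Q) ⊗ R) (α_ P.X Q.X R.X).inv
      (MonoidalCategory.associator_inv_naturality _ _ _) := rfl

theorem leftUnitor_hom (P : Karoubi C) : (λ_ P).hom =
    res (P := 𝟙_ _ ⊗ P) (Q := P) (λ_ P.X).hom ((congrArg (fun t => t ≫ (λ_ P.X).hom)
      (MonoidalCategory.id_tensorHom _ _)).trans (MonoidalCategory.leftUnitor_naturality _)) := rfl

theorem rightUnitor_hom (P : Karoubi C) : (ρ_ P).hom =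
    res (P := P ⊗ 𝟙_ _) (Q := P) (ρ_ P.X).hom ((congrArg (fun t => t ≫ (ρ_ P.X).hom)
      (MonoidalCategory.tensorHom_id _ _)).trans (MonoidalCategory.rightUnitor_naturality _)) := rfl

instance : MonoidalCategory (Karoubi C) :=
  MonoidalCategory.ofTensorHom
    (id_tensorHom_id := fun P Q => rfl)
    (id_tensorHom := fun _ _ _ _ => rfl)
    (tensorHom_id := fun _ _ => rfl)
    (tensorHom_comp_tensorHom := fun f₁ f₂ g₁ g₂ => by
      apply Karoubi.hom_ext
      exact MonoidalCategory.tensorHom_comp_tensorHom _ _ _ _)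
    (associator_naturality := fun f₁ f₂ f₃ => by
      apply Karoubi.hom_ext
      rw [associator_hom, associator_hom, comp_res_f, res_comp_f]
      exact MonoidalCategory.associator_naturality _ _ _)
    (leftUnitor_naturality := fun f => by
      apply Karoubi.hom_ext
      rw [leftUnitor_hom, leftUnitor_hom, comp_res_f, res_comp_f]
      exact (congrArg (fun t => t ≫ (λ_ _).hom) (MonoidalCategory.id_tensorHom (𝟙_ C) f.f)).trans
        (MonoidalCategory.leftUnitor_naturality f.f))
    (rightUnitor_naturality := fun f => by
      apply Karoubi.hom_ext
      rw [rightUnitor_hom, rightUnitor_hom, comp_res_f, res_comp_f]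
      exact (congrArg (fun t => t ≫ (ρ_ _).hom) (MonoidalCategory.tensorHom_id f.f (𝟙_ C))).trans
        (MonoidalCategory.rightUnitor_naturality f.f))
    (pentagon := fun W X Y Z => by
      simp only [associator_hom, id_eq_res, res_tensor_res, res_comp_res]
      apply res_congr
      simp only [MonoidalCategory.id_tensorHom, MonoidalCategory.tensorHom_id]
      exact MonoidalCategory.pentagon _ _ _ _)
    (triangle := fun X Y => by
      simp only [associator_hom, leftUnitor_hom, rightUnitor_hom, id_eq_res, res_tensor_res,
        res_comp_res]
      apply res_congr
      simp only [MonoidalCategory.id_tensorHom, MonoidalCategory.tensorHom_id]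
      exact MonoidalCategory.triangle _ _)

theorem whiskerLeft_f (P : Karoubi C) {Q R : Karoubi C} (f : Q ⟶ R) :
    (P ◁ f).f = P.p ⊗ₘ f.f := rfl

theorem whiskerRight_f {Q R : Karoubi C} (f : Q ⟶ R) (P : Karoubi C) :
    (f ▷ P).f = f.f ⊗ₘ P.p := rfl

instance [Preadditive C] [MonoidalPreadditive C] : MonoidalPreadditive (Karoubi C) where
  whiskerLeft_zero := Karoubi.hom_ext _ _ (MonoidalPreadditive.tensor_zero _)
  zero_whiskerRight := Karoubi.hom_ext _ _ (MonoidalPreadditive.zero_tensor _)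
  whiskerLeft_add _ _ := Karoubi.hom_ext _ _ (MonoidalPreadditive.tensor_add _ _ _)
  add_whiskerRight _ _ := Karoubi.hom_ext _ _ (MonoidalPreadditive.add_tensor _ _ _)

instance [Preadditive C] [MonoidalPreadditive C] {k : Type w} [CommRing k] [Linear k C]
    [MonoidalLinear k C] : MonoidalLinear k (Karoubi C) where
  whiskerLeft_smul P Q R r f := by
    apply Karoubi.hom_ext
    rw [smul_f, whiskerLeft_f, whiskerLeft_f, smul_f, MonoidalCategory.tensorHom_def, MonoidalCategory.tensorHom_def,
      MonoidalLinear.whiskerLeft_smul, Linear.comp_smul]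
  smul_whiskerRight r Q R f P := by
    apply Karoubi.hom_ext
    rw [smul_f, whiskerRight_f, whiskerRight_f, smul_f, MonoidalCategory.tensorHom_def, MonoidalCategory.tensorHom_def,
      MonoidalLinear.smul_whiskerRight, Linear.smul_comp]

variable [SymmetricCategory C]

theorem braid_aux (P Q : Karoubi C) :
    (P ⊗ Q).p ≫ (β_ P.X Q.X).hom = (β_ P.X Q.X).hom ≫ (Q ⊗ P).p :=
  BraidedCategory.braiding_naturality _ _

instance : SymmetricCategory (Karoubi C) where
  braiding P Q := resIso (P := P ⊗ Q) (Q := Q ⊗ P) (β_ P.X Q.X) (braid_aux P Q)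
  braiding_naturality_right P Q R f := by
    apply Karoubi.hom_ext
    refine (comp_res_f (P := P ⊗ Q) (Q := P ⊗ R) (R := R ⊗ P) (P ◁ f) (β_ P.X R.X).hom
      (braid_aux P R)).trans (Eq.trans ?_ (res_comp_f (P := P ⊗ Q) (Q := Q ⊗ P) (R := R ⊗ P)
        (β_ P.X Q.X).hom (braid_aux P Q) (f ▷ P)).symm)
    exact BraidedCategory.braiding_naturality _ _
  braiding_naturality_left {Q R} f P := by
    apply Karoubi.hom_ext
    refine (comp_res_f (P := Q ⊗ P) (Q := R ⊗ P) (R := P ⊗ R) (f ▷ P) (β_ R.X P.X).hom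
      (braid_aux R P)).trans (Eq.trans ?_ (res_comp_f (P := Q ⊗ P) (Q := P ⊗ Q) (R := P ⊗ R)
        (β_ Q.X P.X).hom (braid_aux Q P) (P ◁ f)).symm)
    exact BraidedCategory.braiding_naturality _ _
  hexagon_forward P Q R := by
    simp only [resIso, ← id_tensor, ← tensor_id, associator_hom, id_eq_res, res_tensor_res,
      res_comp_res]
    apply res_congr
    simp only [MonoidalCategory.id_tensorHom, MonoidalCategory.tensorHom_id]
    exact BraidedCategory.hexagon_forward _ _ _
  hexagon_reverse P Q R := by
    simp only [resIso, ← id_tensor, ← tensor_id, associator_inv, id_eq_res, res_tensor_res,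
      res_comp_res]
    apply res_congr
    simp only [MonoidalCategory.id_tensorHom, MonoidalCategory.tensorHom_id]
    exact BraidedCategory.hexagon_reverse _ _ _
  symmetry P Q := by
    simp only [resIso, id_eq_res, res_comp_res]
    apply res_congr
    exact SymmetricCategory.symmetry _ _

end Monoidal

/-- An endomorphism `τ` of the identity functor of `C` acts on `(X, p)` as the restriction
of `τ_X`. -/
def idEnd (τ : IdEnd C) : IdEnd (Karoubi C) where
  app P := res (τ.app P.X) (τ.naturality P.p)
  naturality f := by
    apply Karoubi.hom_ext
    rw [comp_res_f, res_comp_f, τ.naturality]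

theorem idEnd_app (τ : IdEnd C) (P : Karoubi C) :
    (idEnd τ).app P = res (τ.app P.X) (τ.naturality P.p) := rfl

instance (τ : IdEnd C) [MonoidalCategory C] [τ.IsTensorIdempotent] :
    (idEnd τ).IsTensorIdempotent where
  idem P := by
    rw [idEnd_app, res_comp_res]
    exact res_congr _ _ (IdEnd.IsTensorIdempotent.idem _)
  app_tensor_left P Q := by
    rw [← tensor_id, id_eq_res, idEnd_app, idEnd_app, res_tensor_res]
    apply res_congr
    rw [MonoidalCategory.tensorHom_id]
    exact IdEnd.IsTensorIdempotent.app_tensor_left _ _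
  app_tensor_right P Q := by
    rw [← id_tensor, id_eq_res, idEnd_app, idEnd_app, res_tensor_res]
    apply res_congr
    rw [MonoidalCategory.id_tensorHom]
    exact IdEnd.IsTensorIdempotent.app_tensor_right _ _

end Kar


namespace IdEnd

variable {C : Type u} [Category.{v} C]

/-- The objects on which an endomorphism of the identity functor is the identity. -/
def fixed (σ : IdEnd C) : ObjectProperty C := fun X => σ.app X = 𝟙 X

end IdEnd

/-- The summand of the Karoubi envelope of `C` cut out by an idempotent endomorphism `τ` of the
identity functor: the full subcategory of the objects `P` with `τ P = P`. -/
abbrev Summand {C : Type u} [Category.{v} C] (τ : IdEnd C) : Type (max u v) :=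
  (Kar.idEnd τ).fixed.FullSubcategory

namespace Summand

variable {C : Type u} [Category.{v} C] [MonoidalCategory C] (τ : IdEnd C) [τ.IsTensorIdempotent]

theorem fixed_tensor {P : Karoubi C} (hP : (Kar.idEnd τ).fixed P) (Q : Karoubi C) :
    (Kar.idEnd τ).fixed (P ⊗ Q) := by
  have h : (Kar.idEnd τ).app P = 𝟙 P := hP
  show _ = _
  rw [IdEnd.IsTensorIdempotent.app_tensor_left, h, MonoidalCategory.id_whiskerRight]

/-- The image of `τ` on the unit object. -/
def unit : Karoubi C := ⟨𝟙_ C, τ.app (𝟙_ C), IdEnd.IsTensorIdempotent.idem _⟩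

theorem fixed_unit : (Kar.idEnd τ).fixed (unit τ) :=
  Karoubi.hom_ext _ _ (IdEnd.IsTensorIdempotent.idem (τ := τ) (𝟙_ C))

/-- The inclusion of the image of `τ` on the unit object. -/
def ι : unit τ ⟶ 𝟙_ (Karoubi C) :=
  ⟨τ.app (𝟙_ C), by
    refine Eq.trans (congrArg (fun t => τ.app (𝟙_ C) ≫ t) (Category.comp_id _)) ?_
    exact IdEnd.IsTensorIdempotent.idem _⟩

/-- The projection to the image of `τ` on the unit object. -/
def π : 𝟙_ (Karoubi C) ⟶ unit τ :=
  ⟨τ.app (𝟙_ C), by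
    refine Eq.trans (Category.id_comp _) ?_
    exact IdEnd.IsTensorIdempotent.idem _⟩

theorem ι_π : ι τ ≫ π τ = 𝟙 (unit τ) :=
  Karoubi.hom_ext _ _ (IdEnd.IsTensorIdempotent.idem (τ := τ) (𝟙_ C))

theorem π_ι : π τ ≫ ι τ = (Kar.idEnd τ).app (𝟙_ (Karoubi C)) :=
  Karoubi.hom_ext _ _ ((IdEnd.IsTensorIdempotent.idem (τ := τ) (𝟙_ C)).trans
    (Category.id_comp _).symm)

theorem π_ι_whisker {P : Karoubi C} (hP : (Kar.idEnd τ).fixed P) :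
    π τ ▷ P ≫ ι τ ▷ P = 𝟙 (𝟙_ _ ⊗ P) := by
  have h : (Kar.idEnd τ).app P = 𝟙 P := hP
  rw [← MonoidalCategory.comp_whiskerRight, π_ι, ← IdEnd.IsTensorIdempotent.app_tensor_left,
    IdEnd.IsTensorIdempotent.app_tensor_right, h, MonoidalCategory.whiskerLeft_id]

theorem whisker_π_ι {P : Karoubi C} (hP : (Kar.idEnd τ).fixed P) :
    P ◁ π τ ≫ P ◁ ι τ = 𝟙 (P ⊗ 𝟙_ _) := by
  have h : (Kar.idEnd τ).app P = 𝟙 P := hP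
  rw [← MonoidalCategory.whiskerLeft_comp, π_ι, ← IdEnd.IsTensorIdempotent.app_tensor_right,
    IdEnd.IsTensorIdempotent.app_tensor_left, h, MonoidalCategory.id_whiskerRight]

/-- The unit constraint `unit ⊗ P ≅ 𝟙_ ⊗ P ≅ P` for an object `P` of the summand. -/
@[simps]
def leftUnit (P : Karoubi C) (hP : (Kar.idEnd τ).fixed P) : unit τ ⊗ P ≅ P where
  hom := ι τ ▷ P ≫ (λ_ P).hom
  inv := (λ_ P).inv ≫ π τ ▷ P
  hom_inv_id := by
    rw [Category.assoc, Iso.hom_inv_id_assoc, ← MonoidalCategory.comp_whiskerRight, ι_π,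
      MonoidalCategory.id_whiskerRight]
  inv_hom_id := by
    rw [Category.assoc, ← Category.assoc (π τ ▷ P), π_ι_whisker τ hP, Category.id_comp,
      Iso.inv_hom_id]

/-- The unit constraint `P ⊗ unit ≅ P ⊗ 𝟙_ ≅ P` for an object `P` of the summand. -/
@[simps]
def rightUnit (P : Karoubi C) (hP : (Kar.idEnd τ).fixed P) : P ⊗ unit τ ≅ P where
  hom := P ◁ ι τ ≫ (ρ_ P).hom
  inv := (ρ_ P).inv ≫ P ◁ π τ
  hom_inv_id := by
    rw [Category.assoc, Iso.hom_inv_id_assoc, ← MonoidalCategory.whiskerLeft_comp, ι_π,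
      MonoidalCategory.whiskerLeft_id]
  inv_hom_id := by
    rw [Category.assoc, ← Category.assoc (P ◁ π τ), whisker_π_ι τ hP, Category.id_comp,
      Iso.inv_hom_id]

/-- The tensor product of the summand is the one of the Karoubi envelope, and its unit object is
the image of `τ` on the unit object. -/
instance : MonoidalCategoryStruct (Summand τ) where
  tensorObj P Q := ⟨P.obj ⊗ Q.obj, fixed_tensor τ P.property Q.obj⟩
  tensorHom f g := ObjectProperty.homMk (f.hom ⊗ₘ g.hom)
  whiskerLeft P _ _ f := ObjectProperty.homMk (P.obj ◁ f.hom)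
  whiskerRight f Q := ObjectProperty.homMk (f.hom ▷ Q.obj)
  tensorUnit := ⟨unit τ, fixed_unit τ⟩
  associator P Q R := ObjectProperty.isoMk _ (α_ P.obj Q.obj R.obj)
  leftUnitor P := ObjectProperty.isoMk _ (leftUnit τ P.obj P.property)
  rightUnitor P := ObjectProperty.isoMk _ (rightUnit τ P.obj P.property)

instance : MonoidalCategory (Summand τ) where
  tensorHom_def f g := ObjectProperty.hom_ext _ (MonoidalCategory.tensorHom_def _ _)
  id_tensorHom_id P Q := ObjectProperty.hom_ext _ (MonoidalCategory.id_tensorHom_id _ _)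
  tensorHom_comp_tensorHom f₁ f₂ g₁ g₂ :=
    ObjectProperty.hom_ext _ (MonoidalCategory.tensorHom_comp_tensorHom _ _ _ _)
  whiskerLeft_id P Q := ObjectProperty.hom_ext _ (MonoidalCategory.whiskerLeft_id _ _)
  id_whiskerRight P Q := ObjectProperty.hom_ext _ (MonoidalCategory.id_whiskerRight _ _)
  associator_naturality f g h :=
    ObjectProperty.hom_ext _ (MonoidalCategory.associator_naturality _ _ _)
  leftUnitor_naturality {P Q} f := ObjectProperty.hom_ext _ (by
    show unit τ ◁ f.hom ≫ ι τ ▷ Q.obj ≫ (λ_ Q.obj).hom = (ι τ ▷ P.obj ≫ (λ_ P.obj).hom) ≫ f.hom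
    rw [MonoidalCategory.whisker_exchange_assoc, MonoidalCategory.leftUnitor_naturality,
      Category.assoc])
  rightUnitor_naturality {P Q} f := ObjectProperty.hom_ext _ (by
    show f.hom ▷ unit τ ≫ Q.obj ◁ ι τ ≫ (ρ_ Q.obj).hom = (P.obj ◁ ι τ ≫ (ρ_ P.obj).hom) ≫ f.hom
    rw [← MonoidalCategory.whisker_exchange_assoc, MonoidalCategory.rightUnitor_naturality,
      Category.assoc])
  pentagon P Q R S := ObjectProperty.hom_ext _ (MonoidalCategory.pentagon _ _ _ _)
  triangle P Q := ObjectProperty.hom_ext _ (by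
    show (α_ P.obj (unit τ) Q.obj).hom ≫ P.obj ◁ (ι τ ▷ Q.obj ≫ (λ_ Q.obj).hom) =
      (P.obj ◁ ι τ ≫ (ρ_ P.obj).hom) ▷ Q.obj
    rw [MonoidalCategory.whiskerLeft_comp, MonoidalCategory.comp_whiskerRight,
      ← MonoidalCategory.associator_naturality_middle_assoc, MonoidalCategory.triangle])

instance [SymmetricCategory C] : SymmetricCategory (Summand τ) where
  braiding P Q := ObjectProperty.isoMk _ (β_ P.obj Q.obj)
  braiding_naturality_right P Q R f :=
    ObjectProperty.hom_ext _ (BraidedCategory.braiding_naturality_right _ _)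
  braiding_naturality_left f P :=
    ObjectProperty.hom_ext _ (BraidedCategory.braiding_naturality_left _ _)
  hexagon_forward P Q R := ObjectProperty.hom_ext _ (BraidedCategory.hexagon_forward _ _ _)
  hexagon_reverse P Q R := ObjectProperty.hom_ext _ (BraidedCategory.hexagon_reverse _ _ _)
  symmetry P Q := ObjectProperty.hom_ext _ (SymmetricCategory.symmetry _ _)

instance [Preadditive C] [MonoidalPreadditive C] : MonoidalPreadditive (Summand τ) where
  whiskerLeft_zero := ObjectProperty.hom_ext _ MonoidalPreadditive.whiskerLeft_zero
  zero_whiskerRight := ObjectProperty.hom_ext _ MonoidalPreadditive.zero_whiskerRight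
  whiskerLeft_add _ _ := ObjectProperty.hom_ext _ (MonoidalPreadditive.whiskerLeft_add _ _)
  add_whiskerRight _ _ := ObjectProperty.hom_ext _ (MonoidalPreadditive.add_whiskerRight _ _)

instance [Preadditive C] [MonoidalPreadditive C] {k : Type w} [CommRing k] [Linear k C]
    [MonoidalLinear k C] : MonoidalLinear k (Summand τ) where
  whiskerLeft_smul _ _ _ _ _ := ObjectProperty.hom_ext _ (MonoidalLinear.whiskerLeft_smul _ _ _)
  smul_whiskerRight _ _ _ _ _ := ObjectProperty.hom_ext _ (MonoidalLinear.smul_whiskerRight _ _ _)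

end Summand

open scoped Classical in
/-- The element `e_χ = - δ_χ [0] + (q - 1)⁻¹ ∑_{a ∈ Fˣ} χ(a)⁻¹ [a]` of the monoid algebra `k[F]`
of the multiplicative monoid of the field `F` with `q` elements, where `δ_χ` is `1` if `χ` is the
trivial character and `0` otherwise. -/
def charIdem {k : Type*} [Field k] {F : Type*} [Field F] [Finite F] (χ : Fˣ →* kˣ) :
    MonoidAlgebra k F :=
  -(if χ = 1 then MonoidAlgebra.single 0 1 else 0) +
    ((Nat.card F : k) - 1)⁻¹ • ∑ᶠ a : Fˣ, MonoidAlgebra.single (a : F) (((χ a)⁻¹ : kˣ) : k)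

theorem charIdem_idem {k : Type*} [Field k] [CharZero k] {F : Type*} [Field F] [Finite F]
    (χ : Fˣ →* kˣ) : IsIdempotentElem (charIdem χ) := by
  classical
  have : Fintype F := Fintype.ofFinite F
  unfold IsIdempotentElem charIdem
  rw [finsum_eq_sum_of_fintype]
  set n : k := (Nat.card F : k) - 1 with hn
  have hcard : ((Fintype.card Fˣ : ℕ) : k) = n := by
    rw [hn, ← Nat.card_eq_fintype_card, Nat.card_units, Nat.cast_sub Nat.card_pos, Nat.cast_one]
  have hn0 : n ≠ 0 := by
    rw [← hcard]
    exact Nat.cast_ne_zero.mpr Fintype.card_ne_zero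
  set S : MonoidAlgebra k F :=
    ∑ a : Fˣ, MonoidAlgebra.single (a : F) (((χ a)⁻¹ : kˣ) : k) with hS
  have hSS : S * S = n • S := by
    have h1 : ∀ a : Fˣ, MonoidAlgebra.single (a : F) (((χ a)⁻¹ : kˣ) : k) * S = S := by
      intro a
      rw [hS, Finset.mul_sum]
      refine Fintype.sum_equiv (Equiv.mulLeft a) _ _ fun b => ?_
      simp [MonoidAlgebra.single_mul_single, mul_comm]
    conv_lhs => rw [hS, Finset.sum_mul]
    rw [Finset.sum_congr rfl fun a _ => h1 a, Finset.sum_const, Finset.card_univ, ← hcard,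
      Nat.cast_smul_eq_nsmul]
  have h0S : MonoidAlgebra.single (0 : F) (1 : k) * S =
      (∑ a : Fˣ, (((χ a)⁻¹ : kˣ) : k)) • MonoidAlgebra.single (0 : F) (1 : k) := by
    rw [hS, Finset.mul_sum, Finset.sum_smul]
    simp [MonoidAlgebra.single_mul_single, MonoidAlgebra.smul_single]
  by_cases hχ : χ = 1
  · subst hχ
    have h0S' : MonoidAlgebra.single (0 : F) (1 : k) * S =
        n • MonoidAlgebra.single (0 : F) (1 : k) := by
      rw [h0S, ← hcard]
      simp
    have h00 : MonoidAlgebra.single (0 : F) (1 : k) * MonoidAlgebra.single (0 : F) (1 : k) =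
        MonoidAlgebra.single (0 : F) (1 : k) := by
      simp [MonoidAlgebra.single_mul_single]
    rw [if_pos rfl]
    have hS0 := (mul_comm S (MonoidAlgebra.single (0 : F) (1 : k))).trans h0S'
    simp only [mul_add, add_mul, neg_mul, mul_neg, smul_mul_assoc, mul_smul_comm, h00, h0S', hSS,
      smul_smul, hS0]
    rw [inv_mul_cancel₀ hn0, one_smul, one_smul, smul_add, smul_neg, smul_smul,
      inv_mul_cancel₀ hn0, one_smul]
    abel
  · rw [if_neg hχ]
    simp only [neg_zero, zero_add, smul_mul_assoc, mul_smul_comm, hSS, smul_smul]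
    rw [inv_mul_cancel₀ hn0, mul_one]

namespace Lin

variable {k : Type*} [CommRing k] {F : Type*} [Field F]
  {E : Type u} [Category.{v} E] [Preadditive E] [Linear F E]

/-- The action of the monoid algebra `k[F]` on the object `[X]` of `k[E]`: the basis element `[a]`
acts through the endomorphism `[a • 𝟙 X]`. -/
def act (X : Lin k E) : MonoidAlgebra k F →ₐ[k] End X :=
  MonoidAlgebra.lift k (End X) F
    { toFun := fun a => single (X := X) (Y := X) (a • 𝟙 X.as) 1
      map_one' := by
        rw [one_smul]
        exact single_id X
      map_mul' := fun a b => by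
        show _ = single (X := X) (Y := X) (b • 𝟙 X.as) 1 ≫ single (X := X) (Y := X) (a • 𝟙 X.as) 1
        rw [single_comp, Linear.smul_comp, Category.id_comp, smul_smul, mul_one, mul_comm] }

theorem act_single (X : Lin k E) (a : F) (r : k) :
    act X (MonoidAlgebra.single a r) = single (X := X) (Y := X) (a • 𝟙 X.as) r := by
  refine (MonoidAlgebra.lift_single _ _ _).trans ?_
  show r • single (X := X) (Y := X) (a • 𝟙 X.as) (1 : k) = _
  rw [smul_single, mul_one]

/-- The action of an element of the monoid algebra `k[F]` on the identity functor of `k[E]`. -/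
def scalar (x : MonoidAlgebra k F) : IdEnd (Lin k E) where
  app X := act X x
  naturality {X Y} f := by
    induction x using MonoidAlgebra.induction_linear with
    | zero =>
      rw [map_zero, map_zero]
      exact comp_zero.trans zero_comp.symm
    | add x y hx hy =>
      rw [map_add, map_add]
      refine (Preadditive.comp_add _ _ _ _ _ _).trans (Eq.trans ?_
        (Preadditive.add_comp _ _ _ _ _ _).symm)
      rw [hx, hy]
    | single a r =>
      rw [act_single, act_single]
      refine ind f ?_ ?_ ?_
      · simp
      · intro f g hf hg
        rw [Preadditive.comp_add, Preadditive.add_comp, hf, hg]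
      · intro φ s
        rw [single_comp, single_comp, Linear.comp_smul, Linear.smul_comp, Category.comp_id,
          Category.id_comp, mul_comm]

theorem scalar_app (x : MonoidAlgebra k F) (X : Lin k E) : (scalar x).app X = act X x := rfl

variable [MonoidalCategory E] [MonoidalPreadditive E] [MonoidalLinear F E]

theorem act_tensor_left (x : MonoidAlgebra k F) (X Y : Lin k E) :
    act (X ⊗ Y) x = (show X ⟶ X from act X x) ▷ Y := by
  induction x using MonoidAlgebra.induction_linear with
  | zero =>
    rw [map_zero, map_zero]
    exact (MonoidalPreadditive.zero_whiskerRight).symm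
  | add x y hx hy =>
    rw [map_add, map_add, hx, hy]
    exact (MonoidalPreadditive.add_whiskerRight _ _).symm
  | single a r =>
    rw [act_single, act_single]
    refine Eq.trans ?_ (single_whiskerRight _ _ _).symm
    rw [MonoidalLinear.smul_whiskerRight, MonoidalCategory.id_whiskerRight]
    rfl

theorem act_tensor_right (x : MonoidAlgebra k F) (X Y : Lin k E) :
    act (X ⊗ Y) x = X ◁ (show Y ⟶ Y from act Y x) := by
  induction x using MonoidAlgebra.induction_linear with
  | zero =>
    rw [map_zero, map_zero]
    exact (MonoidalPreadditive.whiskerLeft_zero).symm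
  | add x y hx hy =>
    rw [map_add, map_add, hx, hy]
    exact (MonoidalPreadditive.whiskerLeft_add _ _).symm
  | single a r =>
    rw [act_single, act_single]
    refine Eq.trans ?_ (whiskerLeft_single _ _ _).symm
    rw [MonoidalLinear.whiskerLeft_smul, MonoidalCategory.whiskerLeft_id]
    rfl

theorem scalar_isTensorIdempotent {x : MonoidAlgebra k F} (hx : IsIdempotentElem x) :
    (scalar (E := E) x).IsTensorIdempotent where
  idem X := by
    show (act X x) * (act X x) = act X x
    rw [← map_mul, hx]
  app_tensor_left := act_tensor_left x
  app_tensor_right := act_tensor_right x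

end Lin

section

variable {k : Type*} [Field k] {F : Type*} [Field F] [Finite F]
  {E : Type u} [Category.{v} E] [Preadditive E] [Linear F E]

variable (E) in
/-- The action of `e_χ` on the additive envelope of `k[E]`. -/
def charEnd (χ : Fˣ →* kˣ) : IdEnd (Mat_ (Lin k E)) :=
  AddEnv.idEnd (Lin.scalar (charIdem χ))

instance [CharZero k] [MonoidalCategory E] [MonoidalPreadditive E] [MonoidalLinear F E]
    (χ : Fˣ →* kˣ) : (charEnd E χ).IsTensorIdempotent :=
  have := Lin.scalar_isTensorIdempotent (E := E) (charIdem_idem χ)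
  inferInstanceAs (AddEnv.idEnd (Lin.scalar (charIdem χ))).IsTensorIdempotent

end

/-- Objects of finite length: those with a composition series. -/
inductive HasFiniteLength {C : Type u} [Category.{v} C] [HasZeroMorphisms C] : C → Prop
  | zero {X : C} (h : IsZero X) : HasFiniteLength X
  | ext (S : ShortComplex C) (hS : S.ShortExact) (h₁ : HasFiniteLength S.X₁) (h₃ : Simple S.X₃) :
      HasFiniteLength S.X₂

/-- A category is semi-simple if every object is a finite direct sum of simple objects. -/
def IsSemisimple (C : Type u) [Category.{v} C] [HasZeroMorphisms C] : Prop :=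
  ∀ X : C, ∃ (n : ℕ) (S : Fin n → C) (_ : HasBiproduct S),
    (∀ i, Simple (S i)) ∧ Nonempty (X ≅ ⨁ S)

/-- A pre-Tannakian category over a field `F`: an `F`-linear symmetric monoidal category that is
abelian, with all objects of finite length, all Hom spaces of finite dimension, all objects
dualizable, and `End(𝟙) = F`. -/
structure IsPreTannakian (F : Type*) [Field F] (C : Type u) [Category.{v} C] [Preadditive C]
    [Linear F C] [MonoidalCategory C] [SymmetricCategory C] [MonoidalPreadditive C]
    [MonoidalLinear F C] : Prop where
  hasFiniteProducts : HasFiniteProducts C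
  hasKernels : HasKernels C
  hasCokernels : HasCokernels C
  normalMono : IsNormalMonoCategory C
  normalEpi : IsNormalEpiCategory C
  finiteLength : ∀ X : C, HasFiniteLength X
  finite : ∀ X Y : C, Module.Finite F (X ⟶ Y)
  rigid : ∀ X : C, ∃ Y : C, Nonempty (ExactPairing X Y)
  unit : Function.Bijective fun a : F => a • 𝟙 (𝟙_ C)

/-- A full subcategory of a preadditive category is a direct summand if it has a complement: a
full subcategory without nonzero morphisms to or from it, such that every object is the
direct sum of an object of the one and an object of the other. -/
def IsDirectSummand {C : Type u} [Category.{v} C] [Preadditive C] (P : ObjectProperty C) : Prop :=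
  ∃ Q : ObjectProperty C,
    (∀ X Y, P X → Q Y → (∀ f : X ⟶ Y, f = 0) ∧ ∀ f : Y ⟶ X, f = 0) ∧
    ∀ X, ∃ Y Z, P Y ∧ Q Z ∧ ∃ b : BinaryBicone Y Z, Nonempty b.IsBilimit ∧ Nonempty (X ≅ b.pt)

end

end LinPT

/-! The whole theorem rests on one property: every morphism `f` of the summand is regular, i.e. has
a `g` with `f ≫ g ≫ f = f` (`IsRegularMor`). In an idempotent-complete additive category of this
kind kernels and cokernels are cut out by idempotents and all monomorphisms and epimorphisms split,
so it is abelian. With finite-dimensional Hom spaces, every object then splits into simple ones by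
induction on the dimension of its endomorphism ring.

Regularity passes to retracts, to the Karoubi envelope and to full subcategories, so it suffices to
treat tuples over `k[E]`. A morphism of tuples is a corner of an endomorphism of a constant tuple
`([Z], ..., [Z])`, where `Z` is the direct sum of all entries involved. Such endomorphisms are
matrices over `k[R]`, the monoid algebra of the multiplicative monoid of the finite ring `R = End
Z`. Hence the core is that `k[R]` is semisimple (`isSemisimpleRing_of_basis`).

Since `E` is semi-simple, `R` is von Neumann regular and the categorical trace gives a cyclic
nondegenerate form `t : R → F`. On a regular ring `t` kills nilpotents, whence `t (m ^ q) = t m` for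
all large `q ≡ 1` modulo a suitable `N`. Let `φ` be the indicator function of a level set of `t`,
and let `q` be a power of a large prime `p`. The additivity of Frobenius modulo commutators gives
`φ(z ^ q) ≡ φ(z)` mod `p` for `z` in `ℤ[R]`, so `φ` vanishes on nilpotent elements
(`weight_eq_zero_of_isNilpotent`). If all multiples `x * y` of `x` in `ℚ[R]` are nilpotent, the
coefficients of `x` therefore sum to zero over every set `{m | t (m m') = a}`, and a count of
hyperplanes forces `x = 0`. So the trace form of `ℚ[R]` is nondegenerate. Its Gram matrix consists
of integers that do not depend on the field, so the form is nondegenerate over `k` as well, and the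
Jacobson radical, which lies in its kernel, is zero.

The unit condition holds because `[0] e_χ = 0` and `[a] e_χ = χ(a) e_χ`, so `k[F] e_χ` is a line.
Duals are carried from `E` through the linearization, tuples, images of idempotents and the summand.
-/

namespace LinPT

/-! ### Rotation of words and Frobenius modulo commutators. -/

section Words

theorem sum_pow_eq_sum_words {A ι : Type*} [Semiring A] [Fintype ι] (x : ι → A) (n : ℕ) :
    (∑ i, x i) ^ n = ∑ v : Fin n → ι, (List.ofFn fun i => x (v i)).prod := by
  induction n with
  | zero => simp
  | succ n ih =>
    rw [pow_succ', ih, Finset.sum_mul_sum, ← Finset.sum_product', Finset.univ_product_univ]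
    refine Fintype.sum_equiv (Fin.consEquiv fun _ => ι) _ _ fun p => ?_
    simp [List.ofFn_succ]

/-- A function that is invariant under a transformation of `p`-power order has the same sum over
all points as over the fixed points, in characteristic `p`. -/
theorem sum_eq_sum_fixedPoints {α V : Type*} [Fintype α] [CommRing V] {p n : ℕ} [Fact p.Prime]
    [CharP V p] {f : Function.End α} (hf : f ^ p ^ n = 1) (w : α → V) (hw : ∀ a, w (f a) = w a)
    [DecidablePred fun a => f a = a] :
    ∑ a, w a = ∑ a with f a = a, w a := by
  classical
  -- On a fibre of `w` the sum is a constant times a cardinality, so only cardinalities modulo `p`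
  -- have to be compared.
  rw [← Finset.sum_fiberwise_of_maps_to (s := Finset.univ) (t := Finset.univ.image w) (g := w)
      (fun a _ => Finset.mem_image_of_mem _ (Finset.mem_univ a)),
    ← Finset.sum_fiberwise_of_maps_to (s := Finset.univ.filter fun a => f a = a)
      (t := Finset.univ.image w) (g := w)
      (fun a _ => Finset.mem_image_of_mem _ (Finset.mem_univ a))]
  refine Finset.sum_congr rfl fun c _ => ?_
  rw [Finset.sum_congr rfl (g := fun _ => c) (by simp), Finset.sum_const,
    Finset.sum_congr rfl (g := fun _ => c) (by simp), Finset.sum_const, nsmul_eq_mul, nsmul_eq_mul]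
  congr 1
  let g : Function.End {a // w a = c} := fun a => ⟨f a.1, (hw _).trans a.2⟩
  have hg : ∀ m : ℕ, ∀ a, ((g ^ m) a).1 = (f ^ m) a.1 := by
    intro m
    induction m with
    | zero => intro a; rfl
    | succ m ih =>
      intro a
      rw [pow_succ, pow_succ]
      exact ih _
  have hg1 : g ^ p ^ n = 1 := by
    funext a
    apply Subtype.ext
    rw [hg, hf]
    rfl
  have h := Equiv.Perm.card_fixedPoints_modEq hg1
  replace h := (CharP.natCast_eq_natCast (R := V) p).mpr h
  rw [Fintype.card_subtype] at h
  rw [h, Finset.filter_filter, Fintype.card_subtype,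
    ← Finset.card_map (Function.Embedding.subtype _)]
  congr 2
  ext a
  simp only [Finset.mem_map, Finset.mem_filter, Finset.mem_univ, true_and]
  constructor
  · rintro ⟨⟨b, hb⟩, h, rfl⟩
    exact ⟨congrArg Subtype.val h, hb⟩
  · rintro ⟨h1, h2⟩
    exact ⟨⟨a, h2⟩, Subtype.ext h1, rfl⟩

theorem finRotate_pow_self (n : ℕ) : (finRotate n) ^ n = 1 := by
  rcases n with _ | _ | n
  · rfl
  · exact finRotate_one
  · have h := (isCycle_finRotate (n := n)).orderOf
    rw [support_finRotate, Finset.card_univ, Fintype.card_fin] at h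
    exact (congrArg (_ ^ ·) h.symm).trans (pow_orderOf_eq_one _)

theorem eq_const_of_comp_finRotate {ι : Type*} {n : ℕ} (hn : 0 < n) {v : Fin n → ι}
    (h : v ∘ finRotate n = v) (i : Fin n) : v i = v ⟨0, hn⟩ := by
  obtain ⟨n, rfl⟩ := Nat.exists_eq_succ_of_ne_zero hn.ne'
  induction i using Fin.induction with
  | zero => rfl
  | succ i ih =>
    rw [← ih, ← congrFun h i.castSucc, Function.comp_apply, finRotate_apply]
    simp

/-- The additivity of the Frobenius map modulo commutators, for a noncommutative ring. -/
theorem trace_sum_pow {A ι V : Type*} [Ring A] [Fintype ι] [CommRing V] {p : ℕ} [Fact p.Prime]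
    [CharP V p] (T : A →+ V) (hT : ∀ a b, T (a * b) = T (b * a)) (x : ι → A) (n : ℕ) :
    T ((∑ i, x i) ^ p ^ n) = ∑ i, T (x i ^ p ^ n) := by
  classical
  -- The successor form allows the first or the last letter of a word to be split off.
  obtain ⟨q, hq⟩ : ∃ q, p ^ n = q + 1 :=
    ⟨p ^ n - 1, (Nat.succ_pred_eq_of_pos (pow_pos (Fact.out (p := p.Prime)).pos n)).symm⟩
  rw [sum_pow_eq_sum_words, map_sum]
  -- The power expands into words of length `p ^ n`. Cyclicity of `T` makes their traces invariant
  -- under rotation, and the words fixed by rotation are the constant ones.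
  let f : Function.End (Fin (p ^ n) → ι) := fun v => v ∘ finRotate (p ^ n)
  have hfm : ∀ m : ℕ, ∀ v, (f ^ m) v = v ∘ ⇑((finRotate (p ^ n)) ^ m) := by
    intro m
    induction m with
    | zero => intro v; rfl
    | succ m ih =>
      intro v
      rw [pow_succ, pow_succ']
      exact ih _
  have hf : f ^ p ^ n = 1 := by
    funext v
    rw [hfm, finRotate_pow_self]
    rfl
  rw [sum_eq_sum_fixedPoints hf]
  · symm
    refine Finset.sum_bij (fun i _ => fun _ => i) ?_ ?_ ?_ ?_
    · intro i _
      simp [f]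
      rfl
    · intro i _ j _ h
      exact congrFun h ⟨0, by omega⟩
    · intro v hv
      replace hv : v ∘ finRotate (p ^ n) = v := (Finset.mem_filter.mp hv).2
      refine ⟨v ⟨0, by omega⟩, Finset.mem_univ _, ?_⟩
      exact funext fun i => (eq_const_of_comp_finRotate _ hv i).symm
    · intro i _
      simp
  · clear hfm hf
    intro v
    show T (List.ofFn fun i => x (v (finRotate _ i))).prod = _
    clear f
    generalize p ^ n = r at *
    subst hq
    -- The rotated word ends with the letter with which the original word begins; `hT` moves it to
    -- the front.
    rw [List.ofFn_succ', List.ofFn_succ (n := q), List.prod_concat, List.prod_cons, hT]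
    simp

end Words

/-! ### Class functions on a finite monoid and nilpotent elements. -/

section ClassFunctions

variable {M : Type*}

/-- The linear extension of a function on a monoid to the monoid algebra. -/
noncomputable def weight {K : Type*} [CommRing K] (φ : M → K) : MonoidAlgebra K M →ₗ[K] K :=
  Finsupp.linearCombination K φ ∘ₗ (MonoidAlgebra.coeffLinearEquiv K).toLinearMap

@[simp]
theorem weight_single {K : Type*} [CommRing K] (φ : M → K) (m : M) (r : K) :
    weight φ (MonoidAlgebra.single m r) = r * φ m := by
  simp [weight]

theorem eq_sum_single {K : Type*} [CommRing K] [Fintype M] (x : MonoidAlgebra K M) :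
    x = ∑ m, MonoidAlgebra.single m (x.coeff m) := by
  classical
  ext m
  simp

theorem weight_eq_sum {K : Type*} [CommRing K] [Fintype M] (φ : M → K) (x : MonoidAlgebra K M) :
    weight φ x = ∑ m, x.coeff m * φ m := by
  conv_lhs => rw [eq_sum_single x]
  simp

variable [Monoid M]

theorem weight_mul_comm {K : Type*} [CommRing K] (φ : M → K) (hφ : ∀ a b, φ (a * b) = φ (b * a))
    (x y : MonoidAlgebra K M) : weight φ (x * y) = weight φ (y * x) := by
  induction x using MonoidAlgebra.induction_linear with
  | zero => simp
  | add x x' hx hx' => rw [add_mul, mul_add, map_add, map_add, hx, hx']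
  | single a r =>
    induction y using MonoidAlgebra.induction_linear with
    | zero => simp
    | add y y' hy hy' => rw [add_mul, mul_add, map_add, map_add, hy, hy']
    | single b s =>
      rw [MonoidAlgebra.single_mul_single, MonoidAlgebra.single_mul_single, weight_single,
        weight_single, hφ, mul_comm r]

/-- An integral class function on a finite monoid whose value does not change under the powers
with large exponents congruent to `1` vanishes on nilpotent elements of the monoid ring. -/
theorem weight_eq_zero_of_isNilpotent [Finite M] (φ : M → ℤ) (hφ : ∀ a b, φ (a * b) = φ (b * a))
    {N c : ℕ} (hN : 0 < N) (hpow : ∀ q, c ≤ q → q ≡ 1 [MOD N] → ∀ m, φ (m ^ q) = φ m)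
    {z : MonoidAlgebra ℤ M} (hz : IsNilpotent z) : weight φ z = 0 := by
  have := Fintype.ofFinite M
  obtain ⟨K, hK⟩ := hz
  -- `p > N` makes `p` prime to `N`; `p > |weight φ z|` lets divisibility by `p` force vanishing at
  -- the end.
  obtain ⟨p, hpb, hp⟩ := Nat.exists_infinite_primes (N + (weight φ z).natAbs + 1)
  have : Fact p.Prime := ⟨hp⟩
  -- The factor `N.totient` gives `p ^ j ≡ 1` mod `N`; the factor `c + K` makes `p ^ j` exceed both
  -- the threshold `c` and the nilpotency exponent `K`.
  set j := N.totient * (c + K) with hj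
  have hq1 : p ^ j ≡ 1 [MOD N] := by
    have h : (p ^ N.totient) ≡ 1 [MOD N] := Nat.ModEq.pow_totient

      (Nat.coprime_of_lt_prime hN.ne' (by omega) hp)
    rw [hj, pow_mul]
    simpa using h.pow (c + K)
  have hqj : c + K ≤ p ^ j := by
    have h1 : j < p ^ j := Nat.lt_pow_self hp.one_lt
    have h2 : c + K ≤ j := Nat.le_mul_of_pos_left _ (Nat.totient_pos.mpr hN)
    omega
  let ρ := MonoidAlgebra.mapRingHom M (Int.castRingHom (ZMod p))
  have hρ : ρ z ^ p ^ j = 0 := by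
    rw [← map_pow, pow_eq_zero_of_le (by omega) hK, map_zero]
  have h := trace_sum_pow (p := p) (weight fun m => (φ m : ZMod p)).toAddMonoidHom
    (weight_mul_comm _ fun a b => by rw [hφ]) (fun m => MonoidAlgebra.single m ((ρ z).coeff m)) j
  rw [← eq_sum_single, hρ, map_zero] at h
  have h0 : ((weight φ z : ℤ) : ZMod p) = 0 := by
    rw [h, weight_eq_sum]
    push_cast
    refine Finset.sum_congr rfl fun m _ => ?_
    -- The power `p ^ j` changes neither the coefficients in `ZMod p`, by Fermat, nor the values of
    -- `φ`, by `hpow`.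
    rw [MonoidAlgebra.single_pow, ZMod.pow_card_pow]
    simp [ρ, hpow _ (by omega) hq1]
  rw [ZMod.intCast_zmod_eq_zero_iff_dvd] at h0
  exact Int.eq_zero_of_abs_lt_dvd h0 (by rw [Int.abs_eq_natAbs]; omega)

end ClassFunctions

/-! ### Traces on von Neumann regular rings. -/

section RegularRings

/-- If `x g x = x`, then `t x = t (x g x) = t (g x x)`, and `(g x x) ^ (i + 1) = g x ^ (i + 2)`. So
`x` may be replaced by `g x x`, whose nilpotency exponent is smaller by one. -/
theorem trace_eq_zero_of_isNilpotent {R V : Type*} [Ring R] [AddCommGroup V] (t : R →+ V)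
    (ht : ∀ a b, t (a * b) = t (b * a)) (hreg : ∀ a : R, ∃ b, a * b * a = a) {x : R}
    (hx : IsNilpotent x) : t x = 0 := by
  obtain ⟨j, hj⟩ := hx
  induction j generalizing x with
  | zero =>
    rw [pow_zero] at hj
    rw [← mul_one x, hj, mul_zero, map_zero]
  | succ j ih =>
    rcases j with _ | j
    · rw [← pow_one x, hj, map_zero]
    obtain ⟨g, hg⟩ := hreg x
    have hpow : ∀ i, (g * x * x) ^ (i + 1) = g * x ^ (i + 2) := by
      intro i
      induction i with
      | zero => rw [zero_add, pow_one, pow_two, mul_assoc]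
      | succ i ih =>
        calc (g * x * x) ^ (i + 1 + 1) = g * x ^ (i + 1) * (x * g * x) * x := by
              rw [pow_succ, ih, pow_succ x (i + 1)]
              simp only [mul_assoc]
          _ = g * x ^ (i + 1 + 2) := by
              rw [hg, pow_succ x (i + 2), pow_succ x (i + 1)]
              simp only [mul_assoc]
    have h1 : t x = t (g * x * x) := by
      conv_lhs => rw [← hg, mul_assoc]
      rw [ht]
    rw [h1]
    apply ih
    rw [hpow, hj, mul_zero]

/-- Among the first `|M| + 1` powers of `m` two agree, so the powers from exponent `|M|` on have a
period at most `|M|`. It divides `|M|!`, which therefore serves for all `m` at once. -/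
theorem exists_period_pow (M : Type*) [Monoid M] [Finite M] :
    ∃ N c : ℕ, 0 < N ∧ ∀ m : M, ∀ i, c ≤ i → ∀ s, m ^ (i + N * s) = m ^ i := by
  have := Fintype.ofFinite M
  refine ⟨(Fintype.card M).factorial, Fintype.card M, Nat.factorial_pos _, fun m i hi s => ?_⟩
  obtain ⟨a, b, hab, h⟩ := Fintype.exists_ne_map_eq_of_card_lt
    (fun j : Fin (Fintype.card M + 1) => m ^ (j : ℕ)) (by simp)
  wlog hlt : a < b generalizing a b
  · exact this b a hab.symm h.symm (lt_of_le_of_ne (not_lt.mp hlt) hab.symm)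
  have hstep : ∀ i, Fintype.card M ≤ i → ∀ s, m ^ (i + ((b : ℕ) - a) * s) = m ^ i := by
    intro i hi s
    induction s with
    | zero => simp
    | succ s ih =>
      have e1 : i + ((b : ℕ) - a) * (s + 1) = b + (i + ((b : ℕ) - a) * s - a) := by
        rw [Nat.mul_succ]
        have := a.is_lt
        have : (a : ℕ) < b := hlt
        omega
      have e2 : i + ((b : ℕ) - a) * s = a + (i + ((b : ℕ) - a) * s - a) := by
        have := a.is_lt
        have := b.is_lt
        have : (a : ℕ) < b := hlt
        omega
      rw [← ih, e1]
      conv_rhs => rw [e2]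
      rw [pow_add, pow_add, ← h]
  obtain ⟨d, hd⟩ : ((b : ℕ) - a) ∣ (Fintype.card M).factorial :=
    Nat.dvd_factorial (by have : (a : ℕ) < b := hlt; omega) (by have := b.is_lt; omega)
  rw [hd, mul_assoc]
  exact hstep i hi _

/-- For `q = 1 + N s` the difference `m ^ q - m = m (m ^ (N s) - 1)` is nilpotent: a high power of
it contains `m ^ (c + 1) (m ^ (N s) - 1)`, which is zero by periodicity. The trace does not see it.
-/
theorem trace_pow_eq {R V : Type*} [Ring R] [AddCommGroup V] (t : R →+ V)
    (ht : ∀ a b, t (a * b) = t (b * a)) (hreg : ∀ a : R, ∃ b, a * b * a = a) [Finite R] :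
    ∃ N c : ℕ, 0 < N ∧ ∀ q, c ≤ q → q ≡ 1 [MOD N] → ∀ m : R, t (m ^ q) = t m := by
  obtain ⟨N, c, hN, h⟩ := exists_period_pow R
  -- The threshold `c + 1` ensures `1 ≤ q`, so that `q - 1` is a genuine multiple of `N`.
  refine ⟨N, c + 1, hN, fun q hq hq1 m => ?_⟩
  rw [← sub_eq_zero, ← map_sub]
  apply trace_eq_zero_of_isNilpotent t ht hreg
  obtain ⟨s, hs⟩ := (Nat.modEq_iff_dvd' (by omega : 1 ≤ q)).mp hq1.symm
  obtain rfl : q = 1 + N * s := by omega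
  refine ⟨c + 1, ?_⟩
  have hc : Commute m (m ^ (N * s) - 1) :=
    ((Commute.refl m).pow_right _).sub_right (Commute.one_right m)
  rw [show m ^ (1 + N * s) - m = m * (m ^ (N * s) - 1) by rw [mul_sub, pow_add, pow_one, mul_one],
    hc.mul_pow, pow_succ' (m ^ (N * s) - 1), ← mul_assoc, mul_sub, ← pow_add,
    h m (c + 1) (by omega),
    mul_one, sub_self, zero_mul]

/-- Take a complement `J` of the left ideal `Aa` and write `1 = b a + f` with `f` in `J`. Then `a f
= a - a b a` lies in both `Aa` and `J`. -/
theorem IsSemisimpleRing.exists_mul_mul_eq {A : Type*} [Ring A] [IsSemisimpleRing A] (a : A) :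
    ∃ b, a * b * a = a := by
  obtain ⟨J, hJ⟩ := exists_isCompl (Ideal.span {a})
  obtain ⟨e, he, f, hf, hef⟩ := Submodule.mem_sup.mp
    ((Submodule.eq_top_iff'.mp hJ.sup_eq_top) (1 : A))
  obtain ⟨b, rfl⟩ := Ideal.mem_span_singleton'.mp he
  refine ⟨b, ?_⟩
  have h1 : a * f = a - a * b * a := by
    have := congrArg (a * ·) hef
    simp only [mul_add, mul_one] at this
    rw [eq_sub_iff_add_eq', mul_assoc, this]
  have h2 : a * f = 0 := by
    have : a * f ∈ Ideal.span {a} ⊓ J := by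
      refine ⟨?_, J.mul_mem_left a hf⟩
      rw [h1]
      exact sub_mem (Ideal.mem_span_singleton_self a)
        (Ideal.mul_mem_left _ _ (Ideal.mem_span_singleton_self a))
    rwa [hJ.inf_eq_bot, Submodule.mem_bot] at this
  rw [h2] at h1
  exact (sub_eq_zero.mp h1.symm).symm

end RegularRings

/-! ### Semisimplicity of the monoid algebra of a finite regular ring. -/

section MonoidAlgebraSemisimple

/-- A common denominator of the coefficients reduces this to the integral case. -/
theorem weight_eq_zero_of_isNilpotent_rat {M : Type*} [Monoid M] [Finite M] (φ : M → ℤ)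
    (hφ : ∀ a b, φ (a * b) = φ (b * a)) {N c : ℕ} (hN : 0 < N)
    (hpow : ∀ q, c ≤ q → q ≡ 1 [MOD N] → ∀ m, φ (m ^ q) = φ m)
    {x : MonoidAlgebra ℚ M} (hx : IsNilpotent x) : weight (fun m => (φ m : ℚ)) x = 0 := by
  classical
  have := Fintype.ofFinite M
  obtain ⟨d, hd⟩ := IsLocalization.exist_integer_multiples_of_finset (nonZeroDivisors ℤ)
    (Finset.univ.image fun m => x.coeff m)
  have hd' : ∀ m, ∃ z : ℤ, (z : ℚ) = (d : ℤ) * x.coeff m := fun m => by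
    obtain ⟨z, hz⟩ := hd (x.coeff m) (Finset.mem_image_of_mem _ (Finset.mem_univ m))
    exact ⟨z, hz.trans (zsmul_eq_mul _ _)⟩
  choose z hz using hd'
  let ρ := MonoidAlgebra.mapRingHom M (Int.castRingHom ℚ)
  have hρ : Function.Injective ρ := MonoidAlgebra.map_injective _ (Int.cast_injective)
  let y : MonoidAlgebra ℤ M := ∑ m, MonoidAlgebra.single m (z m)
  have hy : ρ y = ((d : ℤ) : ℚ) • x := by
    conv_rhs => rw [eq_sum_single x]
    rw [map_sum, Finset.smul_sum]
    refine Finset.sum_congr rfl fun m _ => ?_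
    rw [MonoidAlgebra.smul_single, smul_eq_mul, ← hz]
    simp [ρ]
  have hyn : IsNilpotent y := by
    rw [← IsNilpotent.map_iff hρ, hy]
    exact hx.smul _
  have h := weight_eq_zero_of_isNilpotent φ hφ hN hpow hyn
  have h1 : weight (fun m => (φ m : ℚ)) (ρ y) = (weight φ y : ℤ) := by
    rw [weight_eq_sum, weight_eq_sum]
    simp [ρ]
  rw [hy, h, map_smul, Int.cast_zero, smul_eq_mul, mul_eq_zero] at h1
  exact h1.resolve_left (Int.cast_ne_zero.mpr (nonZeroDivisors.ne_zero d.2))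

/-- By nondegeneracy `m ↦ t (d m)` is a nonzero linear form, hence onto `F`, and its kernel has
index `|F|`. -/
theorem card_hyperplane {F R : Type*} [Field F] [Ring R] [Algebra F R] (t : R →ₗ[F] F)
    (hnd : ∀ a : R, a ≠ 0 → ∃ b, t (a * b) ≠ 0) (d : R) (hd : d ≠ 0) :
    Nat.card F * Nat.card {m // t (d * m) = 0} = Nat.card R := by
  let f : R →ₗ[F] F := t ∘ₗ LinearMap.mulLeft F d
  have hf : Function.Surjective f := by
    obtain ⟨b, hb⟩ := hnd d hd
    intro a
    refine ⟨(a * (t (d * b))⁻¹) • b, ?_⟩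
    simp [f, hb]
  have h1 := Submodule.card_eq_card_quotient_mul_card (LinearMap.ker f)
  rw [Nat.card_congr (f.quotKerEquivOfSurjective hf).toEquiv] at h1
  rw [h1, mul_comm]
  rfl

variable {F R : Type*} [Field F] [Finite F] [Ring R] [Finite R] [Algebra F R] (t : R →ₗ[F] F)
  (ht : ∀ a b, t (a * b) = t (b * a)) (hreg : ∀ a : R, ∃ b, a * b * a = a)
  (hnd : ∀ a : R, a ≠ 0 → ∃ b, t (a * b) ≠ 0)

-- Indicator functions of the level sets of `t` vanish on the nilpotent elements `x [m']`, which
-- says that the coefficients of `x` sum to zero over each set `{m | t (m m') = a}`. To isolate the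
-- coefficient at `m₀`, take `a = t (m₀ m')` and sum over `m'`: the element `m₀` is counted `|R|`
-- times, every other one only `|R| / |F|` times.
include ht hreg hnd in
theorem eq_zero_of_mul_isNilpotent {x : MonoidAlgebra ℚ R} (hx : ∀ y, IsNilpotent (x * y)) :
    x = 0 := by
  classical
  have := Fintype.ofFinite R
  obtain ⟨N, c, hN, hpow⟩ := trace_pow_eq t.toAddMonoidHom ht hreg
  have key : ∀ (a : F) (m' : R), ∑ m, x.coeff m * (if t (m * m') = a then 1 else 0) = 0 := by
    intro a m'
    have h := weight_eq_zero_of_isNilpotent_rat (fun m : R => if t m = a then 1 else 0)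
      (fun r s => by rw [ht]) hN (fun q h1 h2 m => by
        have : t (m ^ q) = t m := hpow q h1 h2 m
        rw [this])
      (hx (MonoidAlgebra.single m' 1))
    rw [eq_sum_single x, Finset.sum_mul, map_sum] at h
    simpa [MonoidAlgebra.single_mul_single] using h
  -- For `m' = 0` and `a = 0` the condition holds for every `m`.
  have hsum : ∑ m, x.coeff m = 0 := by simpa using key 0 0
  have hcount : ∀ d : R, d ≠ 0 →
      (Nat.card F : ℚ) * ∑ m', (if t (d * m') = 0 then 1 else 0) = Nat.card R := by
    intro d hd
    rw [← card_hyperplane t hnd d hd, Nat.cast_mul, Finset.sum_boole,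
      Nat.card_eq_fintype_card (α := {m // t (d * m) = 0}), Fintype.card_subtype]
  ext m₀
  have h0 : ∑ m', ∑ m, x.coeff m * (if t (m * m') = t (m₀ * m') then (1 : ℚ) else 0) = 0 :=
    Finset.sum_eq_zero fun m' _ => key _ _
  rw [Finset.sum_comm] at h0
  -- After multiplication by `|F|` each `m` contributes `|R|`, with an excess `(|F| - 1) |R|` at
  -- `m₀`. The common part drops out by `hsum`.
  have h1 : ∀ m, (Nat.card F : ℚ) *
      ∑ m', x.coeff m * (if t (m * m') = t (m₀ * m') then (1 : ℚ) else 0) =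
      x.coeff m * Nat.card R +
        (if m = m₀ then x.coeff m * (((Nat.card F : ℚ) - 1) * Nat.card R) else 0) := by
    intro m
    rw [← Finset.mul_sum]
    by_cases hm : m = m₀
    · subst hm
      simp
      ring
    · rw [if_neg hm, add_zero, ← hcount (m - m₀) (sub_ne_zero.mpr hm)]
      simp only [sub_mul, map_sub, sub_eq_zero]
      ring
  have h2 := congrArg (fun u => (Nat.card F : ℚ) * u) h0
  simp only [Finset.mul_sum (Finset.univ) (fun m => ∑ m', _), h1, mul_zero,
    Finset.sum_add_distrib, ← Finset.sum_mul, hsum, zero_mul, zero_add, Finset.sum_ite_eq',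
    Finset.mem_univ, if_true] at h2
  rcases mul_eq_zero.mp h2 with h | h
  · simpa using h
  · exfalso
    have : 1 < Nat.card F := Finite.one_lt_card
    have hR : 0 < Nat.card R := Nat.card_pos
    rcases mul_eq_zero.mp h with h | h
    · have : (Nat.card F : ℚ) = 1 := by linarith
      norm_cast at this
      omega
    · norm_cast at h
      omega

/-- The trace of the left regular representation. -/
noncomputable def regTrace (k A : Type*) [Field k] [Ring A] [Algebra k A] : A →ₗ[k] k :=
  LinearMap.trace k A ∘ₗ (Algebra.lmul k A).toLinearMap

theorem regTrace_apply {k A : Type*} [Field k] [Ring A] [Algebra k A] (x : A) :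
    regTrace k A x = LinearMap.trace k A (Algebra.lmul k A x) := rfl

/-- In the Artinian commutative algebra `k[x]` the powers of `x` stabilize up to multiples, which
produces an idempotent `e`, divisible by `x`, with `x ^ (n + 1) e = x ^ (n + 1)`. The trace of `e`
is zero by hypothesis and equals its rank in characteristic zero, so `e = 0`. -/
theorem isNilpotent_of_trace_mul_eq_zero {k A : Type*} [Field k] [CharZero k] [Ring A] [Algebra k A]
    [Module.Finite k A] {x : A} (hx : ∀ y, regTrace k A (x * y) = 0) : IsNilpotent x := by
  let B := Algebra.adjoin k {x}
  have : IsArtinianRing B := IsArtinianRing.of_finite k B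
  let x' : B := ⟨x, Algebra.self_mem_adjoin_singleton k x⟩
  obtain ⟨n, y, hy⟩ := IsArtinian.exists_pow_succ_smul_dvd (M := B) x' 1
  have hy : x' ^ (n + 1) * y = x' ^ n := by simpa using hy
  have hc : Commute x' y := IsMulCommutative.is_comm.comm _ _
  have hj : ∀ j, x' ^ (n + 1 + j) * y ^ j = x' ^ (n + 1) := by
    intro j
    induction j with
    | zero => simp
    | succ j ih =>
      calc x' ^ (n + 1 + (j + 1)) * y ^ (j + 1)
          = x' * x' ^ j * (x' ^ (n + 1) * y) * y ^ j := by
            rw [pow_succ' y, ← mul_assoc, ← pow_succ', mul_assoc, mul_assoc,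
              ← mul_assoc (x' ^ (j + 1)),
              ← mul_assoc (x' ^ (j + 1)), ← pow_add, mul_assoc]
            congr 2
            omega
        _ = x' ^ (n + 1) := by
          rw [hy, ← pow_succ', ← pow_add, ← ih]
          congr 2
          omega
  set e : B := x' ^ (n + 1) * y ^ (n + 1) with he
  have hcp : Commute (x' ^ (n + 1)) (y ^ (n + 1)) := hc.pow_pow _ _
  have he1 : x' ^ (n + 1) * e = x' ^ (n + 1) := by
    rw [he, ← mul_assoc, ← pow_add, hj]
  have he2 : IsIdempotentElem e := by
    have h : e = y ^ (n + 1) * x' ^ (n + 1) := hcp.eq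
    calc e * e = y ^ (n + 1) * (x' ^ (n + 1) * e) :=
          (congrArg (· * e) h).trans (mul_assoc _ _ _)
      _ = e := by rw [he1, ← h]
  have h0 : (e : A) = 0 := by
    have hi : IsIdempotentElem (Algebra.lmul k A (e : A)) := by
      show _ * _ = _
      rw [← map_mul]
      exact congrArg (fun a : B => Algebra.lmul k A (a : A)) he2
    have hz : LinearMap.trace k A (Algebra.lmul k A (e : A)) = 0 := by
      have h := hx (x ^ n * (y : A) ^ (n + 1))
      rw [← mul_assoc, ← pow_succ'] at h
      exact h
    have := congrArg (fun f : A →ₗ[k] A => f 1)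
      (LinearMap.IsIdempotentElem.eq_zero_of_trace_eq_zero hi hz)
    simpa using this
  refine ⟨n + 1, ?_⟩
  have := congrArg (fun a : B => (a : A)) he1
  simpa [h0, x'] using this.symm

/-- The matrix whose entry at `(r, s)` is the trace of `r s` on the regular representation. -/
noncomputable def fixMatrix (R : Type*) [Mul R] : Matrix R R ℤ :=
  fun r s => Nat.card {h : R // r * s * h = h}

/-- Left multiplication by `b (r s)` sends basis elements to basis elements, so its trace counts the
fixed ones. The resulting integer is the same for every field `k`. -/
theorem trace_basis_mul {R k A : Type*} [Mul R] [Finite R] [Field k] [Ring A] [Algebra k A]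
    (b : Module.Basis R k A) (hb : ∀ r s, b (r * s) = b r * b s) (r s : R) :
    regTrace k A (b r * b s) = (fixMatrix R r s : k) := by
  classical
  have := Fintype.ofFinite R
  rw [regTrace_apply, LinearMap.trace_eq_matrix_trace k b, Matrix.trace, fixMatrix,
    Nat.card_eq_fintype_card,
    Fintype.card_subtype, Int.cast_natCast, ← Finset.sum_boole]
  refine Finset.sum_congr rfl fun h _ => ?_
  rw [Matrix.diag_apply, LinearMap.toMatrix_apply, Algebra.coe_lmul_eq_mul, LinearMap.mul_apply',
    ← hb, ← hb, Module.Basis.repr_self,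
    Finsupp.single_apply]

-- A null vector over `ℚ` would be an `x` in `ℚ[R]` orthogonal to everything under the trace form.
-- Then each `x y` is orthogonal to everything too, hence nilpotent, and `x = 0`.
include ht hreg hnd in
theorem det_fixMatrix_ne_zero [Fintype R] [DecidableEq R] : (fixMatrix R).det ≠ 0 := by
  intro h0
  let b : Module.Basis R ℚ (MonoidAlgebra ℚ R) :=
    Module.Basis.ofRepr (MonoidAlgebra.coeffLinearEquiv ℚ)
  have hbs : ∀ r, b r = MonoidAlgebra.single r 1 := fun r => rfl
  have hb : ∀ r s, b (r * s) = b r * b s := fun r s => by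
    rw [hbs, hbs, hbs, MonoidAlgebra.single_mul_single, one_mul]
  have : Module.Finite ℚ (MonoidAlgebra ℚ R) := Module.Finite.of_basis b
  have h1 : ((fixMatrix R).map (Int.castRingHom ℚ)).det = 0 := by
    rw [← RingHom.mapMatrix_apply, ← RingHom.map_det, h0, map_zero]
  obtain ⟨v, hv, hv0⟩ := Matrix.exists_vecMul_eq_zero_iff.mpr h1
  have hx : ∀ y, regTrace ℚ _ ((∑ r, v r • b r) * y) = 0 := by
    intro y
    rw [← b.sum_repr y, Finset.mul_sum, map_sum]
    refine Finset.sum_eq_zero fun s _ => ?_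
    rw [mul_smul_comm, map_smul, Finset.sum_mul, map_sum]
    have := congrFun hv0 s
    simp only [Matrix.vecMul, dotProduct, Matrix.map_apply, Pi.zero_apply] at this
    simp only [smul_mul_assoc, map_smul, trace_basis_mul b hb, smul_eq_mul]
    rw [show ∑ r, v r * ((fixMatrix R r s : ℤ) : ℚ) = 0 from this, mul_zero]
  have hx0 := eq_zero_of_mul_isNilpotent t ht hreg hnd (x := ∑ r, v r • b r) fun y =>
    isNilpotent_of_trace_mul_eq_zero (k := ℚ) fun z => by rw [mul_assoc, hx]
  exact hv (funext (Fintype.linearIndependent_iff.mp b.linearIndependent v hx0))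

include ht hreg hnd in
/-- The monoid algebra of the multiplicative monoid of a finite regular ring with a nondegenerate
trace form is semisimple in characteristic zero. -/
theorem isSemisimpleRing_of_basis {k A : Type*} [Field k] [CharZero k] [Ring A] [Algebra k A]
    (b : Module.Basis R k A) (hb : ∀ r s, b (r * s) = b r * b s) : IsSemisimpleRing A := by
  classical
  have := Fintype.ofFinite R
  have : Module.Finite k A := Module.Finite.of_basis b
  have : IsArtinianRing A := IsArtinianRing.of_finite k A
  rw [IsArtinianRing.isSemisimpleRing_iff_jacobson, eq_bot_iff]
  intro x hx
  -- The radical of an Artinian ring is nilpotent, so it lies in the kernel of the trace form.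
  have htr : ∀ y, regTrace k A (x * y) = 0 := by
    intro y
    have hxy : x * y ∈ Ring.jacobson A := Ideal.mul_mem_right _ _ hx
    obtain ⟨n, hn⟩ := IsSemiprimaryRing.isNilpotent (R := A)
    have : IsNilpotent (x * y) := by
      refine ⟨n, ?_⟩
      have := Ideal.pow_mem_pow hxy n
      rwa [hn] at this
    exact (LinearMap.isNilpotent_trace_of_isNilpotent (this.map (Algebra.lmul k A))).eq_zero
  -- The determinant is a nonzero integer, so it remains nonzero in any field of characteristic
  -- zero.
  have hdet : ((fixMatrix R).map (Int.castRingHom k)).det ≠ 0 := by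
    rw [← RingHom.mapMatrix_apply, ← RingHom.map_det]
    exact Int.cast_ne_zero.mpr (det_fixMatrix_ne_zero t ht hreg hnd)
  have hv : (b.repr x : R → k) = 0 := by
    apply Matrix.eq_zero_of_vecMul_eq_zero hdet
    funext s
    have := htr (b s)
    rw [← b.sum_repr x, Finset.sum_mul, map_sum] at this
    simp only [smul_mul_assoc, map_smul, trace_basis_mul b hb, smul_eq_mul] at this
    exact this
  exact b.repr.map_eq_zero_iff.mp (DFunLike.coe_injective hv)

end MonoidAlgebraSemisimple

/-! ### Generalized inverses of morphisms. -/

section Regular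

variable {C : Type u} [Category.{v} C]

/-- A morphism is (von Neumann) regular if it has a generalized inverse. -/
def IsRegularMor {X Y : C} (f : X ⟶ Y) : Prop := ∃ g : Y ⟶ X, f ≫ g ≫ f = f

theorem IsRegularMor.of_retract {X Y X' Y' : C} {f : X ⟶ Y} {i : X ⟶ X'} {r : X' ⟶ X}
    (hir : i ≫ r = 𝟙 X) {j : Y ⟶ Y'} {s : Y' ⟶ Y} (hjs : j ≫ s = 𝟙 Y)
    (h : IsRegularMor (r ≫ f ≫ j)) : IsRegularMor f := by
  obtain ⟨g, hg⟩ := h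
  refine ⟨j ≫ g ≫ r, ?_⟩
  have := congrArg (fun t => i ≫ t ≫ s) hg
  simpa [reassoc_of% hir, hjs] using this

variable [Preadditive C]

/-- McCoy's lemma: a generalized inverse of the defect `f - f ≫ h ≫ f` corrects the approximate
inverse `h`. It is the elimination step below. -/
theorem IsRegularMor.of_sub {X Y : C} {f : X ⟶ Y} (h : Y ⟶ X)
    (hf : IsRegularMor (f - f ≫ h ≫ f)) : IsRegularMor f := by
  obtain ⟨g, hg⟩ := hf
  refine ⟨h + (𝟙 _ - h ≫ f) ≫ g ≫ (𝟙 _ - f ≫ h), ?_⟩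
  have e : f ≫ ((𝟙 _ - h ≫ f) ≫ g ≫ (𝟙 _ - f ≫ h)) ≫ f =
      (f - f ≫ h ≫ f) ≫ g ≫ (f - f ≫ h ≫ f) := by
    simp only [Preadditive.comp_sub, Preadditive.sub_comp, Category.assoc, Category.comp_id,
      Category.id_comp]
  rw [Preadditive.add_comp, Preadditive.comp_add, e, hg]
  abel

/-- A finite family of morphisms exhibiting an object as a direct sum. -/
structure Decomposition {n : ℕ} (X : C) (S : Fin n → C) where
  ι : ∀ i, S i ⟶ X
  π : ∀ i, X ⟶ S i
  ι_π_self : ∀ i, ι i ≫ π i = 𝟙 (S i)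
  ι_π_ne : ∀ i j, i ≠ j → ι i ≫ π j = 0
  total : ∑ i, π i ≫ ι i = 𝟙 X

/-- The decomposition given by an isomorphism with a biproduct. -/
noncomputable def Decomposition.ofIso {n : ℕ} {X : C} {S : Fin n → C} [HasBiproduct S]
    (e : X ≅ ⨁ S) :
    Decomposition X S where
  ι i := biproduct.ι S i ≫ e.inv
  π i := e.hom ≫ biproduct.π S i
  ι_π_self i := by simp
  ι_π_ne i j h := by simp [biproduct.ι_π_ne S h]
  total := by
    simp only [Category.assoc]
    rw [← Preadditive.comp_sum]
    simp only [← Category.assoc (biproduct.π S _)]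
    rw [← Preadditive.sum_comp, biproduct.total]
    simp

theorem Decomposition.exists_iso {n : ℕ} {X : C} {S : Fin n → C} (d : Decomposition X S) :
    ∃ _ : HasBiproduct S, Nonempty (X ≅ ⨁ S) := by
  let b : Bicone S :=
    { pt := X
      ι := d.ι
      π := d.π
      ι_π := fun i j => by
        split_ifs with h
        · subst h
          simpa using d.ι_π_self i
        · exact d.ι_π_ne i j h }
  have hb : b.IsBilimit := isBilimitOfTotal b d.total
  have : HasBiproduct S := HasBiproduct.mk ⟨b, hb⟩
  exact ⟨this, ⟨biproduct.uniqueUpToIso S hb⟩⟩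

/-- In a category with kernels, a morphism between finite direct sums of simple objects is
regular. -/
theorem isRegularMor_of_decomposition [HasKernels C] {m n : ℕ} {X Y : C} {S : Fin m → C}
    {T : Fin n → C} (hS : ∀ i, Simple (S i)) (hT : ∀ i, Simple (T i)) (dX : Decomposition X S)
    (dY : Decomposition Y T) (f : X ⟶ Y) : IsRegularMor f := by
  classical
  -- Gaussian elimination: `J` contains the simple summands of the source on which `f` may still be
  -- nonzero.
  suffices H : ∀ (J : Finset (Fin m)) (f : X ⟶ Y), (∀ i ∉ J, dX.ι i ≫ f = 0) → IsRegularMor f from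
    H Finset.univ f (by simp)
  intro J
  induction J using Finset.induction_on with
  | empty =>
    intro f hf
    have : f = 0 := by
      rw [← Category.id_comp f, ← dX.total, Preadditive.sum_comp]
      exact Finset.sum_eq_zero fun i _ => by simp [hf i]
    exact ⟨0, by simp [this]⟩
  | insert i J hi ih =>
    intro f hf
    by_cases h0 : dX.ι i ≫ f = 0
    · apply ih
      intro l hl
      by_cases hli : l = i
      · rw [hli, h0]
      · exact hf l (by simp [hl, hli])
    · obtain ⟨j, hj⟩ : ∃ j, dX.ι i ≫ f ≫ dY.π j ≠ 0 := by
        by_contra! hc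
        apply h0
        rw [← Category.comp_id (dX.ι i ≫ f), ← dY.total, Preadditive.comp_sum]
        exact Finset.sum_eq_zero fun j _ => by
          have := hc j
          rw [Category.assoc, reassoc_of% this, zero_comp]
      have := hS i
      have := hT j
      have := isIso_of_hom_simple hj
      -- The pivot, a nonzero entry between simple objects, is invertible by Schur's lemma. With `h`
      -- built from its inverse, `f - f ≫ h ≫ f` vanishes on the summand `i` and still vanishes
      -- where `f` did.
      apply IsRegularMor.of_sub (dY.π j ≫ inv (dX.ι i ≫ f ≫ dY.π j) ≫ dX.ι i)
      apply ih
      intro l hl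
      by_cases hli : l = i
      · subst hli
        have := IsIso.hom_inv_id_assoc (dX.ι l ≫ f ≫ dY.π j) (dX.ι l ≫ f)
        simp only [Category.assoc] at this
        simp [Preadditive.comp_sub, this]
      · have := hf l (by simp [hl, hli])
        simp [Preadditive.comp_sub, reassoc_of% this, this]

theorem isRegularMor_of_isSemisimple [HasKernels C] (hs : IsSemisimple C) {X Y : C} (f : X ⟶ Y) :
    IsRegularMor f := by
  obtain ⟨m, S, _, hS, ⟨e⟩⟩ := hs X
  obtain ⟨n, T, _, hT, ⟨e'⟩⟩ := hs Y
  exact isRegularMor_of_decomposition hS hT (.ofIso e) (.ofIso e') f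

end Regular

/-! ### Idempotent-complete categories in which all morphisms are regular. -/

section RegularCategory

variable {C : Type u} [Category.{v} C] [Preadditive C] [IsIdempotentComplete C]

theorem exists_complement {X Y : C} {i : Y ⟶ X} {r : X ⟶ Y} (h : i ≫ r = 𝟙 Y) :
    ∃ (Z : C) (j : Z ⟶ X) (s : X ⟶ Z), j ≫ s = 𝟙 Z ∧ s ≫ j = 𝟙 X - r ≫ i ∧ j ≫ r = 0 ∧
      i ≫ s = 0 := by
  obtain ⟨Z, j, s, h1, h2⟩ := IsIdempotentComplete.idempotents_split X (𝟙 X - r ≫ i) (by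
    simp [Preadditive.comp_sub, Preadditive.sub_comp, reassoc_of% h])
  refine ⟨Z, j, s, h1, h2, ?_, ?_⟩
  · rw [← Category.id_comp (j ≫ r), ← h1, Category.assoc, reassoc_of% h2]
    simp [Preadditive.sub_comp, h]
  · rw [← Category.comp_id (i ≫ s), ← h1, Category.assoc, reassoc_of% h2]
    simp [Preadditive.sub_comp, Preadditive.comp_sub, reassoc_of% h]

variable (hreg : ∀ {X Y : C} (f : X ⟶ Y), IsRegularMor f)

include hreg

/-- The kernel of `f` is the image of the idempotent `𝟙 X - f ≫ g`, for `g` a generalized inverse.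
-/
theorem hasKernels_of_regular : HasKernels C where
  has_limit {X Y} f := by
    obtain ⟨g, hg⟩ := hreg f
    obtain ⟨Z, j, s, h1, h2⟩ := IsIdempotentComplete.idempotents_split X (𝟙 X - f ≫ g) (by
      simp [Preadditive.comp_sub, Preadditive.sub_comp, reassoc_of% hg])
    have h3 : j ≫ f = 0 := by
      rw [← Category.id_comp (j ≫ f), ← h1, Category.assoc, reassoc_of% h2]
      simp [Preadditive.sub_comp, hg]
    exact ⟨⟨⟨KernelFork.ofι j h3, KernelFork.IsLimit.ofι _ _ (fun h _ => h ≫ s)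
      (fun h w => by
        rw [Category.assoc, h2, Preadditive.comp_sub, reassoc_of% w]
        simp)
      (fun h w m hm => by rw [← hm, Category.assoc, h1, Category.comp_id])⟩⟩⟩

theorem hasCokernels_of_regular : HasCokernels C where
  has_colimit {X Y} f := by
    obtain ⟨g, hg⟩ := hreg f
    obtain ⟨Z, j, s, h1, h2⟩ := IsIdempotentComplete.idempotents_split Y (𝟙 Y - g ≫ f) (by
      simp [Preadditive.comp_sub, Preadditive.sub_comp, hg])
    have h3 : f ≫ s = 0 := by
      rw [← Category.comp_id (f ≫ s), ← h1, Category.assoc, reassoc_of% h2]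
      simp [Preadditive.sub_comp, Preadditive.comp_sub, reassoc_of% hg]
    exact ⟨⟨⟨CokernelCofork.ofπ s h3, CokernelCofork.IsColimit.ofπ _ _ (fun h _ => j ≫ h)
      (fun h w => by
        rw [reassoc_of% h2, Preadditive.sub_comp, Category.assoc, w]
        simp)
      (fun h w m hm => by rw [← hm, reassoc_of% h1])⟩⟩⟩

omit [Preadditive C] [IsIdempotentComplete C] in
theorem exists_retraction_of_mono {X Y : C} (f : X ⟶ Y) [Mono f] : ∃ g, f ≫ g = 𝟙 X := by
  obtain ⟨g, hg⟩ := hreg f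
  exact ⟨g, by rw [← cancel_mono f, Category.assoc, hg, Category.id_comp]⟩

omit [Preadditive C] [IsIdempotentComplete C] in
theorem exists_section_of_epi {X Y : C} (f : X ⟶ Y) [Epi f] : ∃ g, g ≫ f = 𝟙 Y := by
  obtain ⟨g, hg⟩ := hreg f
  exact ⟨g, by rw [← cancel_epi f, hg, Category.comp_id]⟩

-- A monomorphism `f` has a retraction `g`, and is then the kernel of `𝟙 Y - g ≫ f`.
omit [IsIdempotentComplete C] in
theorem isNormalMonoCategory_of_regular : IsNormalMonoCategory C where
  normalMonoOfMono {X Y} f _ := by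
    obtain ⟨g, hg⟩ := exists_retraction_of_mono hreg f
    have h3 : f ≫ (𝟙 Y - g ≫ f) = 0 := by simp [Preadditive.comp_sub, reassoc_of% hg]
    exact ⟨⟨Y, 𝟙 Y - g ≫ f, h3, KernelFork.IsLimit.ofι _ _ (fun h _ => h ≫ g)
      (fun h w => by
        rw [Preadditive.comp_sub, sub_eq_zero, Category.comp_id] at w
        rw [Category.assoc, ← w])
      (fun h w m hm => by rw [← hm, Category.assoc, hg, Category.comp_id])⟩⟩

omit [IsIdempotentComplete C] in
theorem isNormalEpiCategory_of_regular : IsNormalEpiCategory C where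
  normalEpiOfEpi {X Y} f _ := by
    obtain ⟨g, hg⟩ := exists_section_of_epi hreg f
    have h3 : (𝟙 X - f ≫ g) ≫ f = 0 := by simp [Preadditive.sub_comp, hg]
    exact ⟨⟨X, 𝟙 X - f ≫ g, h3, CokernelCofork.IsColimit.ofπ _ _ (fun h _ => g ≫ h)
      (fun h w => by
        rw [Preadditive.sub_comp, sub_eq_zero, Category.id_comp, Category.assoc] at w
        rw [← w])
      (fun h w m hm => by rw [← hm, reassoc_of% hg])⟩⟩

-- Every subobject is split, so it gives an idempotent of `X`; if this is `0` the subobject is zero,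
-- if it is `𝟙 X` the subobject is everything.
omit [IsIdempotentComplete C] in
theorem simple_of_idempotents_trivial {X : C} (hX : ¬ IsZero X)
    (h : ∀ e : X ⟶ X, e ≫ e = e → e = 0 ∨ e = 𝟙 X) : Simple X where
  mono_isIso_iff_nonzero {Y} f _ := by
    constructor
    · rintro hf rfl
      apply hX
      rw [IsZero.iff_id_eq_zero, ← IsIso.inv_hom_id (0 : Y ⟶ X), comp_zero]
    · intro hf
      obtain ⟨g, hg⟩ := exists_retraction_of_mono hreg f
      rcases h (g ≫ f) (by simp [reassoc_of% hg]) with h0 | h1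
      · exfalso
        apply hf
        rw [← Category.id_comp f, ← hg, Category.assoc, h0, comp_zero]
      · exact ⟨g, hg, h1⟩

variable (k : Type w) [Field k] [Linear k C] [∀ X Y : C, Module.Finite k (X ⟶ Y)]

-- `f ↦ s ≫ f ≫ j` embeds `End Z` into `End X`. The projector `r ≫ i` onto `Y` is not in the image,
-- because `i ≫ s = 0` and `Y` is nonzero. This is the descent for the inductions below.
omit hreg [IsIdempotentComplete C] in
theorem finrank_end_complement_lt {X Y Z : C} {i : Y ⟶ X} {r : X ⟶ Y} {j : Z ⟶ X} {s : X ⟶ Z}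
    (hY : ¬ IsZero Y) (h : i ≫ r = 𝟙 Y) (h1 : j ≫ s = 𝟙 Z) (h2 : i ≫ s = 0) :
    Module.finrank k (Z ⟶ Z) < Module.finrank k (X ⟶ X) := by
  let φ : (Z ⟶ Z) →ₗ[k] (X ⟶ X) := Linear.leftComp k X s ∘ₗ Linear.rightComp k Z j
  have hφ : ∀ f, φ f = s ≫ f ≫ j := fun f => rfl
  have hinj : Function.Injective φ := by
    intro f g hfg
    have := congrArg (fun t => j ≫ t ≫ s) hfg
    simpa [hφ, reassoc_of% h1, h1] using this
  rw [← LinearMap.finrank_range_of_inj hinj]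
  apply Submodule.finrank_lt
  intro htop
  obtain ⟨f, hf⟩ := LinearMap.range_eq_top.mp htop (r ≫ i)
  apply hY
  have := congrArg (fun t => i ≫ t ≫ r) hf
  simp only [hφ, Category.assoc, reassoc_of% h2, zero_comp, reassoc_of% h, h] at this
  rw [IsZero.iff_id_eq_zero, ← this]

include k

theorem exists_simple_retract {X : C} (hX : ¬ IsZero X) :
    ∃ (S : C) (i : S ⟶ X) (r : X ⟶ S), Simple S ∧ i ≫ r = 𝟙 S := by
  induction hn : Module.finrank k (X ⟶ X) using Nat.strong_induction_on generalizing X with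
  | _ n ih =>
    by_cases h : ∀ e : X ⟶ X, e ≫ e = e → e = 0 ∨ e = 𝟙 X
    · exact ⟨X, 𝟙 X, 𝟙 X, simple_of_idempotents_trivial hreg hX h, Category.comp_id _⟩
    · push Not at h
      obtain ⟨e, he, he0, he1⟩ := h
      obtain ⟨Y, i, r, h1, h2⟩ := IsIdempotentComplete.idempotents_split X e he
      obtain ⟨Z, j, s, h3, h4, h5, h6⟩ := exists_complement h1
      have hY : ¬ IsZero Y := by
        intro h
        apply he0
        rw [← h2, h.eq_zero_of_tgt r, zero_comp]
      have hZ : ¬ IsZero Z := by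
        intro h
        apply he1
        rw [h.eq_zero_of_tgt s, zero_comp, h2] at h4
        exact (sub_eq_zero.mp h4.symm).symm
      -- The roles are exchanged here: since `Z` is nonzero, it is `Y` that has the smaller
      -- endomorphism ring.
      have hlt := finrank_end_complement_lt k hZ h3 h1 h5
      obtain ⟨S, i', r', hS, hir⟩ := ih _ (hn ▸ hlt) hY rfl
      exact ⟨S, i' ≫ i, r ≫ r', hS, by simp [reassoc_of% h1, hir]⟩

/-- Each nonzero object loses one simple summand and leaves a complement with a smaller endomorphism
ring. Semi-simplicity and finite length both follow by this induction. -/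
theorem simple_induction {p : C → Prop} (hzero : ∀ X, IsZero X → p X)
    (hadd : ∀ {X S Z : C} (i : S ⟶ X) (r : X ⟶ S) (j : Z ⟶ X) (s : X ⟶ Z), Simple S → p Z →
      i ≫ r = 𝟙 S → j ≫ s = 𝟙 Z → j ≫ r = 0 → i ≫ s = 0 → r ≫ i + s ≫ j = 𝟙 X → p X) (X : C) :
    p X := by
  induction hn : Module.finrank k (X ⟶ X) using Nat.strong_induction_on generalizing X with
  | _ n ih =>
    by_cases hX : IsZero X
    · exact hzero X hX
    · obtain ⟨S, i, r, hS, h1⟩ := exists_simple_retract hreg k hX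
      obtain ⟨Z, j, s, h3, h4, h5, h6⟩ := exists_complement h1
      have hlt := finrank_end_complement_lt k (Simple.not_isZero S) h1 h3 h6
      exact hadd i r j s hS (ih _ (hn ▸ hlt) Z rfl) h1 h3 h5 h6 (by rw [h4]; abel)

theorem isSemisimple_of_regular : IsSemisimple C := by
  suffices H : ∀ X : C, ∃ (n : ℕ) (S : Fin n → C), (∀ i, Simple (S i)) ∧
      Nonempty (Decomposition X S) by
    intro X
    obtain ⟨n, S, hS, ⟨d⟩⟩ := H X
    obtain ⟨hb, e⟩ := d.exists_iso
    exact ⟨n, S, hb, hS, e⟩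
  intro X
  induction X using simple_induction hreg k with
  | hzero X hX =>
    exact ⟨0, Fin.elim0, fun i => i.elim0, ⟨⟨fun i => i.elim0, fun i => i.elim0, fun i => i.elim0,
      fun i => i.elim0, by simpa using ((IsZero.iff_id_eq_zero X).mp hX).symm⟩⟩⟩
  | @hadd X S Z i r j s hS ih h1 h2 h3 h4 h5 =>
    obtain ⟨n, T, hT, ⟨d⟩⟩ := ih
    refine ⟨n + 1, fun a => Fin.cases (motive := fun _ => C) S T a, fun a => ?_, ⟨⟨
      fun a => Fin.cases (motive := fun a => Fin.cases (motive := fun _ => C) S T a ⟶ X) i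
        (fun b => d.ι b ≫ j) a,
      fun a => Fin.cases (motive := fun a => X ⟶ Fin.cases (motive := fun _ => C) S T a) r
        (fun b => s ≫ d.π b) a,
      fun a => ?_, fun a b hab => ?_, ?_⟩⟩⟩
    · cases a using Fin.cases with
      | zero => exact hS
      | succ a => exact hT a
    · cases a using Fin.cases with
      | zero => exact h1
      | succ a =>
        show (d.ι a ≫ j) ≫ s ≫ d.π a = 𝟙 (T a)
        rw [Category.assoc, reassoc_of% h2, d.ι_π_self]
    · cases a using Fin.cases with
      | zero =>
        cases b using Fin.cases with
        | zero => exact absurd rfl hab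
        | succ b =>
          show i ≫ s ≫ d.π b = 0
          rw [reassoc_of% h4, zero_comp]
      | succ a =>
        cases b using Fin.cases with
        | zero =>
          show (d.ι a ≫ j) ≫ r = 0
          rw [Category.assoc, h3, comp_zero]
        | succ b =>
          show (d.ι a ≫ j) ≫ s ≫ d.π b = 0
          rw [Category.assoc, reassoc_of% h2, d.ι_π_ne]
          exact fun h => hab (congrArg Fin.succ h)
    · rw [Fin.sum_univ_succ]
      show r ≫ i + ∑ b, (s ≫ d.π b) ≫ d.ι b ≫ j = 𝟙 X
      rw [← h5]
      congr 1
      simp only [Category.assoc]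
      rw [← Preadditive.comp_sum]
      simp only [← Category.assoc (d.π _)]
      rw [← Preadditive.sum_comp, d.total, Category.id_comp]

theorem hasFiniteLength_of_regular [HasZeroObject C] (X : C) : HasFiniteLength X := by
  induction X using simple_induction hreg k with
  | hzero X hX => exact .zero hX
  | @hadd X S Z i r j s hS ih h1 h2 h3 h4 h5 =>
    let K : ShortComplex C := ShortComplex.mk j r h3
    have hK : K.Splitting :=
      { r := s
        s := i
        f_r := h2
        s_g := h1
        id := by
          show s ≫ j + r ≫ i = 𝟙 X
          rw [add_comm, h5] }
    exact .ext K hK.shortExact ih hS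

end RegularCategory

/-- The complement consists of the objects on which `σ` is zero. Naturality of `σ` kills the
morphisms between the two parts, and splitting the idempotent `σ.app X` decomposes `X`. -/
theorem isDirectSummand_fixed {C : Type u} [Category.{v} C] [Preadditive C]
    [IsIdempotentComplete C] (σ : IdEnd C) (hσ : ∀ X, σ.app X ≫ σ.app X = σ.app X) :
    IsDirectSummand σ.fixed := by
  refine ⟨fun X => σ.app X = 0, fun X Y hX hY => ⟨fun f => ?_, fun f => ?_⟩, fun X => ?_⟩
  · have h := σ.naturality f
    rw [show σ.app X = 𝟙 X from hX, show σ.app Y = 0 from hY] at h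
    simpa using h.symm
  · have h := σ.naturality f
    rw [show σ.app X = 𝟙 X from hX, show σ.app Y = 0 from hY] at h
    simpa using h
  · obtain ⟨Y, i, r, h1, h2⟩ := IsIdempotentComplete.idempotents_split X (σ.app X) (hσ X)
    obtain ⟨Z, j, s, h3, h4, h5, h6⟩ := exists_complement h1
    refine ⟨Y, Z, ?_, ?_, ?_⟩
    · show σ.app Y = 𝟙 Y
      rw [← Category.comp_id (σ.app Y), ← h1, ← reassoc_of% (σ.naturality i), ← h2]
      simp [h1]
    · show σ.app Z = 0
      rw [← Category.comp_id (σ.app Z), ← h3, ← reassoc_of% (σ.naturality j), ← h2]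
      simp [reassoc_of% h5]
    · let b : BinaryBicone Y Z :=
        { pt := X
          fst := r
          snd := s
          inl := i
          inr := j
          inl_fst := h1
          inl_snd := h6
          inr_fst := h5
          inr_snd := h3 }
      refine ⟨b, ⟨isBinaryBilimitOfTotal b ?_⟩, ⟨Iso.refl X⟩⟩
      show r ≫ i + s ≫ j = 𝟙 X
      rw [h4]
      abel

/-! ### The categorical trace form on endomorphism rings of `E`. -/

section Trace

variable {F : Type*} [Field F] {E : Type u} [Category.{v} E] [Preadditive E] [Linear F E]
  [MonoidalCategory E] [SymmetricCategory E] [MonoidalPreadditive E] [MonoidalLinear F E]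

/-- The categorical trace of the endomorphisms of a dualizable object. -/
def catTrace (F : Type*) [Field F] [Linear F E] [MonoidalLinear F E] (X : E) [HasRightDual X] :
    (X ⟶ X) →ₗ[F] (𝟙_ E ⟶ 𝟙_ E) where
  toFun f := η_ X Xᘁ ≫ f ▷ Xᘁ ≫ (β_ X Xᘁ).hom ≫ ε_ X Xᘁ
  map_add' f g := by
    simp only [MonoidalPreadditive.add_whiskerRight, Preadditive.add_comp, Preadditive.comp_add]
  map_smul' a f := by
    simp only [MonoidalLinear.smul_whiskerRight, Linear.smul_comp, Linear.comp_smul,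
      RingHom.id_apply]

theorem catTrace_apply (X : E) [HasRightDual X] (f : X ⟶ X) :
    catTrace F X f = η_ X Xᘁ ≫ f ▷ Xᘁ ≫ (β_ X Xᘁ).hom ≫ ε_ X Xᘁ := rfl

/-- `g` slides around the loop: through the braiding, over the evaluation to its mate on the dual,
back through the braiding, past `f`, and over the coevaluation onto `X` again. -/
theorem catTrace_comp_comm (X : E) [HasRightDual X] (f g : X ⟶ X) :
    catTrace F X (f ≫ g) = catTrace F X (g ≫ f) := by
  rw [catTrace_apply, catTrace_apply]
  simp only [comp_whiskerRight, Category.assoc]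
  rw [BraidedCategory.braiding_naturality_left_assoc, ← rightAdjointMate_comp_evaluation,
    ← BraidedCategory.braiding_naturality_right_assoc, ← whisker_exchange_assoc,
    reassoc_of% (coevaluation_comp_rightAdjointMate g)]

-- By the triangle identity `f` can be recovered from `η_ X Xᘁ ≫ f ▷ Xᘁ`.
omit [Linear F E] [SymmetricCategory E] [MonoidalLinear F E] in
theorem coevaluation_whiskerRight_ne_zero (X : E) [HasRightDual X] {f : X ⟶ X} (hf : f ≠ 0) :
    η_ X Xᘁ ≫ f ▷ Xᘁ ≠ 0 := by
  intro h
  apply hf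
  have e : f = (λ_ X).inv ≫ (η_ X Xᘁ ≫ f ▷ Xᘁ) ▷ X ≫ (α_ X Xᘁ X).hom ≫ X ◁ ε_ X Xᘁ ≫
      (ρ_ X).hom := by
    rw [comp_whiskerRight, Category.assoc, associator_naturality_left_assoc,
      ← whisker_exchange_assoc, rightUnitor_naturality]
    have := ExactPairing.evaluation_coevaluation X Xᘁ
    rw [reassoc_of% this]
    simp
  rw [e, h]
  simp

/-- The morphism `u = η_ X Xᘁ ≫ f ▷ Xᘁ` is nonzero and has a generalized inverse `h`. Under duality
`h` corresponds to an endomorphism `g` with trace of `f ≫ g` equal to `u ≫ h`; if this were zero, so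
would be `u = u ≫ h ≫ u`. -/
theorem catTrace_nondegenerate [HasKernels E] (hs : IsSemisimple E) (X : E) [HasRightDual X]
    {f : X ⟶ X} (hf : f ≠ 0) : ∃ g, catTrace F X (f ≫ g) ≠ 0 := by
  have h0 := coevaluation_whiskerRight_ne_zero X hf
  obtain ⟨h, hh⟩ := isRegularMor_of_isSemisimple hs (η_ X Xᘁ ≫ f ▷ Xᘁ)
  let G := tensorLeftHomEquiv X X Xᘁ (𝟙_ E) ((β_ X Xᘁ).inv ≫ h)
  have hG : Xᘁ ◁ (G ≫ (ρ_ X).hom) ≫ ε_ X Xᘁ = (β_ X Xᘁ).inv ≫ h := by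
    have := (tensorLeftHomEquiv X X Xᘁ (𝟙_ E)).symm_apply_apply ((β_ X Xᘁ).inv ≫ h)
    rw [← this]
    show _ = Xᘁ ◁ G ≫ (α_ _ _ _).inv ≫ ε_ X Xᘁ ▷ 𝟙_ E ≫ (λ_ _).hom
    rw [MonoidalCategory.whiskerLeft_comp, Category.assoc]
    congr 1
    rw [unitors_equal, rightUnitor_naturality, ← Category.assoc (α_ _ _ _).inv]
    congr 1
    simp
  refine ⟨G ≫ (ρ_ X).hom, fun ht => h0 ?_⟩
  rw [catTrace_apply, comp_whiskerRight, Category.assoc,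
    BraidedCategory.braiding_naturality_left_assoc, hG, Iso.hom_inv_id_assoc] at ht
  rw [← hh]
  simp only [Category.assoc] at ht ⊢
  rw [reassoc_of% ht, zero_comp]

theorem isSemisimpleRing_end_lin [Finite F] {k : Type w} [Field k] [CharZero k]
    (hE : IsPreTannakian F E) (hs : IsSemisimple E) (X : E) :
    IsSemisimpleRing (End (⟨X⟩ : Lin k E)) := by
  have := hE.hasKernels
  obtain ⟨Y, ⟨pairing⟩⟩ := hE.rigid X
  let _ : HasRightDual X := ⟨Y⟩
  have : Module.Finite F (End X) := hE.finite X X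
  have : Finite (End X) := Module.finite_of_finite F
  let unitEquiv : F ≃ₗ[F] (𝟙_ E ⟶ 𝟙_ E) :=
    LinearEquiv.ofBijective (LinearMap.toSpanSingleton F _ (𝟙 (𝟙_ E))) hE.unit
  let t : End X →ₗ[F] F := unitEquiv.symm.toLinearMap ∘ₗ catTrace F X
  have ht : ∀ a b, t (a * b) = t (b * a) := fun a b =>
    congrArg unitEquiv.symm (catTrace_comp_comm X b a)
  have hnd : ∀ a : End X, a ≠ 0 → ∃ b, t (a * b) ≠ 0 := by
    intro a ha
    obtain ⟨b, hb⟩ := catTrace_nondegenerate (F := F) hs X ha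
    refine ⟨b, fun h => hb ?_⟩
    -- The product of `End X` is composition in the reverse order, so cyclicity is needed to match
    -- the two.
    rw [ht] at h
    exact unitEquiv.symm.map_eq_zero_iff.mp h
  let b : Module.Basis (End X) k (End (⟨X⟩ : Lin k E)) :=
    Module.Basis.ofRepr (Lin.coeffs (⟨X⟩ : Lin k E) ⟨X⟩)
  refine isSemisimpleRing_of_basis t ht
    (fun a => isRegularMor_of_isSemisimple hs a) hnd b fun r s => ?_
  refine Eq.trans ?_ (Lin.single_comp (X := (⟨X⟩ : Lin k E)) (Y := ⟨X⟩) (Z := ⟨X⟩) s r 1 1).symm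
  rw [mul_one]
  rfl

end Trace

/-! ### Regularity in the additive and Karoubi envelopes. -/

section Envelope

variable {D : Type u} [Category.{v} D] [Preadditive D]

/-- The constant tuple. -/
abbrev constTuple (K : Type) [Fintype K] (Z : D) : Mat_ D := ⟨K, fun _ => Z⟩

/-- The matrix over `End Z` of an endomorphism of a constant tuple, transposed because the
multiplication of `End Z` is the opposite of the composition. -/
def constTupleMatrix {K : Type} [Fintype K] {Z : D} (f : constTuple K Z ⟶ constTuple K Z) :
    Matrix K K (End Z) :=
  fun i j => f j i

theorem constTupleMatrix_comp {K : Type} [Fintype K] {Z : D}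
    (f g : constTuple K Z ⟶ constTuple K Z) :
    constTupleMatrix (f ≫ g) = constTupleMatrix g * constTupleMatrix f := rfl

/-- A matrix ring over a semisimple ring is semisimple, hence von Neumann regular; regularity is
insensitive to passing to the opposite ring. -/
theorem isRegularMor_constTuple {K : Type} [Fintype K] {Z : D} [IsSemisimpleRing (End Z)]
    (f : constTuple K Z ⟶ constTuple K Z) : IsRegularMor f := by
  classical
  obtain ⟨B, hB⟩ := IsSemisimpleRing.exists_mul_mul_eq (constTupleMatrix f)
  let g : constTuple K Z ⟶ constTuple K Z := fun i j => B j i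
  have h : constTupleMatrix (f ≫ g ≫ f) = constTupleMatrix f := by
    rw [constTupleMatrix_comp, constTupleMatrix_comp]
    exact hB
  exact ⟨g, Mat_.hom_ext _ _ fun i j => congrFun (congrFun h j) i⟩

theorem exists_retract_of_injective {M N : Mat_ D} {e : M.ι → N.ι} (he : Function.Injective e)
    (a : ∀ i, M.X i ⟶ N.X (e i)) (b : ∀ i, N.X (e i) ⟶ M.X i)
    (hab : ∀ i, a i ≫ b i = 𝟙 (M.X i)) : ∃ (i : M ⟶ N) (r : N ⟶ M), i ≫ r = 𝟙 M := by
  classical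
  let r : N ⟶ M := fun j i =>
    if h : e i = j then eqToHom (congrArg N.X h.symm) ≫ b i else 0
  have hr : ∀ i j, r (e i) j = if h : e j = e i then eqToHom (congrArg N.X h.symm) ≫ b j else 0 :=
    fun _ _ => rfl
  refine ⟨AddEnv.perm e a, r, ?_⟩
  apply Mat_.hom_ext
  intro i j
  rw [AddEnv.perm_comp_apply, hr]
  by_cases h : i = j
  · subst h
    simp [hab]
  · rw [dif_neg fun h' => h (he h').symm, comp_zero, Mat_.id_apply_of_ne _ _ _ h]

theorem isRegularMor_karoubi {C : Type u} [Category.{v} C]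
    (hreg : ∀ {X Y : C} (f : X ⟶ Y), IsRegularMor f) {P Q : Karoubi C} (f : P ⟶ Q) :
    IsRegularMor f := by
  obtain ⟨g, hg⟩ := hreg f.f
  refine ⟨⟨Q.p ≫ g ≫ P.p, by simp⟩, ?_⟩
  apply Karoubi.hom_ext
  simp [hg]

/-- Let `Z` be the direct sum in `E` of all entries of both tuples. Although `[Z]` is not the direct
sum of the entries in `k[E]`, each entry is a retract of `[Z]`. So both tuples are retracts of one
constant tuple, and `f` is a corner of an endomorphism of it. -/
theorem isRegularMor_mat_lin {F : Type*} [Field F] [Finite F] {E : Type u} [Category.{v} E]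
    [Preadditive E] [Linear F E] [MonoidalCategory E] [SymmetricCategory E] [MonoidalPreadditive E]
    [MonoidalLinear F E] {k : Type w} [Field k] [CharZero k] (hE : IsPreTannakian F E)
    (hs : IsSemisimple E) {M N : Mat_ (Lin k E)} (f : M ⟶ N) : IsRegularMor f := by
  have := hE.hasFiniteProducts
  have := HasFiniteBiproducts.of_hasFiniteProducts (C := E)
  let X : M.ι ⊕ N.ι → E := Sum.elim (fun i => (M.X i).as) fun j => (N.X j).as
  let Z : Lin k E := ⟨⨁ X⟩
  have : IsSemisimpleRing (End Z) := isSemisimpleRing_end_lin (k := k) hE hs (⨁ X)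
  obtain ⟨i, r, hir⟩ := exists_retract_of_injective (M := M) (N := constTuple (M.ι ⊕ N.ι) Z)
    (e := Sum.inl) Sum.inl_injective
    (fun i => Lin.single (X := M.X i) (Y := Z) (biproduct.ι X (Sum.inl i)) 1)
    (fun i => Lin.single (X := Z) (Y := M.X i) (biproduct.π X (Sum.inl i)) 1)
    (fun i => (Lin.single_comp (X := M.X i) (Y := Z) (Z := M.X i) _ _ _ _).trans
      ((congrArg₂ (Lin.single (X := M.X i) (Y := M.X i)) (biproduct.ι_π_self X (Sum.inl i))
        (mul_one 1)).trans (Lin.single_id _)))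
  obtain ⟨j, s, hjs⟩ := exists_retract_of_injective (M := N) (N := constTuple (M.ι ⊕ N.ι) Z)
    (e := Sum.inr) Sum.inr_injective
    (fun i => Lin.single (X := N.X i) (Y := Z) (biproduct.ι X (Sum.inr i)) 1)
    (fun i => Lin.single (X := Z) (Y := N.X i) (biproduct.π X (Sum.inr i)) 1)
    (fun i => (Lin.single_comp (X := N.X i) (Y := Z) (Z := N.X i) _ _ _ _).trans
      ((congrArg₂ (Lin.single (X := N.X i) (Y := N.X i)) (biproduct.ι_π_self X (Sum.inr i))
        (mul_one 1)).trans (Lin.single_id _)))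
  exact .of_retract hir hjs (isRegularMor_constTuple _)

end Envelope

/-! ### Duals in the linearization, for tuples, images of idempotents and the summand. -/

section Rigid

/-- The exact pairing of `[X]` and `[Y]` induced by one of `X` and `Y`. -/
@[reducible]
noncomputable def Lin.exactPairing {k : Type w} [CommRing k] {E : Type u} [Category.{v} E]
    [MonoidalCategory E] (X Y : E) [ExactPairing X Y] : ExactPairing (⟨X⟩ : Lin k E) ⟨Y⟩ where
  coevaluation' := Lin.single (X := 𝟙_ (Lin k E)) (Y := (⟨X⟩ : Lin k E) ⊗ ⟨Y⟩) (η_ X Y) 1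
  evaluation' := Lin.single (X := (⟨Y⟩ : Lin k E) ⊗ ⟨X⟩) (Y := 𝟙_ (Lin k E)) (ε_ X Y) 1
  coevaluation_evaluation' := by
    simp only [Lin.whiskerLeft_single, Lin.single_whiskerRight, Lin.associator_inv,
      Lin.single_comp, mul_one]
    refine (congrArg (fun t => Lin.single t (1 : k))
      (ExactPairing.coevaluation_evaluation X Y)).trans
      ?_
    refine Eq.trans ?_ (Lin.single_comp (X := (⟨Y⟩ : Lin k E) ⊗ 𝟙_ _) (Y := ⟨Y⟩) (Z := 𝟙_ _ ⊗ ⟨Y⟩)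
      (ρ_ Y).hom (λ_ Y).inv 1 1).symm
    rw [mul_one]
  evaluation_coevaluation' := by
    simp only [Lin.whiskerLeft_single, Lin.single_whiskerRight, Lin.associator_hom,
      Lin.single_comp, mul_one]
    refine (congrArg (fun t => Lin.single t (1 : k))
      (ExactPairing.evaluation_coevaluation X Y)).trans
      ?_
    refine Eq.trans ?_ (Lin.single_comp (X := 𝟙_ _ ⊗ (⟨X⟩ : Lin k E)) (Y := ⟨X⟩) (Z := ⟨X⟩ ⊗ 𝟙_ _)
      (λ_ X).hom (ρ_ X).inv 1 1).symm
    rw [mul_one]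

namespace AddEnv

variable {D : Type u} [Category.{v} D] [Preadditive D] [MonoidalCategory D]
  (M N : Mat_ D) (e : M.ι ≃ N.ι) [∀ i, ExactPairing (M.X i) (N.X (e i))]

open scoped Classical in
/-- The coevaluation of tuples whose entries are paired along a bijection of the index sets. -/
noncomputable def coev : 𝟙_ (Mat_ D) ⟶ M ⊗ N := fun _ p =>
  if h : e p.1 = p.2 then η_ (M.X p.1) (N.X (e p.1)) ≫ M.X p.1 ◁ eqToHom (congrArg N.X h) else 0

open scoped Classical in
/-- The evaluation of tuples whose entries are paired along a bijection of the index sets. -/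
noncomputable def ev : N ⊗ M ⟶ 𝟙_ (Mat_ D) := fun p _ =>
  if h : p.1 = e p.2 then eqToHom (congrArg N.X h) ▷ M.X p.2 ≫ ε_ (M.X p.2) (N.X (e p.2)) else 0

theorem coev_apply_self (u : (𝟙_ (Mat_ D)).ι) (i : M.ι) :
    coev M N e u (i, e i) = η_ (M.X i) (N.X (e i)) := by
  simp [coev]

theorem coev_apply_ne (u : (𝟙_ (Mat_ D)).ι) (i : M.ι) (j : N.ι) (h : e i ≠ j) :
    coev M N e u (i, j) = 0 :=
  dif_neg h

theorem ev_apply_self (u : (𝟙_ (Mat_ D)).ι) (i : M.ι) :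
    ev M N e (e i, i) u = ε_ (M.X i) (N.X (e i)) := by
  refine (dif_pos rfl).trans ?_
  rw [eqToHom_refl, id_whiskerRight]
  exact Category.id_comp _

theorem ev_apply_ne (u : (𝟙_ (Mat_ D)).ι) (i : M.ι) (j : N.ι) (h : e i ≠ j) :
    ev M N e (j, i) u = 0 :=
  dif_neg h.symm

variable [MonoidalPreadditive D]

/-- In the matrix product only the intermediate index `((i, e i), i)` can contribute, and only if `l
= i`. That entry is the triangle identity for the pair `M.X i`, `N.X (e i)`. -/
theorem coev_whiskerRight_comp (u : (𝟙_ (Mat_ D)).ι) (i l : M.ι) (u' : (𝟙_ (Mat_ D)).ι) :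
    (coev M N e ▷ M ≫ (α_ M N M).hom ≫ M ◁ ev M N e) (u, i) (l, u') =
      ((λ_ M).hom ≫ (ρ_ M).inv) (u, i) (l, u') := by
  have hR : (λ_ M).hom ≫ (ρ_ M).inv = perm (M := 𝟙_ _ ⊗ M) (N := M ⊗ 𝟙_ _)
      (fun p => (p.2, PUnit.unit))
      (fun p => (λ_ (M.X p.2)).hom ≫ (ρ_ (M.X p.2)).inv) := perm_comp_perm _ _ _ _
  rw [hR, Mat_.comp_apply, associator_hom]
  have hterm : ∀ a b c, ¬ (a = i ∧ b = e i ∧ c = i ∧ l = i) →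
      (coev M N e ▷ M) (u, i) ((a, b), c) ≫ (perm (M := (M ⊗ N) ⊗ M) (N := M ⊗ (N ⊗ M))
        (fun p => (p.1.1, (p.1.2, p.2))) (fun p => (α_ (M.X p.1.1) (N.X p.1.2) (M.X p.2)).hom) ≫
          M ◁ ev M N e) ((a, b), c) (l, u') = 0 := by
    intro a b c h
    rw [perm_comp_apply, whiskerRight_apply, whiskerLeft_apply]
    by_cases h1 : e a = b
    · by_cases h2 : i = c
      · by_cases h3 : a = l
        · have h4 : e c ≠ b := by
            rintro rfl
            have := e.injective h1
            subst h2 this h3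
            exact h ⟨rfl, rfl, rfl, rfl⟩
          rw [ev_apply_ne M N e u' c b h4, MonoidalPreadditive.tensor_zero, comp_zero, comp_zero]
        · rw [Mat_.id_apply_of_ne M _ _ h3, MonoidalPreadditive.zero_tensor, comp_zero, comp_zero]
      · rw [Mat_.id_apply_of_ne M _ _ h2, MonoidalPreadditive.tensor_zero, zero_comp]
    · rw [coev_apply_ne M N e u a b h1, MonoidalPreadditive.zero_tensor, zero_comp]
  by_cases hl : l = i
  · subst hl
    refine (Finset.sum_eq_single (((l, e l), l) : (M.ι × N.ι) × M.ι) ?_ ?_).trans ?_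
    · rintro ⟨⟨a, b⟩, c⟩ _ h
      exact hterm a b c (by rintro ⟨rfl, rfl, rfl, _⟩; exact h rfl)
    · exact fun h => absurd (Finset.mem_univ _) h
    · refine (congrArg₂ (· ≫ ·) (?_ : _ = η_ (M.X l) (N.X (e l)) ▷ M.X l)
        ((perm_comp_apply _ _ _ _ _).trans (congrArg (_ ≫ ·)
          (?_ : _ = M.X l ◁ ε_ (M.X l) (N.X (e l)))))).trans
        ((ExactPairing.evaluation_coevaluation (M.X l) (N.X (e l))).trans
          (perm_apply (M := 𝟙_ _ ⊗ M) (N := M ⊗ 𝟙_ _) (fun p => (p.2, PUnit.unit))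
            (fun p => (λ_ (M.X p.2)).hom ≫ (ρ_ (M.X p.2)).inv) (u, l)).symm)
      · rw [whiskerRight_apply, coev_apply_self M N e u l, Mat_.id_apply_self]
        exact MonoidalCategory.tensorHom_id _ _
      · rw [whiskerLeft_apply, ev_apply_self M N e u' l, Mat_.id_apply_self]
        exact MonoidalCategory.id_tensorHom _ _
  · rw [perm_apply_ne (M := 𝟙_ _ ⊗ M) (N := M ⊗ 𝟙_ _) _ _ _ _
      (fun h => hl (congrArg Prod.fst h).symm)]
    exact Finset.sum_eq_zero fun p _ => hterm p.1.1 p.1.2 p.2 (fun h => hl h.2.2.2)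

theorem whiskerLeft_coev_comp (u : (𝟙_ (Mat_ D)).ι) (i l : N.ι) (u' : (𝟙_ (Mat_ D)).ι) :
    (N ◁ coev M N e ≫ (α_ N M N).inv ≫ ev M N e ▷ N) (i, u) (u', l) =
      ((ρ_ N).hom ≫ (λ_ N).inv) (i, u) (u', l) := by
  obtain ⟨i, rfl⟩ := e.surjective i
  have hR : (ρ_ N).hom ≫ (λ_ N).inv = perm (M := N ⊗ 𝟙_ _) (N := 𝟙_ _ ⊗ N)
      (fun p => (PUnit.unit, p.1))
      (fun p => (ρ_ (N.X p.1)).hom ≫ (λ_ (N.X p.1)).inv) := perm_comp_perm _ _ _ _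
  rw [hR, Mat_.comp_apply, associator_inv]
  have hterm : ∀ a b c, ¬ (a = e i ∧ b = i ∧ c = e i ∧ l = e i) →
      (N ◁ coev M N e) (e i, u) (a, (b, c)) ≫ (perm (M := N ⊗ (M ⊗ N)) (N := (N ⊗ M) ⊗ N)
        (fun p => ((p.1, p.2.1), p.2.2)) (fun p => (α_ (N.X p.1) (M.X p.2.1) (N.X p.2.2)).inv) ≫
          ev M N e ▷ N) (a, (b, c)) (u', l) = 0 := by
    intro a b c h
    rw [perm_comp_apply, whiskerRight_apply, whiskerLeft_apply]
    by_cases h1 : e b = c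
    · by_cases h2 : e i = a
      · by_cases h3 : c = l
        · have h4 : e b ≠ a := by
            intro h4
            have h5 : b = i := e.injective (h4.trans h2.symm)
            subst h2 h1 h3 h5
            exact h ⟨rfl, rfl, rfl, rfl⟩
          rw [ev_apply_ne M N e u' b a h4, MonoidalPreadditive.zero_tensor, comp_zero, comp_zero]
        · rw [Mat_.id_apply_of_ne N _ _ h3, MonoidalPreadditive.tensor_zero, comp_zero, comp_zero]
      · rw [Mat_.id_apply_of_ne N _ _ h2, MonoidalPreadditive.zero_tensor, zero_comp]
    · rw [coev_apply_ne M N e u b c h1, MonoidalPreadditive.tensor_zero, zero_comp]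
  by_cases hl : l = e i
  · subst hl
    refine (Finset.sum_eq_single ((e i, (i, e i)) : N.ι × (M.ι × N.ι)) ?_ ?_).trans ?_
    · rintro ⟨a, b, c⟩ _ h
      exact hterm a b c (by rintro ⟨rfl, rfl, rfl, _⟩; exact h rfl)
    · exact fun h => absurd (Finset.mem_univ _) h
    · refine (congrArg₂ (· ≫ ·) (?_ : _ = N.X (e i) ◁ η_ (M.X i) (N.X (e i)))
        ((perm_comp_apply _ _ _ _ _).trans (congrArg (_ ≫ ·)
          (?_ : _ = ε_ (M.X i) (N.X (e i)) ▷ N.X (e i))))).trans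
        ((ExactPairing.coevaluation_evaluation (M.X i) (N.X (e i))).trans
          (perm_apply (M := N ⊗ 𝟙_ _) (N := 𝟙_ _ ⊗ N) (fun p => (PUnit.unit, p.1))
            (fun p => (ρ_ (N.X p.1)).hom ≫ (λ_ (N.X p.1)).inv) (e i, u)).symm)
      · rw [whiskerLeft_apply, coev_apply_self M N e u i, Mat_.id_apply_self]
        exact MonoidalCategory.id_tensorHom _ _
      · rw [whiskerRight_apply, ev_apply_self M N e u' i, Mat_.id_apply_self]
        exact MonoidalCategory.tensorHom_id _ _
  · rw [perm_apply_ne (M := N ⊗ 𝟙_ _) (N := 𝟙_ _ ⊗ N) _ _ _ _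
      (fun h => hl (congrArg Prod.snd h).symm)]
    exact Finset.sum_eq_zero fun p _ => hterm p.1 p.2.1 p.2.2 (fun h => hl h.2.2.2)

/-- The exact pairing of tuples whose entries are paired along a bijection of the index sets. -/
@[reducible]
noncomputable def exactPairing : ExactPairing M N where
  coevaluation' := coev M N e
  evaluation' := ev M N e
  evaluation_coevaluation' := Mat_.hom_ext _ _ fun _ _ => coev_whiskerRight_comp M N e _ _ _ _
  coevaluation_evaluation' := Mat_.hom_ext _ _ fun _ _ => whiskerLeft_coev_comp M N e _ _ _ _

end AddEnv

namespace Kar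

section Mate

variable {C : Type u} [Category.{v} C] [MonoidalCategory C] {X : C} [HasRightDual X] {p : X ⟶ X}
  (hp : p ≫ p = p)

include hp

theorem mate_idem : pᘁ ≫ pᘁ = pᘁ := by
  rw [← comp_rightAdjointMate, hp]

theorem coevaluation_comp_idem :
    (η_ X Xᘁ ≫ p ▷ Xᘁ) ≫ (p ⊗ₘ pᘁ) = η_ X Xᘁ ≫ p ▷ Xᘁ := by
  rw [MonoidalCategory.tensorHom_def, Category.assoc, ← comp_whiskerRight_assoc, hp,
    ← whisker_exchange, reassoc_of% (coevaluation_comp_rightAdjointMate p), ← comp_whiskerRight, hp]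

theorem idem_comp_evaluation :
    (pᘁ ⊗ₘ p) ≫ Xᘁ ◁ p ≫ ε_ X Xᘁ = Xᘁ ◁ p ≫ ε_ X Xᘁ := by
  rw [MonoidalCategory.tensorHom_def, Category.assoc, ← whiskerLeft_comp_assoc, hp,
    ← whisker_exchange_assoc, rightAdjointMate_comp_evaluation, ← whiskerLeft_comp_assoc, hp]

/-- This is the triangle identity for the image of `p`, with the Karoubi tensor product and
constraints unfolded. All copies of `p` and of its mate slide together and merge by `p ≫ p = p`,
leaving the triangle identity of `X` between two copies of `p`. -/
theorem idem_evaluation_coevaluation :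
    ((η_ X Xᘁ ≫ p ▷ Xᘁ) ⊗ₘ p) ≫ (((p ⊗ₘ pᘁ) ⊗ₘ p) ≫ (α_ X Xᘁ X).hom) ≫
      (p ⊗ₘ (Xᘁ ◁ p ≫ ε_ X Xᘁ)) = ((𝟙 _ ⊗ₘ p) ≫ (λ_ X).hom) ≫ p ≫ (ρ_ X).inv := by
  have h := ExactPairing.evaluation_coevaluation X Xᘁ
  calc _ = ((η_ X Xᘁ ≫ p ▷ Xᘁ) ⊗ₘ p) ≫ (α_ X Xᘁ X).hom ≫ (p ⊗ₘ (Xᘁ ◁ p ≫ ε_ X Xᘁ)) := by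
        rw [Category.assoc, MonoidalCategory.tensorHom_comp_tensorHom_assoc,
          coevaluation_comp_idem hp, hp]
    _ = 𝟙_ C ◁ p ≫ (η_ X Xᘁ ▷ X ≫ (α_ X Xᘁ X).hom ≫ X ◁ ε_ X Xᘁ) ≫ p ▷ 𝟙_ C := by
        rw [MonoidalCategory.tensorHom_def', MonoidalCategory.tensorHom_def', comp_whiskerRight,
          MonoidalCategory.whiskerLeft_comp]
        simp only [Category.assoc]
        rw [associator_naturality_left_assoc, ← whisker_exchange_assoc, ← whisker_exchange_assoc,
          ← comp_whiskerRight, hp, ← associator_naturality_right_assoc, ← whisker_exchange_assoc,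
          ← whiskerLeft_comp_assoc, hp]
    _ = _ := by
        rw [h]
        simp

theorem idem_coevaluation_evaluation :
    (pᘁ ⊗ₘ (η_ X Xᘁ ≫ p ▷ Xᘁ)) ≫ ((pᘁ ⊗ₘ (p ⊗ₘ pᘁ)) ≫ (α_ Xᘁ X Xᘁ).inv) ≫
      ((Xᘁ ◁ p ≫ ε_ X Xᘁ) ⊗ₘ pᘁ) = ((pᘁ ⊗ₘ 𝟙 _) ≫ (ρ_ Xᘁ).hom) ≫ pᘁ ≫ (λ_ Xᘁ).inv := by
  have h := ExactPairing.coevaluation_evaluation X Xᘁ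
  have hq := mate_idem hp
  calc _ = (pᘁ ⊗ₘ (η_ X Xᘁ ≫ X ◁ pᘁ)) ≫ (α_ Xᘁ X Xᘁ).inv ≫ ((pᘁ ▷ X ≫ ε_ X Xᘁ) ⊗ₘ pᘁ) := by
        rw [Category.assoc, MonoidalCategory.tensorHom_comp_tensorHom_assoc,
          coevaluation_comp_idem hp, hq, coevaluation_comp_rightAdjointMate,
          rightAdjointMate_comp_evaluation]
    _ = pᘁ ▷ 𝟙_ C ≫ (Xᘁ ◁ η_ X Xᘁ ≫ (α_ Xᘁ X Xᘁ).inv ≫ ε_ X Xᘁ ▷ Xᘁ) ≫ 𝟙_ C ◁ pᘁ := by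
        rw [MonoidalCategory.tensorHom_def, MonoidalCategory.tensorHom_def, comp_whiskerRight,
          MonoidalCategory.whiskerLeft_comp]
        simp only [Category.assoc]
        rw [associator_inv_naturality_right_assoc, whisker_exchange_assoc, whisker_exchange_assoc,
          ← MonoidalCategory.whiskerLeft_comp, hq, ← associator_inv_naturality_left_assoc,
          whisker_exchange_assoc, ← comp_whiskerRight_assoc, hq]
    _ = _ := by
        rw [h]
        simp

end Mate

variable {C : Type u} [Category.{v} C] [MonoidalCategory C] (P : Karoubi C) [HasRightDual P.X]

/-- The image of the transposed idempotent on the dual. -/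
noncomputable def dual : Karoubi C := ⟨P.Xᘁ, P.pᘁ, mate_idem P.idem⟩

/-- The exact pairing of the image of an idempotent and the image of the transposed idempotent. -/
@[reducible]
noncomputable def exactPairing : ExactPairing P (dual P) where
  coevaluation' := ⟨η_ P.X P.Xᘁ ≫ P.p ▷ P.Xᘁ,
    (Category.id_comp _).trans (coevaluation_comp_idem P.idem)⟩
  evaluation' := ⟨P.Xᘁ ◁ P.p ≫ ε_ P.X P.Xᘁ,
    (congrArg (_ ≫ ·) (Category.comp_id _)).trans (idem_comp_evaluation P.idem)⟩
  evaluation_coevaluation' := Karoubi.hom_ext _ _ (idem_evaluation_coevaluation P.idem)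
  coevaluation_evaluation' := Karoubi.hom_ext _ _ (idem_coevaluation_evaluation P.idem)

end Kar

/-- By the triangle identity `Q` is a retract of `Q ⊗ (P ⊗ Q)`, on which `τ` acts as the identity
because `P` is a factor; so `Q` lies in the summand. The unit of the summand is only a retract of
the ambient one, so coevaluation and evaluation are composed with `ι τ` and `π τ`. -/
theorem Summand.exists_exactPairing {C : Type u} [Category.{v} C] [MonoidalCategory C] {τ : IdEnd C}
    [τ.IsTensorIdempotent] (P : Summand τ) (Q : Karoubi C) [ExactPairing P.obj Q] :
    ∃ Q' : Summand τ, Nonempty (ExactPairing P Q') := by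
  have hQ : (Kar.idEnd τ).fixed Q := by
    show _ = _
    have h1 : Q ◁ η_ P.obj Q ≫ (α_ _ _ _).inv ≫ ε_ P.obj Q ▷ Q = (ρ_ Q).hom ≫ (λ_ Q).inv :=
      ExactPairing.coevaluation_evaluation _ _
    have h2 : (Kar.idEnd τ).app (Q ⊗ (P.obj ⊗ Q)) = 𝟙 _ := by
      rw [IdEnd.IsTensorIdempotent.app_tensor_right, fixed_tensor τ P.property Q]
      simp
    have h3 : 𝟙 Q =
        ((ρ_ Q).inv ≫ Q ◁ η_ P.obj Q) ≫ (α_ _ _ _).inv ≫ ε_ P.obj Q ▷ Q ≫ (λ_ Q).hom := by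
      rw [Category.assoc, reassoc_of% h1]
      simp
    have h4 := (Kar.idEnd τ).naturality ((ρ_ Q).inv ≫ Q ◁ η_ P.obj Q)
    rw [← Category.comp_id ((Kar.idEnd τ).app Q), h3, ← Category.assoc, ← h4, h2, Category.comp_id]
  refine ⟨⟨Q, hQ⟩, ⟨?_⟩⟩
  exact
    { coevaluation' := ObjectProperty.homMk (ι τ ≫ η_ P.obj Q)
      evaluation' := ObjectProperty.homMk (ε_ P.obj Q ≫ π τ)
      coevaluation_evaluation' := ObjectProperty.hom_ext _ (by
        show Q ◁ (ι τ ≫ η_ P.obj Q) ≫ (α_ _ _ _).inv ≫ (ε_ P.obj Q ≫ π τ) ▷ Q =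
          (Q ◁ ι τ ≫ (ρ_ Q).hom) ≫ (λ_ Q).inv ≫ π τ ▷ Q
        rw [MonoidalCategory.whiskerLeft_comp, comp_whiskerRight, Category.assoc]
        have := ExactPairing.coevaluation_evaluation P.obj Q
        rw [reassoc_of% this, Category.assoc])
      evaluation_coevaluation' := ObjectProperty.hom_ext _ (by
        show (ι τ ≫ η_ P.obj Q) ▷ P.obj ≫ (α_ _ _ _).hom ≫ P.obj ◁ (ε_ P.obj Q ≫ π τ) =
          (ι τ ▷ P.obj ≫ (λ_ P.obj).hom) ≫ (ρ_ P.obj).inv ≫ P.obj ◁ π τ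
        rw [MonoidalCategory.whiskerLeft_comp, comp_whiskerRight, Category.assoc]
        have := ExactPairing.evaluation_coevaluation P.obj Q
        rw [reassoc_of% this, Category.assoc]) }

end Rigid

/-! ### Closure properties of the objects fixed by an endomorphism of the identity functor. -/

section FixedObjects

variable {C : Type u} [Category.{v} C]

theorem IdEnd.fixed_of_retract (σ : IdEnd C) {X Y : C} (hX : σ.fixed X) {i : Y ⟶ X} {r : X ⟶ Y}
    (h : i ≫ r = 𝟙 Y) : σ.fixed Y := by
  show σ.app Y = 𝟙 Y
  rw [← Category.comp_id (σ.app Y), ← h, ← reassoc_of% (σ.naturality i),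
    show σ.app X = 𝟙 X from hX, Category.id_comp]

/-- The projections of a limit are jointly monic, and `σ` commutes with them. In particular the
summand has finite products. -/
instance (σ : IdEnd C) (J : Type*) [Category* J] : σ.fixed.IsClosedUnderLimitsOfShape J where
  limitsOfShape_le X := by
    rintro ⟨h⟩
    refine h.isLimit.hom_ext fun j => ?_
    have hj : σ.app (h.diag.obj j) = 𝟙 _ := h.prop_diag_obj j
    have := σ.naturality (h.π.app j)
    rw [hj, Category.comp_id] at this
    exact this.symm.trans (Category.id_comp _).symm

instance [HasFiniteProducts C] (σ : IdEnd C) : HasFiniteProducts σ.fixed.FullSubcategory :=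
  ⟨fun _ => inferInstance⟩

instance [IsIdempotentComplete C] (σ : IdEnd C) :
    IsIdempotentComplete σ.fixed.FullSubcategory where
  idempotents_split X p hp := by
    obtain ⟨Y, i, r, h1, h2⟩ := IsIdempotentComplete.idempotents_split X.obj p.hom
      (congrArg (fun f => f.hom) hp)
    exact ⟨⟨Y, σ.fixed_of_retract X.property h1⟩, ObjectProperty.homMk i, ObjectProperty.homMk r,
      ObjectProperty.hom_ext _ h1, ObjectProperty.hom_ext _ h2⟩

theorem isRegularMor_fullSubcategory (P : ObjectProperty C) {X Y : P.FullSubcategory} {f : X ⟶ Y}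
    (h : IsRegularMor f.hom) : IsRegularMor f := by
  obtain ⟨g, hg⟩ := h
  exact ⟨ObjectProperty.homMk g, ObjectProperty.hom_ext _ hg⟩

end FixedObjects

/-! ### The ideal of `k[F]` generated by `e_χ`. -/

section CharIdem

open MonoidAlgebra

variable {k : Type*} [Field k] {F : Type*} [Field F] [Finite F] (χ : Fˣ →* kˣ)

theorem charIdem_eq_sum [Fintype Fˣ] [Decidable (χ = 1)] : charIdem χ =
    -(if χ = 1 then single (0 : F) (1 : k) else 0) +
      ((Nat.card F : k) - 1)⁻¹ • ∑ a : Fˣ, single (a : F) (((χ a)⁻¹ : kˣ) : k) := by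
  rw [charIdem, finsum_eq_sum_of_fintype]
  congr

theorem card_units_cast [Fintype Fˣ] : ((Fintype.card Fˣ : ℕ) : k) = (Nat.card F : k) - 1 := by
  rw [← Nat.card_eq_fintype_card, Nat.card_units, Nat.cast_sub Nat.card_pos, Nat.cast_one]

theorem card_sub_one_ne_zero [CharZero k] : (Nat.card F : k) - 1 ≠ 0 := by
  have := Fintype.ofFinite Fˣ
  rw [← card_units_cast]
  exact Nat.cast_ne_zero.mpr Fintype.card_ne_zero

/-- `[a]` permutes the units, and reindexing the sum produces `χ a`. It fixes `[0]`, whose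
coefficient is nonzero only for trivial `χ`, where `χ a = 1`. -/
theorem single_unit_mul_charIdem (a : Fˣ) (r : k) :
    single (a : F) r * charIdem χ = (r * χ a) • charIdem χ := by
  classical
  have := Fintype.ofFinite Fˣ
  have hS : single (a : F) r * ∑ b : Fˣ, single (b : F) (((χ b)⁻¹ : kˣ) : k) =
      (r * χ a) • ∑ b : Fˣ, single (b : F) (((χ b)⁻¹ : kˣ) : k) := by
    rw [Finset.mul_sum, Finset.smul_sum]
    refine Fintype.sum_equiv (Equiv.mulLeft a) _ _ fun b => ?_
    rw [single_mul_single, smul_single, Equiv.coe_mulLeft, Units.val_mul, map_mul, mul_inv,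
      Units.val_mul, smul_eq_mul, ← mul_assoc, mul_assoc r, Units.mul_inv, mul_one]
  rw [charIdem_eq_sum, mul_add, smul_add, mul_neg, smul_neg, mul_smul_comm, hS,
    smul_comm (r * (χ a : k))]
  congr 2
  split_ifs with h
  · simp [single_mul_single, h]
  · simp

/-- `[0]` times the sum over the units is `∑ χ(a)⁻¹` times `[0]`. For nontrivial `χ` this vanishes
by orthogonality; for trivial `χ` it is `(q - 1) [0]`, which the correction `-[0]` in `e_χ` cancels.
-/
theorem single_zero_mul_charIdem [CharZero k] (r : k) : single (0 : F) r * charIdem χ = 0 := by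
  classical
  have := Fintype.ofFinite Fˣ
  have hS : single (0 : F) r * ∑ a : Fˣ, single (a : F) (((χ a)⁻¹ : kˣ) : k) =
      (∑ a : Fˣ, (((χ a)⁻¹ : kˣ) : k)) • single (0 : F) r := by
    rw [Finset.mul_sum, Finset.sum_smul]
    refine Finset.sum_congr rfl fun a _ => ?_
    rw [single_mul_single, smul_single, zero_mul, smul_eq_mul, mul_comm]
  rw [charIdem_eq_sum, mul_add, mul_neg, mul_smul_comm, hS]
  by_cases h : χ = 1
  · subst h
    simp [single_mul_single, card_units_cast, smul_smul, card_sub_one_ne_zero, -smul_single]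
  · have hs : ∑ a : Fˣ, (((χ a)⁻¹ : kˣ) : k) = 0 :=
      sum_hom_units_eq_zero ((Units.coeHom k).comp χ⁻¹) fun h' => h <| MonoidHom.ext fun a =>
        inv_eq_one.mp (Units.ext (DFunLike.congr_fun h' a))
    rw [if_neg h, hs, mul_zero, neg_zero, zero_smul, smul_zero, add_zero]

theorem exists_mul_charIdem [CharZero k] (x : MonoidAlgebra k F) :
    ∃ c : k, x * charIdem χ = c • charIdem χ := by
  induction x using MonoidAlgebra.induction_linear with
  | zero => exact ⟨0, by simp⟩
  | add x y hx hy =>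
    obtain ⟨c, hc⟩ := hx
    obtain ⟨d, hd⟩ := hy
    exact ⟨c + d, by rw [add_mul, hc, hd, add_smul]⟩
  | single a r =>
    by_cases ha : a = 0
    · exact ⟨0, by rw [ha, single_zero_mul_charIdem, zero_smul]⟩
    · exact ⟨_, single_unit_mul_charIdem χ (Units.mk0 a ha) r⟩

/-- Extending `χ` by zero to `F` gives an algebra homomorphism `k[F] → k` that sends `e_χ` to `1`.
-/
theorem charIdem_ne_zero [CharZero k] : charIdem χ ≠ 0 := by
  classical
  have := Fintype.ofFinite Fˣ
  intro h
  have h1 := congrArg (MonoidAlgebra.lift k k F (MulChar.ofUnitHom χ).toMonoidHom) h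
  rw [charIdem_eq_sum, map_add, map_smul, map_sum, map_neg, map_zero] at h1
  have h0 : MonoidAlgebra.lift k k F (MulChar.ofUnitHom χ).toMonoidHom
      (if χ = 1 then single (0 : F) (1 : k) else 0) = 0 := by
    split_ifs
    · rw [MonoidAlgebra.lift_single, one_smul]
      exact MulChar.map_zero _
    · exact map_zero _
  have hu : ∀ a : Fˣ, MonoidAlgebra.lift k k F (MulChar.ofUnitHom χ).toMonoidHom
      (single (a : F) (((χ a)⁻¹ : kˣ) : k)) = 1 := fun a => by
    rw [MonoidAlgebra.lift_single]
    simp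
  simp only [h0, hu] at h1
  simp [card_units_cast, card_sub_one_ne_zero] at h1

end CharIdem

/-! ### Endomorphisms of the unit object of the summand. -/

section Unit

variable {k : Type*} [Field k] {F : Type*} [Field F] [Finite F]
  {E : Type u} [Category.{v} E] [Preadditive E] [Linear F E]

omit [Finite F] in
theorem Lin.coeffs_act (X : Lin k E) (x : MonoidAlgebra k F) :
    Lin.coeffs X X (Lin.act X x) = Finsupp.mapDomain (fun a : F => a • 𝟙 X.as) x.coeff := by
  induction x using MonoidAlgebra.induction_linear with
  | zero => simp
  | add x y hx hy =>
    rw [map_add, MonoidAlgebra.coeff_add, Finsupp.mapDomain_add, ← hx, ← hy]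
    exact map_add (Lin.coeffs X X) _ _
  | single a r =>
    rw [Lin.act_single, Lin.coeffs_single]
    simp

omit [Finite F] in
-- Here `End X` is `F`, so `End [X]` is its monoid algebra. For the unit object this identifies `End
-- [𝟙]` with `k[F]`.
theorem Lin.act_bijective {X : Lin k E} (h : Function.Bijective fun a : F => a • 𝟙 X.as) :
    Function.Bijective (Lin.act (F := F) X) := by
  constructor
  · intro x y hxy
    have := congrArg (Lin.coeffs X X) hxy
    rw [Lin.coeffs_act, Lin.coeffs_act] at this
    exact MonoidAlgebra.coeff_injective (Finsupp.mapDomain_injective h.1 this)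
  · intro f
    obtain ⟨x, hx⟩ := Finsupp.mapDomain_surjective h.2 (Lin.coeffs X X f)
    refine ⟨MonoidAlgebra.ofCoeff x, (Lin.coeffs X X).injective ?_⟩
    rw [Lin.coeffs_act]
    exact hx

section

variable {C : Type u} [Category.{v} C] [Preadditive C] [MonoidalCategory C] [MonoidalPreadditive C]
  {R : Type w} [CommRing R] [Linear R C] (τ : IdEnd C) [τ.IsTensorIdempotent]

theorem Summand.smul_id_unit_entry (a : R) :
    (a • 𝟙 (𝟙_ (Summand (AddEnv.idEnd τ)))).hom.f PUnit.unit PUnit.unit = a • τ.app (𝟙_ C) := by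
  have h : (AddEnv.idEnd τ).app (𝟙_ (Mat_ C)) PUnit.unit PUnit.unit = τ.app (𝟙_ C) :=
    AddEnv.perm_apply (M := 𝟙_ (Mat_ C)) (N := 𝟙_ (Mat_ C)) (fun i => i)
      (fun i => τ.app ((𝟙_ (Mat_ C)).X i)) PUnit.unit
  exact congrArg (a • ·) h

/-- The unit is a one-entry tuple cut by `τ`, so an endomorphism of it is a single entry absorbed by
`τ`. -/
theorem Summand.comp_end_unit_entry (f : 𝟙_ (Summand (AddEnv.idEnd τ)) ⟶ 𝟙_ _) :
    τ.app (𝟙_ C) ≫ (f.hom.f PUnit.unit PUnit.unit : 𝟙_ C ⟶ 𝟙_ C) =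
      f.hom.f PUnit.unit PUnit.unit := by
  have h := AddEnv.perm_comp_apply (M := 𝟙_ (Mat_ C)) (N := 𝟙_ (Mat_ C)) (K := 𝟙_ (Mat_ C))
    (fun i => i) (fun i => τ.app ((𝟙_ (Mat_ C)).X i)) f.hom.f PUnit.unit PUnit.unit
  have h' : (AddEnv.idEnd τ).app (𝟙_ (Mat_ C)) ≫ f.hom.f = f.hom.f := Karoubi.p_comp f.hom
  exact h.symm.trans (congrArg (fun g : 𝟙_ (Mat_ C) ⟶ 𝟙_ (Mat_ C) => g PUnit.unit PUnit.unit) h')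

theorem Summand.end_unit_ext {f g : 𝟙_ (Summand (AddEnv.idEnd τ)) ⟶ 𝟙_ _}
    (h : (f.hom.f PUnit.unit PUnit.unit : 𝟙_ C ⟶ 𝟙_ C) = g.hom.f PUnit.unit PUnit.unit) : f = g :=
  ObjectProperty.hom_ext _ (Karoubi.hom_ext _ _ (Mat_.hom_ext _ _ fun _ _ => h))

end

variable [CharZero k] [MonoidalCategory E] [MonoidalPreadditive E] [MonoidalLinear F E]

/-- Through `End [𝟙] = k[F]`, the endomorphisms of the unit become the multiples of `e_χ`, which
form the line `k e_χ`; it is nonzero because `e_χ` is. -/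
theorem unit_bijective (h : Function.Bijective fun a : F => a • 𝟙 (𝟙_ E)) (χ : Fˣ →* kˣ) :
    Function.Bijective fun a : k => a • 𝟙 (𝟙_ (Summand (charEnd E χ))) := by
  have hb : Function.Bijective (Lin.act (F := F) (𝟙_ (Lin k E))) := Lin.act_bijective h
  have := Lin.scalar_isTensorIdempotent (E := E) (charIdem_idem χ)
  change Function.Bijective fun a : k =>
    a • 𝟙 (𝟙_ (Summand (AddEnv.idEnd (Lin.scalar (E := E) (charIdem χ)))))
  have h0 := charIdem_ne_zero χ
  have hmul := exists_mul_charIdem χ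
  generalize charIdem χ = e at *
  have hid : ∀ a : k, (a • 𝟙 (𝟙_ (Summand (AddEnv.idEnd (Lin.scalar (E := E) e))))).hom.f
      PUnit.unit PUnit.unit = Lin.act (𝟙_ (Lin k E)) (a • e) := fun a =>
    (Summand.smul_id_unit_entry _ a).trans (map_smul (Lin.act (𝟙_ (Lin k E))) a e).symm
  constructor
  · intro a b hab
    have hab' := (hid a).symm.trans
      ((congrArg (fun f => f.hom.f PUnit.unit PUnit.unit) hab).trans (hid b))
    exact smul_left_injective k h0 (hb.1 hab')
  · intro f
    obtain ⟨x, hx⟩ := hb.2 (f.hom.f PUnit.unit PUnit.unit)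
    obtain ⟨c, hc⟩ := hmul x
    refine ⟨c, Summand.end_unit_ext _ ((hid c).trans ?_)⟩
    rw [← hc, map_mul, hx]
    exact Summand.comp_end_unit_entry _ f

end Unit

/-! ### Finiteness of Hom spaces and existence of duals in the envelopes. -/

section HomFinite

variable {C : Type u} [Category.{v} C] [Preadditive C] {k : Type w} [Field k] [Linear k C]

theorem finite_hom_mat (h : ∀ X Y : C, Module.Finite k (X ⟶ Y)) (M N : Mat_ C) :
    Module.Finite k (M ⟶ N) :=
  inferInstanceAs (Module.Finite k (∀ i j, M.X i ⟶ N.X j))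

theorem finite_hom_karoubi (h : ∀ X Y : C, Module.Finite k (X ⟶ Y)) (P Q : Karoubi C) :
    Module.Finite k (P ⟶ Q) :=
  Module.Finite.of_injective
    ({ toFun := fun f => f.f, map_add' := fun _ _ => rfl, map_smul' := fun _ _ => rfl } :
      (P ⟶ Q) →ₗ[k] (P.X ⟶ Q.X)) fun _ _ h => Karoubi.hom_ext _ _ h

theorem finite_hom_fullSubcategory (h : ∀ X Y : C, Module.Finite k (X ⟶ Y)) (P : ObjectProperty C)
    (X Y : P.FullSubcategory) : Module.Finite k (X ⟶ Y) :=
  Module.Finite.of_injective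
    ({ toFun := fun f => f.hom, map_add' := fun _ _ => rfl, map_smul' := fun _ _ => rfl } :
      (X ⟶ Y) →ₗ[k] (X.obj ⟶ Y.obj)) fun _ _ h => ObjectProperty.hom_ext _ h

end HomFinite

theorem exists_exactPairing_karoubi_mat_lin {k : Type w} [CommRing k] {E : Type u} [Category.{v} E]
    [MonoidalCategory E] (hE : ∀ X : E, ∃ Y : E, Nonempty (ExactPairing X Y))
    (P : Karoubi (Mat_ (Lin k E))) : ∃ Q, Nonempty (ExactPairing P Q) := by
  choose Y hY using fun i => hE (P.X.X i).as
  have pairing := fun i => (hY i).some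
  let N : Mat_ (Lin k E) := ⟨P.X.ι, fun i => ⟨Y i⟩⟩
  have : ∀ i, ExactPairing (P.X.X i) (N.X (Equiv.refl P.X.ι i)) := fun i =>
    Lin.exactPairing (P.X.X i).as (Y i)
  let _ : HasRightDual P.X := { rightDual := N, exact := AddEnv.exactPairing P.X N (Equiv.refl _) }
  exact ⟨_, ⟨Kar.exactPairing P⟩⟩

end LinPT

/-! ### Assembly of the theorem. -/

theorem theorem1p2 {k : Type*} [Field k] [IsAlgClosed k] [CharZero k]
    {F : Type*} [Field F] [Finite F]
    {E : Type*} [Category* E] [Preadditive E] [Linear F E] [MonoidalCategory E]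
    [SymmetricCategory E] [MonoidalPreadditive E] [MonoidalLinear F E]
    (hE : LinPT.IsPreTannakian F E) (hs : LinPT.IsSemisimple E) (χ : Fˣ →* kˣ) :
    IsIdempotentElem (LinPT.charIdem χ) ∧
    LinPT.IsDirectSummand (LinPT.Kar.idEnd (LinPT.charEnd E χ)).fixed ∧
    LinPT.IsPreTannakian k (LinPT.Summand (LinPT.charEnd E χ)) ∧
    LinPT.IsSemisimple (LinPT.Summand (LinPT.charEnd E χ)) := by
  have hreg : ∀ {X Y : LinPT.Summand (LinPT.charEnd E χ)} (f : X ⟶ Y), LinPT.IsRegularMor f :=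
    fun f => LinPT.isRegularMor_fullSubcategory _
      (LinPT.isRegularMor_karoubi (LinPT.isRegularMor_mat_lin hE hs) _)
  have hfin : ∀ X Y : LinPT.Summand (LinPT.charEnd E χ), Module.Finite k (X ⟶ Y) :=
    LinPT.finite_hom_fullSubcategory (LinPT.finite_hom_karoubi (LinPT.finite_hom_mat
      fun (X Y : LinPT.Lin k E) =>
      have := hE.finite X.as Y.as
      have : Finite (X.as ⟶ Y.as) := Module.finite_of_finite F
      Module.Finite.equiv (LinPT.Lin.coeffs (k := k) X Y).symm)) _
  have := HasFiniteBiproducts.of_hasFiniteProducts (C := LinPT.Summand (LinPT.charEnd E χ))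
  have : HasZeroObject (LinPT.Summand (LinPT.charEnd E χ)) := hasZeroObject_of_hasFiniteBiproducts _
  refine ⟨LinPT.charIdem_idem χ, LinPT.isDirectSummand_fixed _ fun X =>
    LinPT.IdEnd.IsTensorIdempotent.idem X, ?_, LinPT.isSemisimple_of_regular hreg k⟩
  exact
    { hasFiniteProducts := inferInstance
      hasKernels := LinPT.hasKernels_of_regular hreg
      hasCokernels := LinPT.hasCokernels_of_regular hreg
      normalMono := LinPT.isNormalMonoCategory_of_regular hreg
      normalEpi := LinPT.isNormalEpiCategory_of_regular hreg
      finiteLength := LinPT.hasFiniteLength_of_regular hreg k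
      finite := hfin
      rigid := fun P => by
        obtain ⟨Q, ⟨_⟩⟩ := LinPT.exists_exactPairing_karoubi_mat_lin hE.rigid P.obj
        exact LinPT.Summand.exists_exactPairing P Q
      unit := LinPT.unit_bijective hE.unit χ }
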